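/- **Theorem (qIND-qCPA $\Leftrightarrow$ qSEM-qCPA).** A symmetric-key encryption scheme $\mathcal E=(\mathsf{Gen},\mathsf{Enc},\mathsf{Dec})$ is qIND-qCPA secure if and only if it is qSEM-qCPA secure. *Conventions.* Everything is in the non-uniform model: efficient algorithms are families of polynomial-size circuits indexed by the security parameter $n$. Quantum circuits act on qubits by gates from a fixed finite gate set (NOT, Hadamard and $\pi/8$ gates with at most two controls), start their ancillas in $|0\rangle$ and trace out all qubits that are not output. A classical description of a quantum circuit is a bit string that lists its gates; a classical description of a state is a description of an input-free circuit that outputs it. A function $\varepsilon$ is negligible if for every positive polynomial $p$ one has $\varepsilon(n)\le 1/p(n)$ for all large $n$. *Schemes.* $\mathsf{Gen},\mathsf{Enc},\mathsf{Dec}$ are probabilistic polynomial-size classical circuits with uniform random coins, with messages $x\in\{0,1\}^{m}$, keys and ciphertexts in $\{0,1\}^{\ell}$ of polynomial length, and $\mathsf{Dec}(k,\mathsf{Enc}(k,x))=x$ with probability $1$ for every $x$ and every $k$ in the range of $\mathsf{Gen}$. Type-(2) encryption of an $m$-qubit state $\rho$ under $k$ applies $U_{\mathsf{Enc}_k}:|x\rangle|0^{\ell-m}\rangle\mapsto|\mathsf{Enc}_k(x)\rangle$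 with one fresh uniformly random choice of the coins. *qCPA learning phases.* Before and after the challenge, the adversary may apply $|x\rangle|y\rangle\mapsto|x\rangle|y\oplus\mathsf{Enc}_k(x)\rangle$ to registers of its choice, where $k\leftarrow\mathsf{Gen}$ is fixed in the whole game, and each query uses fresh random coins, the same for the whole superposition. *qIND-qCPA.* After the first learning phase the adversary sends classical descriptions of two $m$-qubit states $\rho_0,\rho_1$. The challenger picks a uniform bit $b$ and returns the type-(2) encryption of $\rho_b$. After the second learning phase the adversary outputs a bit and wins if it equals $b$. The scheme is qIND-qCPA secure if for every polynomial-size quantum adversary the winning probability minus $\frac12$ is negligible. *qSEM-qCPA.* After the first learning phase the adversary $\mathcal A$ sends a template $T$: classical descriptions of quantum circuits $G$ (from $\mathrm{poly}(n)$-bit strings $y$ to $m$-qubit plaintexts $\rho_y=G(y)$), $h$ (from $m$ qubits to $\mathrm{poly}(n)$-qubit advice states) and $f$ (from $m$ qubits to $\mathrm{poly}(n)$-qubit target states). The challenger picks a uniform $y$ and returns the type-(2) encryption of $\rho_y$ together with $h(\rho_y)$, computed from two separate copies of $\rho_y$. After the second learning phase $\mathcal A$ outputs a state, and its aim is that this state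 is indistinguishable from $f(\rho_y)$. In the reduced game a simulator $\mathcal S$ also chooses a template, but has no learning phases and receives only $h(\rho_y)$. For a distinguisher $\mathcal D$ (a polynomial-size quantum circuit with inputs $T$, $y$ and a state, and a one-bit output) and a player $\mathcal P\in\{\mathcal A,\mathcal S\}$, let $$\mathrm{Adv}_{\mathcal D,\mathcal P}(n)=\bigl|\Pr[\mathcal D(T,y,\text{output of }\mathcal P)=1]-\Pr[\mathcal D(T,y,f(\rho_y))=1]\bigr|$$ in the game played by $\mathcal P$. The scheme is qSEM-qCPA secure if for every polynomial-size quantum adversary $\mathcal A$ there is a polynomial-size quantum simulator $\mathcal S$ such that, for every $n$, the templates of $\mathcal A$ and $\mathcal S$ are identically distributed, and for every polynomial-size distinguisher $\mathcal D$ the difference $|\mathrm{Adv}_{\mathcal D,\mathcal A}(n)-\mathrm{Adv}_{\mathcal D,\mathcal S}(n)|$ is negligible (that is, the success of $\mathcal A$ and that of $\mathcal S$ are negligibly close). -/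

import Mathlib

open scoped Matrix

namespace QEnc

noncomputable section

/-! ### Registers, bit strings and states -/

/-- Bit strings indexed by a set `W` of wires. -/
abbrev Bits (W : Type) : Type := W → Bool

/-- Operators on the `2 ^ |W|`-dimensional Hilbert space of a register of qubits `W`, written in the
computational basis. Density operators, and the unnormalised operators that arise when a
measurement outcome is recorded, are of this type. -/
abbrev State (W : Type) : Type := Matrix (Bits W) (Bits W) ℂ

/-- The computational basis state `|x⟩⟨x|`. -/
def basisState {W : Type} [DecidableEq W] [Fintype W] (x : Bits W) : State W :=
  Matrix.single x x 1

/-- The tensor product of two operators. -/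
def tensor {A C : Type} (ρ : State A) (σ : State C) : State (A ⊕ C) :=
  Matrix.of fun u v =>
    ρ (fun a => u (Sum.inl a)) (fun a => v (Sum.inl a)) *
      σ (fun c => u (Sum.inr c)) (fun c => v (Sum.inr c))

/-- `U ρ Uᴴ`, for a unitary or, more generally, an isometry `U`. -/
def conjBy {X Y : Type} [Fintype X] (U : Matrix Y X ℂ) (ρ : Matrix X X ℂ) : Matrix Y Y ℂ :=
  U * ρ * Uᴴ

/-- The average of `f` over a finite set, i.e. the expectation for the uniform distribution. -/
def average {X M : Type} [Fintype X] [AddCommMonoid M] [Module ℝ M] (f : X → M) : M :=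
  (Fintype.card X : ℝ)⁻¹ • ∑ x, f x

/-- Measuring the second register in the computational basis with outcome `t`: the unnormalised
state of the first register. Its trace is the probability of the outcome. -/
def measured {A C : Type} (ρ : State (A ⊕ C)) (t : Bits C) : State A :=
  Matrix.of fun u v => ρ (Sum.elim u t) (Sum.elim v t)

/-- The probability that measuring a qubit yields the bit `b`. -/
def probBit (ρ : State (Fin 1)) (b : Bool) : ℝ :=
  (ρ (fun _ => b) (fun _ => b)).re

/-! ### Gates and quantum circuits -/

/-- The elementary one-qubit operations. -/
inductive Op1 where
  | X
  | H
  | T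
  deriving DecidableEq

instance : Fintype Op1 := ⟨{Op1.X, Op1.H, Op1.T}, fun o => by cases o <;> simp⟩

/-- The unitary `2 × 2` matrices of the NOT gate, the Hadamard gate and the `π/8` gate. -/
def Op1.mat : Op1 → Matrix Bool Bool ℂ
  | .X => Matrix.of fun a b => if a = b then 0 else 1
  | .H => Matrix.of fun a b => (if a = true ∧ b = true then -1 else 1) / (Real.sqrt 2 : ℂ)
  | .T => Matrix.of fun a b =>
      if a = b then (if a = true then Complex.exp (Complex.I * (Real.pi / 4 : ℝ)) else 1) else 0

/-- A gate on the wires `W`: a one-qubit operation on the wire `target`, controlled by the wires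
`c₁` and `c₂`. A control that is equal to the target is void, so that uncontrolled gates and gates
with a single control are included. -/
structure Gate (W : Type) where
  op : Op1
  target : W
  c₁ : W
  c₂ : W
  deriving DecidableEq

/-- A gate is given by its four components. -/
def Gate.equivProd (W : Type) : Op1 × W × W × W ≃ Gate W where
  toFun p := ⟨p.1, p.2.1, p.2.2.1, p.2.2.2⟩
  invFun g := ⟨g.op, g.target, g.c₁, g.c₂⟩
  left_inv _ := rfl
  right_inv _ := rfl

instance {W : Type} [Fintype W] : Fintype (Gate W) := Fintype.ofEquiv _ (Gate.equivProd W)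

/-- All (non-void) controls carry the bit `1`. -/
def Gate.Active {W : Type} (g : Gate W) (u : Bits W) : Prop :=
  (g.c₁ = g.target ∨ u g.c₁ = true) ∧ (g.c₂ = g.target ∨ u g.c₂ = true)

open Classical in
/-- The unitary matrix of a gate. -/
def Gate.mat {W : Type} (g : Gate W) : Matrix (Bits W) (Bits W) ℂ :=
  Matrix.of fun u v =>
    if ∀ w, w ≠ g.target → u w = v w then
      if g.Active v then g.op.mat (u g.target) (v g.target)
      else if u g.target = v g.target then 1 else 0
    else 0

/-- A register with input wires `A`, output wires `B` and `work` work wires, before a computation: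
the input wires carry `ρ` and all other wires are in the state `|0⟩`. -/
def prepare {A : Type} (B : Type) (work : ℕ) (ρ : State A) : State (A ⊕ B ⊕ Fin work) :=
  tensor ρ (Matrix.of fun u v =>
    open Classical in if (∀ w, u w = false) ∧ (∀ w, v w = false) then 1 else 0)

/-- The state of the output wires after a computation: all other wires are traced out. -/
def readout {A B : Type} {work : ℕ} [DecidableEq A] [Fintype A]
    (σ : State (A ⊕ B ⊕ Fin work)) : State B :=
  Matrix.of fun u v => ∑ a : Bits A, ∑ z : Bits (Fin work),
    σ (Sum.elim a (Sum.elim u z)) (Sum.elim a (Sum.elim v z))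

/-- A quantum circuit from a register of qubits `A` to a register of qubits `B`. -/
structure QCircuit (A B : Type) where
  work : ℕ
  gates : List (Gate (A ⊕ B ⊕ Fin work))

/-- The quantum channel computed by a circuit. -/
def QCircuit.run {A B : Type} [DecidableEq A] [Fintype A] [DecidableEq B] [Fintype B]
    (C : QCircuit A B) (ρ : State A) : State B :=
  readout (C.gates.foldl (fun σ g => conjBy g.mat σ) (prepare B C.work ρ))

/-- The size of a circuit: number of wires plus number of gates. -/
def QCircuit.size {A B : Type} [Fintype A] [Fintype B] (C : QCircuit A B) : ℕ :=
  Fintype.card A + Fintype.card B + C.work + C.gates.length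

/-! ### Quantum circuits with access to a type-(1) encryption oracle -/

/-- An instruction on the wires `W`: a gate, or a query to the oracle, with `m` message wires and
`l` distinct answer wires. -/
inductive Instr (m l : ℕ) (W : Type) where
  | gate (g : Gate W)
  | query (q : (Fin m ⊕ Fin l) ↪ W)

open Classical in
/-- The permutation `|x, y⟩ ↦ |x, y ⊕ F x⟩` of the computational basis, acting on the wires chosen
by `q`. -/
def xorInto {m l : ℕ} {W : Type} (q : (Fin m ⊕ Fin l) ↪ W) (F : Bits (Fin m) → Bits (Fin l))
    (u : Bits W) : Bits W := fun w =>
  xor (u w) (decide (∃ j : Fin l, q (Sum.inr j) = w ∧ F (fun i => u (q (Sum.inl i))) j = true))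

open Classical in
/-- The type-(1) unitary `|x, y⟩ ↦ |x, y ⊕ F x⟩`. -/
def typeOne {m l : ℕ} {W : Type} (q : (Fin m ⊕ Fin l) ↪ W) (F : Bits (Fin m) → Bits (Fin l)) :
    Matrix (Bits W) (Bits W) ℂ :=
  Matrix.of fun u v => if u = xorInto q F v then 1 else 0

/-- Execution of an instruction. The oracle is given by the function `F r` for each value `r` of its
random coins; every query uses fresh coins, the same ones for the whole superposition. -/
def Instr.exec {m l : ℕ} {W R : Type} [DecidableEq W] [Fintype W] [Fintype R]
    (F : R → Bits (Fin m) → Bits (Fin l)) (σ : State W) : Instr m l W → State W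
  | .gate g => conjBy g.mat σ
  | .query q => average fun r => conjBy (typeOne q (F r)) σ

/-- A quantum oracle circuit from a register `A` to a register `B`. -/
structure OCircuit (m l : ℕ) (A B : Type) where
  work : ℕ
  instrs : List (Instr m l (A ⊕ B ⊕ Fin work))

/-- The quantum channel computed by an oracle circuit. -/
def OCircuit.run {m l : ℕ} {A B R : Type} [DecidableEq A] [Fintype A] [DecidableEq B] [Fintype B]
    [Fintype R] (C : OCircuit m l A B) (F : R → Bits (Fin m) → Bits (Fin l)) (ρ : State A) :
    State B :=
  readout (C.instrs.foldl (fun σ i => i.exec F σ) (prepare B C.work ρ))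

/-- The size of an oracle circuit; a query counts as one gate. -/
def OCircuit.size {m l : ℕ} {A B : Type} [Fintype A] [Fintype B] (C : OCircuit m l A B) : ℕ :=
  Fintype.card A + Fintype.card B + C.work + C.instrs.length

/-! ### Classical descriptions of quantum circuits -/

/-- The format of a circuit description: the number of work wires and a length parameter. -/
structure Format where
  work : ℕ
  slots : ℕ

/-- The size of a format. -/
def Format.size (f : Format) : ℕ := f.work + f.slots

/-- The positions of the bits of a description of a circuit from `A` to `B`: it consists of `slots`
blocks, each with one bit for every gate. -/
structure DescBit (A B : Type) (f : Format) where
  slot : Fin f.slots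
  gate : Gate (A ⊕ B ⊕ Fin f.work)
  deriving DecidableEq

/-- A position is given by a block and a gate. -/
def DescBit.equivProd (A B : Type) (f : Format) :
    Fin f.slots × Gate (A ⊕ B ⊕ Fin f.work) ≃ DescBit A B f where
  toFun p := ⟨p.1, p.2⟩
  invFun b := ⟨b.slot, b.gate⟩
  left_inv _ := rfl
  right_inv _ := rfl

instance {A B : Type} {f : Format} [Fintype A] [Fintype B] : Fintype (DescBit A B f) :=
  Fintype.ofEquiv _ (DescBit.equivProd A B f)

/-- All gates on the wires `W`, in lexicographic order. -/
def allGates (W : Type) [FinEnum W] : List (Gate W) :=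
  [Op1.X, Op1.H, Op1.T].flatMap fun o =>
    (FinEnum.toList W).flatMap fun t =>
      (FinEnum.toList W).flatMap fun c =>
        (FinEnum.toList W).map fun c' => ⟨o, t, c, c'⟩

/-- The circuit described by a bit string. The bits of the string say which of the gates in
`slots` repetitions of the list of all gates are present. Every circuit with at most `slots` gates
has such a description, which uses at most one gate of each block. -/
def decode {A B : Type} [FinEnum A] [FinEnum B] {f : Format} (d : Bits (DescBit A B f)) :
    QCircuit A B where
  work := f.work
  gates := (List.finRange f.slots).flatMap fun s =>
    (allGates (A ⊕ B ⊕ Fin f.work)).filter fun g => d ⟨s, g⟩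

/-! ### Asymptotics -/

/-- Polynomially bounded functions. -/
def PolyBounded (f : ℕ → ℕ) : Prop :=
  ∃ (p : Polynomial ℕ) (n₀ : ℕ), ∀ n ≥ n₀, f n ≤ p.eval n

/-- Negligible functions: eventually at most `1 / p` for every positive polynomial `p`. -/
def Negligible (ε : ℕ → ℝ) : Prop :=
  ∀ p : Polynomial ℝ, (∀ n : ℕ, 0 < p.eval (n : ℝ)) →
    ∃ n₀ : ℕ, ∀ n ≥ n₀, ε n ≤ 1 / p.eval (n : ℝ)

/-! ### Classical secret-key encryption schemes -/

/-- A classical circuit from a bit string on `A` to a bit string on `B`, consisting of NOT gates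
with at most two controls (NOT, CNOT, Toffoli), with work bits that are initially `0`. -/
structure CCircuit (A B : Type) where
  work : ℕ
  gates : List ((A ⊕ B ⊕ Fin work) × (A ⊕ B ⊕ Fin work) × (A ⊕ B ⊕ Fin work))

open Classical in
/-- The action of a NOT gate on the first wire that is controlled by the other two wires; a control
that is equal to the target is void. -/
def applyNot {W : Type} (g : W × W × W) (u : Bits W) : Bits W :=
  if (Gate.mk Op1.X g.1 g.2.1 g.2.2).Active u then Function.update u g.1 (!u g.1) else u

/-- The function computed by a classical circuit. -/
def CCircuit.eval {A B : Type} (C : CCircuit A B) (x : Bits A) : Bits B := fun b =>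
  C.gates.foldl (fun u g => applyNot g u) (Sum.elim x fun _ => false) (Sum.inr (Sum.inl b))

/-- The size of a classical circuit. -/
def CCircuit.size {A B : Type} [Fintype A] [Fintype B] (C : CCircuit A B) : ℕ :=
  Fintype.card A + Fintype.card B + C.work + C.gates.length

/-- A secret-key encryption scheme: for each security parameter `n`, probabilistic algorithms for
key generation, encryption and decryption, given by circuits of polynomial size whose last input
(the only input of `Gen`) is a string of uniformly random coins. -/
structure Scheme where
  keyLen : ℕ → ℕ
  msgLen : ℕ → ℕ
  ctLen : ℕ → ℕ
  genCoins : ℕ → ℕ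
  encCoins : ℕ → ℕ
  decCoins : ℕ → ℕ
  Gen : ∀ n, CCircuit (Fin (genCoins n)) (Fin (keyLen n))
  Enc : ∀ n, CCircuit (Fin (keyLen n) ⊕ Fin (msgLen n) ⊕ Fin (encCoins n)) (Fin (ctLen n))
  Dec : ∀ n, CCircuit (Fin (keyLen n) ⊕ Fin (ctLen n) ⊕ Fin (decCoins n)) (Fin (msgLen n))
  gen_poly : PolyBounded fun n => (Gen n).size
  enc_poly : PolyBounded fun n => (Enc n).size
  dec_poly : PolyBounded fun n => (Dec n).size
  correct : ∀ n (g : Bits (Fin (genCoins n))) (x : Bits (Fin (msgLen n)))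
    (r : Bits (Fin (encCoins n))) (s : Bits (Fin (decCoins n))),
    (Dec n).eval (Sum.elim ((Gen n).eval g)
      (Sum.elim ((Enc n).eval (Sum.elim ((Gen n).eval g) (Sum.elim x r))) s)) = x

namespace Scheme

variable (E : Scheme) (n : ℕ)

/-- The key that is generated from the coins `g`. -/
def key (g : Bits (Fin (E.genCoins n))) : Bits (Fin (E.keyLen n)) := (E.Gen n).eval g

/-- `Enc_k(x)` with random coins `r`. -/
def enc (k : Bits (Fin (E.keyLen n))) (r : Bits (Fin (E.encCoins n)))
    (x : Bits (Fin (E.msgLen n))) : Bits (Fin (E.ctLen n)) :=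
  (E.Enc n).eval (Sum.elim k (Sum.elim x r))

/-- Type-(2) encryption with coins `r`: the map `|x⟩ ↦ |Enc_k(x)⟩`. It is an isometry for every key
in the range of `Gen`, and it is the restriction of the type-(2) unitary to ancillas `|0⟩`. -/
def typeTwo (k : Bits (Fin (E.keyLen n))) (r : Bits (Fin (E.encCoins n))) :
    Matrix (Bits (Fin (E.ctLen n))) (Bits (Fin (E.msgLen n))) ℂ :=
  Matrix.of fun c x => if c = E.enc n k r x then 1 else 0

/-- The type-(2) encryption of a plaintext state with fresh random coins. -/
def encState (k : Bits (Fin (E.keyLen n))) (ρ : State (Fin (E.msgLen n))) :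
    State (Fin (E.ctLen n)) :=
  average fun r => conjBy (E.typeTwo n k r) ρ

end Scheme

/-! ### The qIND-qCPA game -/

/-- The classical description of an `m`-qubit state: a circuit without input that outputs it. -/
abbrev StateDescBit (m : ℕ) (f : Format) : Type := DescBit (Fin 0) (Fin m) f

/-- The state with classical description `d`. -/
def describedState {m : ℕ} {f : Format} (d : Bits (StateDescBit m f)) : State (Fin m) :=
  (decode d).run (basisState fun _ => false)

/-- A qIND-qCPA adversary for a fixed security parameter. In the first learning phase it computes
two classical descriptions, which are measured and sent to the challenger, and an internal state
of `mem` qubits; in the second one it obtains the internal state and the challenge and computes its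
guess. -/
structure INDAdversary (m l : ℕ) where
  fmt : Format
  mem : ℕ
  choose : OCircuit m l (Fin 0) (Fin mem ⊕ (StateDescBit m fmt ⊕ StateDescBit m fmt))
  guess : OCircuit m l (Fin mem ⊕ Fin l) (Fin 1)

/-- The size of a qIND-qCPA adversary. -/
def INDAdversary.size {m l : ℕ} (a : INDAdversary m l) : ℕ :=
  a.fmt.size + a.choose.size + a.guess.size

/-- The success probability of the adversary in the qIND-qCPA game. -/
def indSuccess (E : Scheme) (n : ℕ) (a : INDAdversary (E.msgLen n) (E.ctLen n)) : ℝ :=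
  average fun g : Bits (Fin (E.genCoins n)) => average fun b : Bool =>
    ∑ t : Bits (StateDescBit (E.msgLen n) a.fmt ⊕ StateDescBit (E.msgLen n) a.fmt),
      probBit
        (a.guess.run (E.enc n (E.key n g))
          (tensor
            (measured (a.choose.run (E.enc n (E.key n g)) (basisState fun _ => false)) t)
            (E.encState n (E.key n g)
              (describedState fun i => t (if b then Sum.inr i else Sum.inl i)))))
        b

/-- qIND-qCPA security: every polynomial-size quantum adversary wins with probability at most
negligibly larger than `1/2`. -/
def QINDqCPA (E : Scheme) : Prop :=
  ∀ a : ∀ n, INDAdversary (E.msgLen n) (E.ctLen n), PolyBounded (fun n => (a n).size) →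
    Negligible fun n => indSuccess E n (a n) - 1 / 2

/-! ### The qSEM-qCPA game -/

/-- The (polynomial) lengths that occur in a qSEM challenge template. -/
structure TemplateShape where
  seed : ℕ
  advice : ℕ
  target : ℕ
  fmtG : Format
  fmtH : Format
  fmtF : Format

/-- The size of a template shape. -/
def TemplateShape.size (s : TemplateShape) : ℕ :=
  s.seed + s.advice + s.target + s.fmtG.size + s.fmtH.size + s.fmtF.size

/-- The bits of a challenge template: descriptions of a circuit from seeds to plaintexts, of an
advice circuit and of a target circuit. -/
abbrev TemplateBit (m : ℕ) (s : TemplateShape) : Type :=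
  DescBit (Fin s.seed) (Fin m) s.fmtG ⊕
    (DescBit (Fin m) (Fin s.advice) s.fmtH ⊕ DescBit (Fin m) (Fin s.target) s.fmtF)

section Template

variable {m : ℕ} {s : TemplateShape} (T : Bits (TemplateBit m s)) (y : Bits (Fin s.seed))

/-- The plaintext state `ρ_y = G_m(y)`. -/
def plaintext : State (Fin m) :=
  (decode fun i => T (Sum.inl i)).run (basisState y)

/-- The advice state `h_m(ρ_y)`. -/
def adviceState : State (Fin s.advice) :=
  (decode fun i => T (Sum.inr (Sum.inl i))).run (plaintext T y)

/-- The target state `f_m(ρ_y)`. -/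
def targetState : State (Fin s.target) :=
  (decode fun i => T (Sum.inr (Sum.inr i))).run (plaintext T y)

end Template

/-- A qSEM-qCPA adversary for a fixed security parameter. The template that is computed in the first
phase is measured and sent to the challenger. -/
structure SEMAdversary (m l : ℕ) where
  shape : TemplateShape
  mem : ℕ
  choose : OCircuit m l (Fin 0) (Fin mem ⊕ TemplateBit m shape)
  respond : OCircuit m l (Fin mem ⊕ (Fin l ⊕ Fin shape.advice)) (Fin shape.target)

/-- The size of a qSEM-qCPA adversary. -/
def SEMAdversary.size {m l : ℕ} (a : SEMAdversary m l) : ℕ :=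
  a.shape.size + a.choose.size + a.respond.size

/-- A simulator, which plays the reduced game: it has no oracle and receives no ciphertext. Its
templates have the lengths `shape`. -/
structure Simulator (m : ℕ) (shape : TemplateShape) where
  mem : ℕ
  choose : QCircuit (Fin 0) (Fin mem ⊕ TemplateBit m shape)
  respond : QCircuit (Fin mem ⊕ Fin shape.advice) (Fin shape.target)

/-- The size of a simulator. -/
def Simulator.size {m : ℕ} {shape : TemplateShape} (S : Simulator m shape) : ℕ :=
  S.choose.size + S.respond.size

section Real

variable (E : Scheme) (n : ℕ) (a : SEMAdversary (E.msgLen n) (E.ctLen n))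

/-- The internal state of the adversary after the first phase, for a fixed key, when the template is
`T`; its trace is the probability of `T`. -/
def advMemory (k : Bits (Fin (E.keyLen n))) (T : Bits (TemplateBit (E.msgLen n) a.shape)) :
    State (Fin a.mem) :=
  measured (a.choose.run (E.enc n k) (basisState fun _ => false)) T

/-- The probability that the adversary chooses the template `T`. -/
def advTemplateProb (T : Bits (TemplateBit (E.msgLen n) a.shape)) : ℝ :=
  average fun g : Bits (Fin (E.genCoins n)) => (advMemory E n a (E.key n g) T).trace.re

/-- The output state of the adversary in the qSEM-qCPA game when the template is `T` and the seed is
`y`, weighted with the probability of `T`. -/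
def advOutput (T : Bits (TemplateBit (E.msgLen n) a.shape)) (y : Bits (Fin a.shape.seed)) :
    State (Fin a.shape.target) :=
  average fun g : Bits (Fin (E.genCoins n)) =>
    a.respond.run (E.enc n (E.key n g))
      (tensor (advMemory E n a (E.key n g) T)
        (tensor (E.encState n (E.key n g) (plaintext T y)) (adviceState T y)))

end Real

section Reduced

variable {m : ℕ} {shape : TemplateShape} (S : Simulator m shape)

/-- The internal state of the simulator when the template is `T`. -/
def simMemory (T : Bits (TemplateBit m shape)) : State (Fin S.mem) :=
  measured (S.choose.run (basisState fun _ => false)) T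

/-- The probability that the simulator chooses the template `T`. -/
def simTemplateProb (T : Bits (TemplateBit m shape)) : ℝ := (simMemory S T).trace.re

/-- The output state of the simulator in the reduced game when the template is `T` and the seed is
`y`, weighted with the probability of `T`. -/
def simOutput (T : Bits (TemplateBit m shape)) (y : Bits (Fin shape.seed)) :
    State (Fin shape.target) :=
  S.respond.run (tensor (simMemory S T) (adviceState T y))

end Reduced

/-- A distinguisher, which is given the template, the seed `y` and either the output of a player or
the target state `f_m(ρ_y)`, and outputs a bit. -/
abbrev Distinguisher (m : ℕ) (shape : TemplateShape) : Type :=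
  QCircuit (TemplateBit m shape ⊕ (Fin shape.seed ⊕ Fin shape.target)) (Fin 1)

/-- The probability that the distinguisher outputs `1` for the template `T`, the seed `y` and the
state `ρ`. -/
def accept {m : ℕ} {shape : TemplateShape} (D : Distinguisher m shape)
    (T : Bits (TemplateBit m shape)) (y : Bits (Fin shape.seed)) (ρ : State (Fin shape.target)) :
    ℝ :=
  probBit (D.run (tensor (basisState T) (tensor (basisState y) ρ))) true

/-- The advantage of a distinguisher in distinguishing the output of a player from the target state,
for templates with distribution `prob` and uniform seeds, where `out T y` is the output of the
player weighted with the probability of `T`. -/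
def advantage {m : ℕ} {shape : TemplateShape} (D : Distinguisher m shape)
    (prob : Bits (TemplateBit m shape) → ℝ)
    (out : Bits (TemplateBit m shape) → Bits (Fin shape.seed) → State (Fin shape.target)) : ℝ :=
  |(average fun y => ∑ T, accept D T y (out T y)) -
    average fun y => ∑ T, prob T * accept D T y (targetState T y)|

/-- qSEM-qCPA security: every polynomial-size quantum adversary has a polynomial-size quantum
simulator that produces identically distributed templates and whose success in the reduced game is
negligibly close to that of the adversary in the qSEM-qCPA game. Success means that the output is
indistinguishable from the target, and is measured by the advantages of all polynomial-size
distinguishers. -/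
def QSEMqCPA (E : Scheme) : Prop :=
  ∀ a : ∀ n, SEMAdversary (E.msgLen n) (E.ctLen n), PolyBounded (fun n => (a n).size) →
    ∃ S : ∀ n, Simulator (E.msgLen n) (a n).shape,
      PolyBounded (fun n => (S n).size) ∧
      (∀ n T, simTemplateProb (S n) T = advTemplateProb E n (a n) T) ∧
      ∀ D : ∀ n, Distinguisher (E.msgLen n) (a n).shape, PolyBounded (fun n => (D n).size) →
        Negligible fun n =>
          |advantage (D n) (advTemplateProb E n (a n)) (advOutput E n (a n)) -
            advantage (D n) (simTemplateProb (S n)) (simOutput (S n))|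

end

end QEnc

/-! Both implications are reductions, and most of the work is to build circuits that carry them out
with exact output states and explicit size bounds.

From qIND to qSEM. Given a qSEM adversary A, the simulator draws its own key with Gen, runs A while
answering the encryption queries with that key, and hands A an encryption of |0…0⟩ in place of the
challenge, together with the genuine advice (`exists_simulator`). Its templates are distributed
exactly as those of A, so the target terms of the two advantages coincide and cancel. What remains
is the gap between the probabilities that the distinguisher D accepts the answer of A when the
challenge encrypts ρ_y and when it encrypts |0…0⟩. A qIND adversary measures this gap: it runs A,
records the template, samples y, submits descriptions of ρ_y and of |0…0⟩, computes the advice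
itself, finishes the run of A and outputs the bit of D. It wins with probability 1/2 plus half the
signed gap; exchanging the two descriptions covers the other sign (`exists_hybrid_adversaries`).

From qSEM to qIND. Given a qIND adversary, take the template whose one-bit seed y selects one of the
two submitted states, with no advice and with constant target |0⟩; the answer of the player is the
guess. The distinguisher tests whether the answer equals y. It accepts the target with probability
1/2, the adversary with the qIND success probability, and any simulator with probability 1/2, since
nothing the simulator receives depends on y. Hence the difference of the advantages is the distance
of the success probability from 1/2 (`exists_semAdversary`).

Three constructions make these parties efficient. A described circuit is run by a universal circuit,
which applies every gate a description could contain, controlled by the corresponding bit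
(`Transforms.universal`). New descriptions are obtained from old ones by copying bits and inserting
constants, so CNOT and NOT gates suffice (`decode_describe`). An encryption query is emulated with a
known key by computing the ciphertext, adding it to the answer wires and uncomputing
(`Transforms.query`).

Circuits are assembled in the form of `Proc`, where output wires may be chosen freely, and reasoned
about through `Transforms`, where one procedure serves a whole family of inputs. Operators are
neither assumed positive nor normalised, so linearity reduces statements about entangled states to
product operators (`ext_tensor`) and statements about mixtures to their terms (`Transforms.sum`,
`Transforms.average`). -/

set_option linter.unusedSectionVars false
set_option linter.unusedSimpArgs false

namespace QEnc
noncomputable section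

/-! ### Linear algebra of registers: basis maps, tensor products, partial trace -/

section Linear

/-! ### Operators given by maps of the computational basis -/

variable {A B C V W X : Type} [Fintype A] [DecidableEq A] [Fintype B] [DecidableEq B]
  [Fintype C] [DecidableEq C] [Fintype V] [DecidableEq V] [Fintype W] [DecidableEq W]
  [Fintype X] [DecidableEq X]

/-- The matrix of the map `|x⟩ ↦ |f x⟩`. -/
def ketMap (f : Bits A → Bits B) : Matrix (Bits B) (Bits A) ℂ :=
  Matrix.of fun y x => if y = f x then 1 else 0

/-- Transport of an operator along a map of the computational basis. -/
def push (f : Bits A → Bits B) (σ : State A) : State B := conjBy (ketMap f) σ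

theorem conjBy_linear {X Y : Type} [Fintype X] (U : Matrix Y X ℂ) :
    IsLinearMap ℂ (conjBy U) where
  map_add x y := by simp [conjBy, Matrix.mul_add, Matrix.add_mul]
  map_smul c x := by simp [conjBy]

theorem conjBy_mul {X Y Z : Type} [Fintype X] [Fintype Y] (U : Matrix Z Y ℂ) (V : Matrix Y X ℂ)
    (σ : Matrix X X ℂ) : conjBy (U * V) σ = conjBy U (conjBy V σ) := by
  simp [conjBy, Matrix.conjTranspose_mul, Matrix.mul_assoc]

theorem conjBy_one {X : Type} [Fintype X] [DecidableEq X] (σ : Matrix X X ℂ) :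
    conjBy 1 σ = σ := by simp [conjBy]

theorem mul_ketMap_apply {Y : Type} (M : Matrix Y (Bits B) ℂ) (f : Bits A → Bits B) (y : Y)
    (x : Bits A) : (M * ketMap f) y x = M y (f x) := by
  simp [Matrix.mul_apply, ketMap]

theorem ketMap_mul_ketMap (f : Bits B → Bits C) (g : Bits A → Bits B) :
    ketMap f * ketMap g = ketMap (f ∘ g) := by
  ext y x
  rw [mul_ketMap_apply]
  simp [ketMap]

theorem push_push (f : Bits B → Bits C) (g : Bits A → Bits B) (σ : State A) :
    push f (push g σ) = push (f ∘ g) σ := by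
  rw [push, push, ← conjBy_mul, ketMap_mul_ketMap, push]

theorem push_linear (f : Bits A → Bits B) : IsLinearMap ℂ (push f) := conjBy_linear _

theorem push_apply (f : Bits A → Bits B) (σ : State A) (u v : Bits B) :
    push f σ u v = ∑ y, ∑ x, if u = f x ∧ v = f y then σ x y else 0 := by
  simp only [push, conjBy, Matrix.mul_apply, Matrix.conjTranspose_apply, ketMap, Matrix.of_apply]
  refine Finset.sum_congr rfl fun y _ => ?_
  by_cases h : v = f y <;> simp [h]

theorem push_single (f : Bits A → Bits B) (x y : Bits A) (c : ℂ) :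
    push f (Matrix.single x y c) = Matrix.single (f x) (f y) c := by
  ext u v
  rw [push_apply, Finset.sum_eq_single y, Finset.sum_eq_single x]
  · simp [Matrix.single_apply, eq_comm]
  · intro x' _ hx
    simp [Matrix.single_apply, hx.symm]
  · simp
  · intro y' _ hy
    simp [Matrix.single_apply, hy.symm]
  · simp

theorem push_basisState (f : Bits A → Bits B) (x : Bits A) :
    push f (basisState x) = basisState (f x) := push_single f x x 1

/-- Renaming of the wires of an operator. -/
def relabel (e : A ≃ B) (σ : State A) : State B := Matrix.of fun u v => σ (u ∘ e) (v ∘ e)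

theorem relabel_linear (e : A ≃ B) : IsLinearMap ℂ (relabel e) where
  map_add _ _ := rfl
  map_smul _ _ := rfl

theorem relabel_relabel (e : A ≃ B) (e' : B ≃ C) (σ : State A) :
    relabel e' (relabel e σ) = relabel (e.trans e') σ := rfl

theorem comp_symm_eq_iff {e : A ≃ B} {x : Bits A} {u : Bits B} :
    u = x ∘ e.symm ↔ x = u ∘ e := by
  constructor
  · rintro rfl; funext a; simp
  · rintro rfl; funext a; simp

theorem relabel_eq_push (e : A ≃ B) (σ : State A) :
    relabel e σ = push (fun u => u ∘ e.symm) σ := by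
  ext u v
  rw [push_apply, Finset.sum_eq_single (v ∘ e), Finset.sum_eq_single (u ∘ e)]
  · simp [comp_symm_eq_iff, relabel]
  · intro x _ hx
    simp [comp_symm_eq_iff, hx]
  · simp
  · intro x _ hx
    simp [comp_symm_eq_iff, hx]
  · simp

theorem relabel_basisState (e : A ≃ B) (x : Bits A) :
    relabel e (basisState x) = basisState (x ∘ e.symm) := by
  rw [relabel_eq_push, push_basisState]

/-! ### Tensor products -/

theorem sumElim_eq_iff {A C : Type} {x : Bits A} {y : Bits C} {u : Bits (A ⊕ C)} :
    u = Sum.elim x y ↔ (u ∘ Sum.inl = x ∧ u ∘ Sum.inr = y) := by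
  constructor
  · rintro rfl; exact ⟨rfl, rfl⟩
  · rintro ⟨rfl, rfl⟩; simp

theorem sum_bits_sum {M : Type*} [AddCommMonoid M] (f : Bits (A ⊕ C) → M) :
    ∑ u, f u = ∑ x : Bits A, ∑ y : Bits C, f (Sum.elim x y) := by
  rw [← Fintype.sum_prod_type']
  exact Fintype.sum_equiv (Equiv.sumArrowEquivProdArrow A C Bool) _ _ fun u => by
    simp [Equiv.sumArrowEquivProdArrow]

theorem tensor_left_linear (τ : State C) :
    IsLinearMap ℂ (fun ρ : State A => tensor ρ τ) where
  map_add x y := by ext u v; simp [tensor, add_mul]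
  map_smul c x := by ext u v; simp [tensor, mul_assoc]

theorem tensor_right_linear (ρ : State A) :
    IsLinearMap ℂ (fun τ : State C => tensor ρ τ) where
  map_add x y := by ext u v; simp [tensor, mul_add]
  map_smul c x := by ext u v; simp [tensor, mul_left_comm]

theorem tensor_mul (M M' : State A) (N N' : State C) :
    tensor M N * tensor M' N' = tensor (M * M') (N * N') := by
  ext u v
  simp only [Matrix.mul_apply, sum_bits_sum, tensor, Matrix.of_apply, Sum.elim_inl, Sum.elim_inr,
    Finset.sum_mul_sum]
  exact Finset.sum_congr rfl fun x _ => Finset.sum_congr rfl fun y _ => by ring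

theorem tensor_conjTranspose (M : State A) (N : State C) :
    (tensor M N)ᴴ = tensor Mᴴ Nᴴ := by
  ext u v
  simp [tensor]

theorem conjBy_tensor (M ρ : State A) (N τ : State C) :
    conjBy (tensor M N) (tensor ρ τ) = tensor (conjBy M ρ) (conjBy N τ) := by
  simp only [conjBy, tensor_conjTranspose, tensor_mul]

theorem tensor_single (x x' : Bits A) (y y' : Bits C) :
    tensor (Matrix.single x x' (1 : ℂ)) (Matrix.single y y' (1 : ℂ)) =
      Matrix.single (Sum.elim x y) (Sum.elim x' y') 1 := by
  ext u v
  simp only [tensor, Matrix.of_apply, Matrix.single_apply, eq_comm (b := u), eq_comm (b := v),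
    sumElim_eq_iff, funext_iff, Function.comp]
  split_ifs <;> simp_all

theorem tensor_basisState (x : Bits A) (y : Bits C) :
    tensor (basisState x) (basisState y) = basisState (Sum.elim x y) := tensor_single x x y y

/-- Adjoining wires in a known basis state is the isometry |u⟩ ↦ |u, y⟩. In this form it merges with
subsequent permutations of the basis through `push_push`, and an identity of channels becomes an
identity of maps on bit strings. -/
theorem tensor_basisState_eq_push (σ : State A) (y : Bits C) :
    tensor σ (basisState y) = push (fun u => Sum.elim u y) σ := by
  ext u v
  rw [push_apply, Finset.sum_eq_single (v ∘ Sum.inl), Finset.sum_eq_single (u ∘ Sum.inl)]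
  · simp only [sumElim_eq_iff, tensor, basisState, Matrix.single_apply, Matrix.of_apply,
      true_and, Function.comp_def, eq_comm (a := y)]
    split_ifs <;> simp_all
  · intro x _ hx
    simp [sumElim_eq_iff, hx.symm]
  · simp
  · intro x _ hx
    simp [sumElim_eq_iff, hx.symm]
  · simp

theorem sum_smul_single (σ : State A) :
    σ = ∑ x, ∑ y, σ x y • (Matrix.single x y 1 : State A) := by
  conv_lhs => rw [Matrix.matrix_eq_sum_single σ]
  simp [Matrix.smul_single]

theorem linear_sum {M N κ : Type*} [AddCommMonoid M] [Module ℂ M] [AddCommMonoid N]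
    [Module ℂ N] {f : M → N} (hf : IsLinearMap ℂ f) (s : Finset κ) (c : κ → M) :
    f (∑ j ∈ s, c j) = ∑ j ∈ s, f (c j) := map_sum (IsLinearMap.mk' f hf) c s

theorem linear_average {M N κ : Type} [Fintype κ] [AddCommGroup M] [Module ℂ M]
    [AddCommGroup N] [Module ℂ N] {f : M → N} (hf : IsLinearMap ℂ f) (c : κ → M) :
    f (average c) = average fun j => f (c j) := by
  simp only [average, RCLike.real_smul_eq_coe_smul (K := ℂ)]
  rw [hf.map_smul, linear_sum hf]

theorem linear_comp {M N P : Type*} [AddCommMonoid M] [Module ℂ M] [AddCommMonoid N]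
    [Module ℂ N] [AddCommMonoid P] [Module ℂ P] {f : N → P} {g : M → N} (hf : IsLinearMap ℂ f)
    (hg : IsLinearMap ℂ g) : IsLinearMap ℂ (fun x => f (g x)) where
  map_add x y := by rw [hg.map_add, hf.map_add]
  map_smul c x := by rw [hg.map_smul, hf.map_smul]

/-- Matrix units span the space of operators. -/
theorem ext_single {M : Type*} [AddCommMonoid M] [Module ℂ M] {f g : State A → M}
    (hf : IsLinearMap ℂ f) (hg : IsLinearMap ℂ g)
    (h : ∀ x y, f (Matrix.single x y 1) = g (Matrix.single x y 1)) (σ : State A) : f σ = g σ := by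
  rw [sum_smul_single σ]
  simp only [linear_sum hf, linear_sum hg, hf.map_smul, hg.map_smul, h]

/-- A matrix unit of a composite register is a product of matrix units, so product operators span.
This is the tool that disposes of entanglement between registers. -/
theorem ext_tensor {M : Type*} [AddCommMonoid M] [Module ℂ M] {f g : State (A ⊕ C) → M}
    (hf : IsLinearMap ℂ f) (hg : IsLinearMap ℂ g)
    (h : ∀ ρ τ, f (tensor ρ τ) = g (tensor ρ τ)) (σ : State (A ⊕ C)) : f σ = g σ := by
  refine ext_single hf hg (fun x y => ?_) σ
  have := h (Matrix.single (x ∘ Sum.inl) (y ∘ Sum.inl) 1)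
    (Matrix.single (x ∘ Sum.inr) (y ∘ Sum.inr) 1)
  rw [tensor_single] at this
  simpa using this

/-! ### Partial trace -/

/-- The partial trace over the second register. -/
def trOut (σ : State (B ⊕ C)) : State B :=
  Matrix.of fun u v => ∑ j : Bits C, σ (Sum.elim u j) (Sum.elim v j)

theorem trOut_linear : IsLinearMap ℂ (trOut : State (B ⊕ C) → State B) where
  map_add x y := by ext u v; simp [trOut, Finset.sum_add_distrib]
  map_smul c x := by ext u v; simp [trOut, Finset.mul_sum]

theorem trOut_tensor (ρ : State B) (τ : State C) : trOut (tensor ρ τ) = τ.trace • ρ := by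
  ext u v
  simp [trOut, tensor, Matrix.trace, Finset.sum_mul, Finset.mul_sum, mul_comm]

theorem trace_basisState (x : Bits A) : (basisState x).trace = 1 := by
  simp [basisState]

theorem trOut_tensor_basisState (ρ : State B) (x : Bits C) :
    trOut (tensor ρ (basisState x)) = ρ := by
  rw [trOut_tensor, trace_basisState, one_smul]

theorem trace_trOut (σ : State (B ⊕ C)) : (trOut σ).trace = σ.trace := by
  simp [trOut, Matrix.trace, sum_bits_sum]

theorem trace_tensor (ρ : State B) (τ : State C) :
    (tensor ρ τ).trace = ρ.trace * τ.trace := by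
  simp [tensor, Matrix.trace, sum_bits_sum, Finset.sum_mul_sum]

theorem trace_relabel (e : A ≃ B) (σ : State A) : (relabel e σ).trace = σ.trace := by
  simp only [relabel, Matrix.trace, Matrix.diag, Matrix.of_apply]
  exact Fintype.sum_equiv (e.arrowCongr (Equiv.refl Bool)).symm _ _ fun u => by
    congr 1

end Linear

end
end QEnc

namespace QEnc
noncomputable section

/-! ### Locality of gates and queries; reversible classical gates -/

section Gates

variable {A B C V W X : Type} [Fintype A] [DecidableEq A] [Fintype B] [DecidableEq B]
  [Fintype C] [DecidableEq C] [Fintype V] [DecidableEq V] [Fintype W] [DecidableEq W]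
  [Fintype X] [DecidableEq X] {m l : ℕ} {R : Type} [Fintype R]

/-! ### Moving gates and instructions to other wires -/

/-- Renaming of the wires of a gate. -/
def Gate.map (f : V → W) (g : Gate V) : Gate W := ⟨g.op, f g.target, f g.c₁, f g.c₂⟩

/-- Renaming of the wires of an instruction. -/
def Instr.map (f : V ↪ W) : Instr m l V → Instr m l W
  | .gate g => .gate (g.map f)
  | .query q => .query (q.trans f)

theorem relabel_mul (e : A ≃ B) (M N : State A) :
    relabel e (M * N) = relabel e M * relabel e N := by
  ext u v
  simp only [relabel, Matrix.mul_apply, Matrix.of_apply]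
  exact (Fintype.sum_equiv (e.arrowCongr (Equiv.refl Bool)).symm _ _ fun u => rfl).symm

theorem conjBy_relabel (e : A ≃ B) (M σ : State A) :
    conjBy (relabel e M) (relabel e σ) = relabel e (conjBy M σ) := by
  rw [conjBy, conjBy, relabel_mul, relabel_mul]
  rfl

theorem Gate.active_map {f : V → W} (hf : Function.Injective f) (g : Gate V) (u : Bits W) :
    (g.map f).Active u ↔ g.Active (u ∘ f) := by
  simp [Gate.Active, Gate.map, hf.eq_iff]

theorem Gate.mat_eq_zero (g : Gate W) {u v : Bits W} (h : ¬ ∀ w, w ≠ g.target → u w = v w) :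
    g.mat u v = 0 := by
  simp [Gate.mat, if_neg h]

theorem Gate.mat_active (g : Gate W) {u v : Bits W} (h : ∀ w, w ≠ g.target → u w = v w)
    (hA : g.Active v) : g.mat u v = g.op.mat (u g.target) (v g.target) := by
  rw [Gate.mat, Matrix.of_apply, if_pos h, if_pos hA]

theorem Gate.mat_inactive (g : Gate W) {v : Bits W} (u : Bits W) (hA : ¬ g.Active v) :
    g.mat u v = (1 : State W) u v := by
  by_cases h : ∀ w, w ≠ g.target → u w = v w
  · rw [Gate.mat, Matrix.of_apply, if_pos h, if_neg hA, Matrix.one_apply]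
    have : u = v ↔ u g.target = v g.target := by
      refine ⟨fun h' => by rw [h'], fun h' => funext fun w => ?_⟩
      by_cases hw : w = g.target
      · rw [hw, h']
      · exact h w hw
    simp only [this]
  · rw [Gate.mat_eq_zero _ h, Matrix.one_apply_ne]
    rintro rfl
    exact h fun _ _ => rfl

theorem Gate.mat_map_equiv (e : V ≃ W) (g : Gate V) : (g.map e).mat = relabel e g.mat := by
  ext u v
  have key : (∀ w, w ≠ (g.map e).target → u w = v w) ↔
      ∀ w, w ≠ g.target → (u ∘ e) w = (v ∘ e) w := by
    constructor
    · intro h w hw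
      exact h _ (by simpa [Gate.map] using hw)
    · intro h w hw
      have := h (e.symm w) (by rintro h'; apply hw; simp [Gate.map, ← h'])
      simpa using this
  have hA := Gate.active_map e.injective g v
  simp only [relabel, Matrix.of_apply]
  by_cases h1 : ∀ w, w ≠ (g.map e).target → u w = v w
  · by_cases h2 : g.Active (v ∘ e)
    · rw [Gate.mat_active _ h1 (hA.mpr h2), Gate.mat_active _ (key.mp h1) h2]
      rfl
    · rw [Gate.mat_inactive _ _ (fun h => h2 (hA.mp h)), Gate.mat_inactive _ _ h2,
        Matrix.one_apply, Matrix.one_apply]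
      have : u = v ↔ u ∘ e = v ∘ e := (e.surjective.injective_comp_right.eq_iff).symm
      simp only [this]
  · rw [Gate.mat_eq_zero _ h1, Gate.mat_eq_zero _ (fun h => h1 (key.mpr h))]

/-- Locality: neither the target nor a control lies among the wires `X`, so an entry vanishes unless
the bits on `X` agree, and otherwise it does not depend on them. -/
theorem Gate.mat_map_inl (g : Gate V) :
    (g.map (Sum.inl : V → V ⊕ X)).mat = tensor g.mat 1 := by
  ext u v
  have key : (∀ w, w ≠ (g.map (Sum.inl : V → V ⊕ X)).target → u w = v w) ↔
      (∀ w, w ≠ g.target → u (Sum.inl w) = v (Sum.inl w)) ∧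
        ((fun c => u (Sum.inr c)) = fun c => v (Sum.inr c)) := by
    constructor
    · intro h
      exact ⟨fun w hw => h _ (by simpa [Gate.map] using hw),
        funext fun c => h _ (by simp [Gate.map])⟩
    · rintro ⟨h1, h2⟩ (w | w) hw
      · exact h1 w (by simpa [Gate.map] using hw)
      · exact congrFun h2 w
  have hA := Gate.active_map (Sum.inl_injective (β := X)) g v
  simp only [tensor, Matrix.of_apply]
  by_cases h2 : (fun c => u (Sum.inr c)) = fun c => v (Sum.inr c)
  · rw [h2, Matrix.one_apply_eq, mul_one]
    by_cases h3 : g.Active (v ∘ Sum.inl)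
    · by_cases h1 : ∀ w, w ≠ g.target → u (Sum.inl w) = v (Sum.inl w)
      · rw [Gate.mat_active _ (key.mpr ⟨h1, h2⟩) (hA.mpr h3), Gate.mat_active _ h1 h3]
        rfl
      · rw [Gate.mat_eq_zero _ (fun h => h1 (key.mp h).1), Gate.mat_eq_zero _ h1]
    · rw [Gate.mat_inactive _ _ (fun h => h3 (hA.mp h)),
        Gate.mat_inactive g (v := fun a => v (Sum.inl a)) _ h3, Matrix.one_apply, Matrix.one_apply]
      have : u = v ↔ (fun a => u (Sum.inl a)) = fun a => v (Sum.inl a) := by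
        refine ⟨fun h => by rw [h], fun h => ?_⟩
        funext w
        rcases w with w | w
        · exact congrFun h w
        · exact congrFun h2 w
      simp only [this]
  · rw [Gate.mat_eq_zero _ (fun h => h2 (key.mp h).2), Matrix.one_apply_ne h2, mul_zero]

theorem typeOne_eq_ketMap (q : (Fin m ⊕ Fin l) ↪ W) (F : Bits (Fin m) → Bits (Fin l)) :
    typeOne q F = ketMap (xorInto q F) := by
  ext u v
  simp [typeOne, ketMap]

theorem xorInto_answer (q : (Fin m ⊕ Fin l) ↪ W) (F : Bits (Fin m) → Bits (Fin l)) (u : Bits W)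
    (j : Fin l) :
    xorInto q F u (q (Sum.inr j)) =
      xor (u (q (Sum.inr j))) (F (fun i => u (q (Sum.inl i))) j) := by
  simp [xorInto]

theorem xorInto_other (q : (Fin m ⊕ Fin l) ↪ W) (F : Bits (Fin m) → Bits (Fin l)) (u : Bits W)
    (w : W) (h : ∀ j, q (Sum.inr j) ≠ w) : xorInto q F u w = u w := by
  simp [xorInto, h]

theorem xorInto_trans (f : V ↪ W) (q : (Fin m ⊕ Fin l) ↪ V) (F : Bits (Fin m) → Bits (Fin l))
    (u : Bits W) (v : V) : xorInto (q.trans f) F u (f v) = xorInto q F (u ∘ f) v := by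
  simp [xorInto]

theorem typeOne_map_equiv (e : V ≃ W) (q : (Fin m ⊕ Fin l) ↪ V)
    (F : Bits (Fin m) → Bits (Fin l)) :
    typeOne (q.trans e.toEmbedding) F = relabel e (typeOne q F) := by
  ext u v
  rw [typeOne_eq_ketMap, typeOne_eq_ketMap]
  simp only [ketMap, relabel, Matrix.of_apply]
  have : u = xorInto (q.trans e.toEmbedding) F v ↔ u ∘ e = xorInto q F (v ∘ e) := by
    constructor
    · rintro rfl
      funext w
      exact xorInto_trans e.toEmbedding q F v w
    · intro h
      funext w
      obtain ⟨w, rfl⟩ := e.surjective w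
      exact (congrFun h w).trans (xorInto_trans e.toEmbedding q F v w).symm
  simp only [this]

theorem typeOne_map_inl (q : (Fin m ⊕ Fin l) ↪ V) (F : Bits (Fin m) → Bits (Fin l)) :
    typeOne (q.trans (Function.Embedding.inl : V ↪ V ⊕ X)) F = tensor (typeOne q F) 1 := by
  ext u v
  rw [typeOne_eq_ketMap, typeOne_eq_ketMap]
  simp only [ketMap, tensor, Matrix.of_apply, Matrix.one_apply]
  have : u = xorInto (q.trans (Function.Embedding.inl : V ↪ V ⊕ X)) F v ↔
      ((fun a => u (Sum.inl a)) = xorInto q F (fun a => v (Sum.inl a))) ∧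
        ((fun a => u (Sum.inr a)) = fun a => v (Sum.inr a)) := by
    have h1 : ∀ w, xorInto (q.trans (Function.Embedding.inl : V ↪ V ⊕ X)) F v (Sum.inl w) =
      xorInto q F (fun a => v (Sum.inl a)) w := fun w => xorInto_trans Function.Embedding.inl q F v w
    have h2 : ∀ w, xorInto (q.trans (Function.Embedding.inl : V ↪ V ⊕ X)) F v (Sum.inr w) =
      v (Sum.inr w) := fun w => xorInto_other _ _ _ _ (by simp)
    constructor
    · rintro rfl
      exact ⟨funext h1, funext h2⟩
    · rintro ⟨h3, h4⟩
      funext w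
      rcases w with w | w
      · rw [h1, ← h3]
      · rw [h2]; exact congrFun h4 w
  simp only [this]
  split_ifs <;> simp_all

/-! ### Execution of lists of instructions -/

/-- The execution of a list of instructions. -/
def execs (F : R → Bits (Fin m) → Bits (Fin l)) (L : List (Instr m l W)) (σ : State W) :
    State W := L.foldl (fun σ i => i.exec F σ) σ

theorem execs_append (F : R → Bits (Fin m) → Bits (Fin l)) (L L' : List (Instr m l W))
    (σ : State W) : execs F (L ++ L') σ = execs F L' (execs F L σ) := by
  simp [execs]

theorem average_linear {κ M N : Type} [Fintype κ] [AddCommGroup M] [Module ℂ M]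
    [AddCommGroup N] [Module ℂ N] {f : κ → M → N} (h : ∀ i, IsLinearMap ℂ (f i)) :
    IsLinearMap ℂ (fun x => average fun i => f i x) where
  map_add x y := by simp [average, (h _).map_add, Finset.sum_add_distrib]
  map_smul c x := by
    simp only [average, (h _).map_smul, ← Finset.smul_sum]
    rw [smul_comm]

theorem exec_linear (F : R → Bits (Fin m) → Bits (Fin l)) (i : Instr m l W) :
    IsLinearMap ℂ (i.exec F) := by
  cases i with
  | gate g => exact conjBy_linear _
  | query q => exact average_linear fun r => conjBy_linear _

theorem execs_linear (F : R → Bits (Fin m) → Bits (Fin l)) (L : List (Instr m l W)) :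
    IsLinearMap ℂ (execs F L) := by
  induction L with
  | nil => exact ⟨fun _ _ => rfl, fun _ _ => rfl⟩
  | cons i L ih => exact linear_comp (f := execs F L) ih (exec_linear F i)

theorem exec_map_equiv (F : R → Bits (Fin m) → Bits (Fin l)) (e : V ≃ W) (i : Instr m l V)
    (σ : State V) :
    (i.map e.toEmbedding).exec F (relabel e σ) = relabel e (i.exec F σ) := by
  cases i with
  | gate g =>
    simp only [Instr.map, Instr.exec]
    rw [← conjBy_relabel, ← Gate.mat_map_equiv]
    rfl
  | query q =>
    simp only [Instr.map, Instr.exec]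
    rw [linear_average (relabel_linear e)]
    simp only [typeOne_map_equiv, conjBy_relabel]

theorem exec_map_inl (F : R → Bits (Fin m) → Bits (Fin l)) (i : Instr m l V) (σ : State V)
    (τ : State X) :
    (i.map Function.Embedding.inl).exec F (tensor σ τ) = tensor (i.exec F σ) τ := by
  cases i with
  | gate g =>
    simp only [Instr.map, Instr.exec]
    have := conjBy_tensor g.mat σ 1 τ
    rw [← Gate.mat_map_inl, conjBy_one] at this
    exact this
  | query q =>
    simp only [Instr.map, Instr.exec]
    rw [linear_average (tensor_left_linear τ)]
    simp only [typeOne_map_inl, conjBy_tensor, conjBy_one]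

theorem execs_map_equiv (F : R → Bits (Fin m) → Bits (Fin l)) (e : V ≃ W)
    (L : List (Instr m l V)) (σ : State V) :
    execs F (L.map (Instr.map e.toEmbedding)) (relabel e σ) = relabel e (execs F L σ) := by
  induction L generalizing σ with
  | nil => rfl
  | cons i L ih =>
    simp only [execs, List.map_cons, List.foldl_cons, exec_map_equiv]
    exact ih _

theorem execs_map_inl (F : R → Bits (Fin m) → Bits (Fin l)) (L : List (Instr m l V))
    (σ : State V) (τ : State X) :
    execs F (L.map (Instr.map Function.Embedding.inl)) (tensor σ τ) =
      tensor (execs F L σ) τ := by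
  induction L generalizing σ with
  | nil => rfl
  | cons i L ih =>
    simp only [execs, List.map_cons, List.foldl_cons, exec_map_inl]
    exact ih _

theorem Instr.map_trans {U : Type} (f : U ↪ V) (g : V ↪ W) (i : Instr m l U) :
    (i.map f).map g = i.map (f.trans g) := by
  cases i <;> rfl

/-- Execution inside a larger register. -/
theorem execs_map (F : R → Bits (Fin m) → Bits (Fin l)) (e : V ⊕ X ≃ W)
    (L : List (Instr m l V)) (σ : State V) (τ : State X) :
    execs F (L.map (Instr.map (Function.Embedding.inl.trans e.toEmbedding)))
      (relabel e (tensor σ τ)) = relabel e (tensor (execs F L σ) τ) := by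
  have := execs_map_equiv F e (L.map (Instr.map Function.Embedding.inl)) (tensor σ τ)
  rw [execs_map_inl, List.map_map] at this
  rw [← this]
  congr 2
  funext i
  exact (Instr.map_trans _ _ i).symm

/-- The execution of a list of gates. -/
def runGates (L : List (Gate W)) (σ : State W) : State W :=
  L.foldl (fun σ g => conjBy g.mat σ) σ

theorem runGates_append (L L' : List (Gate W)) (σ : State W) :
    runGates (L ++ L') σ = runGates L' (runGates L σ) := by
  simp [runGates]

theorem execs_gates (F : R → Bits (Fin m) → Bits (Fin l)) (L : List (Gate W)) (σ : State W) :
    execs F (L.map Instr.gate) σ = runGates L σ := by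
  rw [execs, List.foldl_map, runGates]
  rfl

theorem runGates_map (e : V ⊕ X ≃ W) (L : List (Gate V)) (σ : State V) (τ : State X) :
    runGates (L.map (Gate.map (e ∘ Sum.inl))) (relabel e (tensor σ τ)) =
      relabel e (tensor (runGates L σ) τ) := by
  have := execs_map (m := 0) (l := 0) (fun (_ : Unit) x => x) e (L.map Instr.gate) σ τ
  rw [execs_gates, List.map_map] at this
  rw [← this, ← execs_gates (fun (_ : Unit) (x : Bits (Fin 0)) => x), List.map_map]
  rfl

/-! ### Classical gates -/

/-- A NOT gate with controls, given by its three wires. -/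
def notGate (g : W × W × W) : Gate W := ⟨Op1.X, g.1, g.2.1, g.2.2⟩

theorem notGate_active_iff (g : W × W × W) (u : Bits W) :
    (notGate g).Active u ↔
      (g.2.1 = g.1 ∨ u g.2.1 = true) ∧ (g.2.2 = g.1 ∨ u g.2.2 = true) := Iff.rfl

theorem applyNot_inactive (g : W × W × W) {u : Bits W} (h : ¬ (notGate g).Active u) :
    applyNot g u = u := if_neg h

theorem applyNot_active (g : W × W × W) {u : Bits W} (h : (notGate g).Active u) :
    applyNot g u = Function.update u g.1 (!u g.1) := by
  refine (if_pos h).trans ?_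
  congr
  exact Subsingleton.elim _ _

theorem applyNot_of_ne (g : W × W × W) (u : Bits W) (w : W) (h : w ≠ g.1) :
    applyNot g u w = u w := by
  by_cases hA : (notGate g).Active u
  · simp [applyNot_active g hA, h]
  · rw [applyNot_inactive g hA]

theorem applyNot_target (g : W × W × W) {u : Bits W} (h : (notGate g).Active u) :
    applyNot g u g.1 = !u g.1 := by
  simp [applyNot_active g h]

/-- Controlled NOT gates permute the computational basis, so quantum circuits made of them can be
analysed on bit strings alone. When the gate is active and two strings agree off the target, one is
the image of the other exactly if they differ at the target. -/
theorem notGate_mat (g : W × W × W) : (notGate g).mat = ketMap (applyNot g) := by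
  ext u v
  simp only [ketMap, Matrix.of_apply]
  by_cases hA : (notGate g).Active v
  · by_cases h1 : ∀ w, w ≠ g.1 → u w = v w
    · have h2 : u = applyNot g v ↔ ¬ (u g.1 = v g.1) := by
        constructor
        · rintro rfl
          simp [applyNot_target g hA]
        · intro h3
          funext w
          by_cases hw : w = g.1
          · subst hw
            rw [applyNot_target g hA]
            cases h4 : u g.1 <;> cases h5 : v g.1 <;> simp_all
          · rw [applyNot_of_ne _ _ _ hw, h1 w hw]
      rw [Gate.mat_active _ h1 hA]
      simp only [h2, notGate, Op1.mat, Matrix.of_apply]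
      split_ifs <;> simp_all
    · rw [Gate.mat_eq_zero _ h1, if_neg]
      rintro rfl
      exact h1 fun w hw => applyNot_of_ne _ _ _ hw
  · rw [Gate.mat_inactive _ _ hA, applyNot_inactive g hA, Matrix.one_apply]

/-- The action of a list of controlled NOT gates on bit strings. -/
def applyNots (L : List (W × W × W)) (u : Bits W) : Bits W := L.foldl (fun u g => applyNot g u) u

theorem applyNots_append (L L' : List (W × W × W)) (u : Bits W) :
    applyNots (L ++ L') u = applyNots L' (applyNots L u) := by
  simp [applyNots]

theorem runGates_notGate (L : List (W × W × W)) (σ : State W) :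
    runGates (L.map notGate) σ = push (applyNots L) σ := by
  induction L generalizing σ with
  | nil =>
    have : ketMap (applyNots ([] : List (W × W × W))) = 1 := by
      ext u v
      by_cases h : u = v <;> simp [ketMap, applyNots, Matrix.one_apply, h]
    simp [runGates, push, this, conjBy_one]
  | cons g L ih =>
    simp only [runGates, List.map_cons, List.foldl_cons] at ih ⊢
    rw [ih, notGate_mat]
    exact push_push _ _ _

/-- A non-void control differs from the target, so flipping the target does not change whether the
gate is active. -/
theorem applyNot_involutive (g : W × W × W) (u : Bits W) : applyNot g (applyNot g u) = u := by
  by_cases hA : (notGate g).Active u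
  · have hA' : (notGate g).Active (applyNot g u) := by
      rw [notGate_active_iff] at hA ⊢
      refine ⟨?_, ?_⟩
      · by_cases h : g.2.1 = g.1
        · exact Or.inl h
        · rw [applyNot_of_ne _ _ _ h]
          exact hA.1
      · by_cases h : g.2.2 = g.1
        · exact Or.inl h
        · rw [applyNot_of_ne _ _ _ h]
          exact hA.2
    funext w
    by_cases hw : w = g.1
    · rw [hw, applyNot_target g hA', applyNot_target g hA, Bool.not_not]
    · rw [applyNot_of_ne _ _ _ hw, applyNot_of_ne _ _ _ hw]
  · rw [applyNot_inactive g hA, applyNot_inactive g hA]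

theorem applyNots_reverse (L : List (W × W × W)) (u : Bits W) :
    applyNots L.reverse (applyNots L u) = u := by
  induction L generalizing u with
  | nil => rfl
  | cons g L ih =>
    rw [List.reverse_cons, applyNots_append]
    have : applyNots (g :: L) u = applyNots L (applyNot g u) := rfl
    rw [this, ih]
    exact applyNot_involutive g u

/-- Renaming of the wires of a NOT gate. -/
def mapNot (f : V → W) (g : V × V × V) : W × W × W := (f g.1, f g.2.1, f g.2.2)

theorem applyNot_mapNot {f : V → W} (hf : Function.Injective f) (g : V × V × V) (u : Bits W) :
    applyNot (mapNot f g) u ∘ f = applyNot g (u ∘ f) := by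
  have hA : (notGate (mapNot f g)).Active u ↔ (notGate g).Active (u ∘ f) :=
    Gate.active_map hf (notGate g) u
  by_cases h : (notGate g).Active (u ∘ f)
  · rw [applyNot_active _ h, applyNot_active _ (hA.mpr h)]
    funext v
    simp [mapNot, Function.update_apply, hf.eq_iff]
  · rw [applyNot_inactive _ h, applyNot_inactive _ (fun h' => h (hA.mp h'))]

theorem applyNots_mapNot {f : V → W} (hf : Function.Injective f) (L : List (V × V × V))
    (u : Bits W) : applyNots (L.map (mapNot f)) u ∘ f = applyNots L (u ∘ f) := by
  induction L generalizing u with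
  | nil => rfl
  | cons g L ih =>
    simp only [applyNots, List.map_cons, List.foldl_cons] at ih ⊢
    rw [ih, applyNot_mapNot hf]

theorem applyNots_of_ne (L : List (W × W × W)) (u : Bits W) (w : W) (h : ∀ g ∈ L, w ≠ g.1) :
    applyNots L u w = u w := by
  induction L generalizing u with
  | nil => rfl
  | cons g L ih =>
    simp only [applyNots, List.foldl_cons] at ih ⊢
    rw [ih _ (fun g' hg' => h g' (List.mem_cons_of_mem _ hg')),
      applyNot_of_ne _ _ _ (h g List.mem_cons_self)]

/-- NOT gates whose targets are distinct and not used as controls of the others act in parallel. -/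
theorem applyNots_parallel {κ : Type} (L : List κ) (hL : L.Nodup) (gate : κ → W × W × W)
    (htgt : ∀ i ∈ L, ∀ j ∈ L, (gate i).1 = (gate j).1 → i = j)
    (hctl : ∀ i ∈ L, ∀ j ∈ L, i ≠ j → (gate i).2.1 ≠ (gate j).1 ∧ (gate i).2.2 ≠ (gate j).1)
    (u : Bits W) (i : κ) (hi : i ∈ L) :
    applyNots (L.map gate) u (gate i).1 = applyNot (gate i) u (gate i).1 := by
  induction L generalizing u with
  | nil => simp at hi
  | cons k L ih =>
    have step : applyNots ((k :: L).map gate) u = applyNots (L.map gate) (applyNot (gate k) u) :=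
      rfl
    rw [step]
    rw [List.nodup_cons] at hL
    rcases List.mem_cons.mp hi with rfl | hi'
    · refine applyNots_of_ne _ _ _ fun g hg => ?_
      obtain ⟨j, hj, rfl⟩ := List.mem_map.mp hg
      intro h
      have := htgt _ hi _ (List.mem_cons_of_mem _ hj) h
      exact hL.1 (this ▸ hj)
    · rw [ih hL.2 (fun a ha b hb => htgt a (List.mem_cons_of_mem _ ha) b (List.mem_cons_of_mem _ hb))
        (fun a ha b hb => hctl a (List.mem_cons_of_mem _ ha) b (List.mem_cons_of_mem _ hb)) _ hi']
      have hik : i ≠ k := by rintro rfl; exact hL.1 hi'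
      have hc := hctl i hi k List.mem_cons_self hik
      have ht : (gate i).1 ≠ (gate k).1 := fun h => hik (htgt i hi k List.mem_cons_self h)
      have e1 := applyNot_of_ne (gate k) u _ hc.1
      have e2 := applyNot_of_ne (gate k) u _ hc.2
      have e3 := applyNot_of_ne (gate k) u _ ht
      have hA : (notGate (gate i)).Active (applyNot (gate k) u) ↔ (notGate (gate i)).Active u := by
        rw [notGate_active_iff, notGate_active_iff, e1, e2]
      by_cases h : (notGate (gate i)).Active u
      · rw [applyNot_target _ h, applyNot_target _ (hA.mpr h), e3]
      · rw [applyNot_inactive _ h, applyNot_inactive _ (fun h' => h (hA.mp h')), e3]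

end Gates

end
end QEnc

namespace QEnc
noncomputable section

/-! ### Circuits with freely chosen output wires: composition and framing -/

section Procedures

variable {A B C J K X Y Z : Type} [Fintype A] [DecidableEq A] [Fintype B] [DecidableEq B]
  [Fintype C] [DecidableEq C] [Fintype J] [DecidableEq J] [Fintype K] [DecidableEq K]
  [Fintype X] [DecidableEq X] [Fintype Y] [DecidableEq Y] [Fintype Z] [DecidableEq Z]
  {m l : ℕ} {R : Type} [Fintype R]

/-! ### Rearranging tensor products -/

/-- Exchange of the last two of three registers. -/
def swapRight (A B C : Type) : (A ⊕ B) ⊕ C ≃ (A ⊕ C) ⊕ B :=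
  (Equiv.sumAssoc A B C).trans
    (((Equiv.refl A).sumCongr (Equiv.sumComm B C)).trans (Equiv.sumAssoc A C B).symm)

theorem relabel_swapRight (ρ : State A) (σ : State B) (τ : State C) :
    relabel (swapRight A B C) (tensor (tensor ρ σ) τ) = tensor (tensor ρ τ) σ := by
  ext u v
  simp only [relabel, tensor, Matrix.of_apply, Function.comp, swapRight]
  exact mul_right_comm _ _ _

theorem relabel_sumAssoc (ρ : State A) (σ : State B) (τ : State C) :
    relabel (Equiv.sumAssoc A B C) (tensor (tensor ρ σ) τ) = tensor ρ (tensor σ τ) := by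
  ext u v
  exact mul_assoc _ _ _

theorem relabel_sumAssoc_symm (ρ : State A) (σ : State B) (τ : State C) :
    relabel (Equiv.sumAssoc A B C).symm (tensor ρ (tensor σ τ)) = tensor (tensor ρ σ) τ := by
  ext u v
  exact (mul_assoc _ _ _).symm

theorem relabel_sumComm (ρ : State A) (σ : State B) :
    relabel (Equiv.sumComm A B) (tensor ρ σ) = tensor σ ρ := by
  ext u v
  exact mul_comm _ _

theorem relabel_sumCongr (e : A ≃ C) (e' : B ≃ X) (ρ : State A) (σ : State B) :
    relabel (e.sumCongr e') (tensor ρ σ) = tensor (relabel e ρ) (relabel e' σ) := rfl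

theorem relabel_refl (ρ : State A) : relabel (Equiv.refl A) ρ = ρ := rfl

theorem relabel_symm_relabel (e : A ≃ B) (ρ : State A) : relabel e.symm (relabel e ρ) = ρ := by
  rw [relabel_relabel, Equiv.self_trans_symm, relabel_refl]

theorem trOut_relabel_sumAssoc (σ : State ((A ⊕ B) ⊕ C)) :
    trOut (relabel (Equiv.sumAssoc A B C) σ) = trOut (trOut σ) := by
  ext u v
  simp only [trOut, relabel, Matrix.of_apply, sum_bits_sum]
  refine Finset.sum_congr rfl fun b _ => Finset.sum_congr rfl fun c _ => ?_
  congr 1 <;> (funext w; rcases w with (w | w) | w <;> rfl)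

theorem trOut_relabel_right (e : C ≃ J) (σ : State (A ⊕ C)) :
    trOut (relabel ((Equiv.refl A).sumCongr e) σ) = trOut σ := by
  ext u v
  simp only [trOut, relabel, Matrix.of_apply]
  refine Fintype.sum_equiv (e.arrowCongr (Equiv.refl Bool)).symm _ _ fun j => ?_
  congr 1 <;> (funext w; rcases w with w | w <;> rfl)

theorem trOut_relabel_left (e : A ≃ B) (σ : State (A ⊕ C)) :
    trOut (relabel (e.sumCongr (Equiv.refl C)) σ) = relabel e (trOut σ) := by
  ext u v
  simp only [trOut, relabel, Matrix.of_apply]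
  refine Finset.sum_congr rfl fun j _ => ?_
  congr 1 <;> (funext w; rcases w with w | w <;> rfl)

/-- The state `|0…0⟩⟨0…0|`. -/
def zeroState (A : Type) [Fintype A] [DecidableEq A] : State A := basisState fun _ => false

theorem tensor_zeroState : tensor (zeroState A) (zeroState B) = zeroState (A ⊕ B) := by
  rw [zeroState, zeroState, tensor_basisState, zeroState]
  congr 1
  funext w
  rcases w with w | w <;> rfl

theorem relabel_zeroState (e : A ≃ B) : relabel e (zeroState A) = zeroState B :=
  relabel_basisState e _

theorem prepare_eq (k : ℕ) (ρ : State A) :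
    prepare B k ρ = tensor ρ (zeroState (B ⊕ Fin k)) := by
  rw [prepare]
  congr 1
  ext u v
  simp only [zeroState, basisState, Matrix.single_apply, Matrix.of_apply, funext_iff,
    eq_comm (a := false)]
  congr

/-- The equivalence that moves the output wires of a circuit to the front. -/
def outFirst (A B K : Type) : A ⊕ B ⊕ K ≃ B ⊕ A ⊕ K :=
  (Equiv.sumAssoc A B K).symm.trans
    (((Equiv.sumComm A B).sumCongr (Equiv.refl K)).trans (Equiv.sumAssoc B A K))

theorem readout_eq {k : ℕ} (σ : State (A ⊕ B ⊕ Fin k)) :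
    readout σ = trOut (relabel (outFirst A B (Fin k)) σ) := by
  ext u v
  simp only [readout, trOut, relabel, Matrix.of_apply, sum_bits_sum]
  refine Finset.sum_congr rfl fun b _ => Finset.sum_congr rfl fun c _ => ?_
  congr 1 <;> (funext w; rcases w with w | w | w <;> rfl)

/-! ### Linearity -/

section

variable {M : Type} [AddCommMonoid M] [Module ℂ M]

theorem linear_id : IsLinearMap ℂ (fun x : M => x) := ⟨fun _ _ => rfl, fun _ _ => rfl⟩

theorem linear_trOut {f : M → State (A ⊕ B)} (hf : IsLinearMap ℂ f) :
    IsLinearMap ℂ (fun x => trOut (f x)) := linear_comp trOut_linear hf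

theorem linear_relabel (e : A ≃ B) {f : M → State A} (hf : IsLinearMap ℂ f) :
    IsLinearMap ℂ (fun x => relabel e (f x)) := linear_comp (relabel_linear e) hf

theorem linear_tensor_left (τ : State B) {f : M → State A} (hf : IsLinearMap ℂ f) :
    IsLinearMap ℂ (fun x => tensor (f x) τ) := linear_comp (f := fun ρ => tensor ρ τ) (tensor_left_linear τ) hf

theorem linear_tensor_right (ρ : State A) {f : M → State B} (hf : IsLinearMap ℂ f) :
    IsLinearMap ℂ (fun x => tensor ρ (f x)) := linear_comp (f := fun τ => tensor ρ τ) (tensor_right_linear ρ) hf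

theorem linear_execs (F : R → Bits (Fin m) → Bits (Fin l)) (L : List (Instr m l A))
    {f : M → State A} (hf : IsLinearMap ℂ f) : IsLinearMap ℂ (fun x => execs F L (f x)) :=
  linear_comp (execs_linear F L) hf

end

/-! ### Procedures -/

/-- A circuit whose output wires may be chosen among its input wires and ancillas. -/
structure Proc (m l : ℕ) (A B : Type) where
  Anc : Type
  Junk : Type
  [ancFintype : Fintype Anc]
  [ancDecidableEq : DecidableEq Anc]
  [junkFintype : Fintype Junk]
  [junkDecidableEq : DecidableEq Junk]
  wires : A ⊕ Anc ≃ B ⊕ Junk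
  instrs : List (Instr m l (A ⊕ Anc))

attribute [instance] Proc.ancFintype Proc.ancDecidableEq Proc.junkFintype Proc.junkDecidableEq

/-- The channel computed by a procedure. -/
def Proc.run (P : Proc m l A B) (F : R → Bits (Fin m) → Bits (Fin l)) (ρ : State A) : State B :=
  trOut (relabel P.wires (execs F P.instrs (tensor ρ (zeroState P.Anc))))

/-- The number of ancillas and instructions. -/
def Proc.cost (P : Proc m l A B) : ℕ := Fintype.card P.Anc + P.instrs.length

theorem Proc.run_linear (P : Proc m l A B) (F : R → Bits (Fin m) → Bits (Fin l)) :
    IsLinearMap ℂ (P.run F) :=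
  linear_trOut (linear_relabel _ (linear_execs F _ (linear_tensor_left _ linear_id)))

/-- The place of the wires of the second procedure of a composition. -/
def compWires (e : A ⊕ K ≃ B ⊕ J) (K' : Type) : (B ⊕ K') ⊕ J ≃ A ⊕ (K ⊕ K') :=
  (swapRight B K' J).trans ((e.symm.sumCongr (Equiv.refl K')).trans (Equiv.sumAssoc A K K'))

/-- The output wires of a composition. -/
def compOut (e : A ⊕ K ≃ B ⊕ J) {J' K' : Type} (e' : B ⊕ K' ≃ C ⊕ J') :
    A ⊕ (K ⊕ K') ≃ C ⊕ (J' ⊕ J) :=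
  (compWires e K').symm.trans ((e'.sumCongr (Equiv.refl J)).trans (Equiv.sumAssoc C J' J))

/-- Sequential composition. -/
def Proc.comp (P : Proc m l A B) (Q : Proc m l B C) : Proc m l A C where
  Anc := P.Anc ⊕ Q.Anc
  Junk := Q.Junk ⊕ P.Junk
  wires := compOut P.wires Q.wires
  instrs := P.instrs.map (Instr.map (Function.Embedding.inl.trans
      (Equiv.sumAssoc A P.Anc Q.Anc).toEmbedding)) ++
    Q.instrs.map (Instr.map (Function.Embedding.inl.trans
      (compWires P.wires Q.Anc).toEmbedding))

theorem Proc.cost_comp (P : Proc m l A B) (Q : Proc m l B C) :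
    (P.comp Q).cost = P.cost + Q.cost := by
  have : Fintype.card (P.comp Q).Anc = Fintype.card P.Anc + Fintype.card Q.Anc :=
    Fintype.card_sum
  rw [Proc.cost, this]
  simp only [Proc.cost, Proc.comp, List.length_append, List.length_map]
  omega

/-- `Q` never touches the junk of `P`, so it is immaterial whether this junk is discarded before or
after `Q` runs. For a product of output and junk this is locality; entangled states follow by
linearity. -/
theorem Proc.run_comp (P : Proc m l A B) (Q : Proc m l B C)
    (F : R → Bits (Fin m) → Bits (Fin l)) (ρ : State A) :
    (P.comp Q).run F ρ = Q.run F (P.run F ρ) := by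
  have h0 : tensor ρ (zeroState (P.Anc ⊕ Q.Anc)) = relabel (Equiv.sumAssoc A P.Anc Q.Anc)
      (tensor (tensor ρ (zeroState P.Anc)) (zeroState Q.Anc)) := by
    rw [relabel_sumAssoc, tensor_zeroState]
  -- The state of outputs and junk is replaced by an arbitrary operator, so that `ext_tensor`
  -- applies; it is specialised to the actual state at the end.
  have key : ∀ σ : State (B ⊕ P.Junk),
      trOut (relabel (compOut P.wires Q.wires) (execs F (Q.instrs.map (Instr.map
        (Function.Embedding.inl.trans (compWires P.wires Q.Anc).toEmbedding)))
        (relabel (Equiv.sumAssoc A P.Anc Q.Anc)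
          (tensor (relabel P.wires.symm σ) (zeroState Q.Anc))))) = Q.run F (trOut σ) := by
    refine ext_tensor (linear_trOut (linear_relabel _ (linear_execs F _
      (linear_relabel _ (linear_tensor_left _ (linear_relabel _ linear_id))))))
      (linear_comp (Q.run_linear F) trOut_linear) fun β τ => ?_
    have h1 : relabel (Equiv.sumAssoc A P.Anc Q.Anc)
        (tensor (relabel P.wires.symm (tensor β τ)) (zeroState Q.Anc)) =
        relabel (compWires P.wires Q.Anc) (tensor (tensor β (zeroState Q.Anc)) τ) := by
      rw [compWires, ← relabel_relabel, ← relabel_relabel, relabel_swapRight, relabel_sumCongr]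
      rfl
    rw [h1, execs_map, trOut_tensor, (Q.run_linear F).map_smul]
    have h2 : ∀ ω : State ((B ⊕ Q.Anc) ⊕ P.Junk), relabel (compOut P.wires Q.wires)
        (relabel (compWires P.wires Q.Anc) ω) = relabel (Equiv.sumAssoc C Q.Junk P.Junk)
          (relabel (Q.wires.sumCongr (Equiv.refl P.Junk)) ω) := by
      intro ω
      rw [compOut, ← relabel_relabel, relabel_symm_relabel, ← relabel_relabel]
    rw [h2, trOut_relabel_sumAssoc, relabel_sumCongr, trOut_tensor, trOut_linear.map_smul]
    rfl
  rw [Proc.run, Proc.comp, execs_append]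
  rw [h0, execs_map]
  have := key (relabel P.wires (execs F P.instrs (tensor ρ (zeroState P.Anc))))
  rw [relabel_symm_relabel] at this
  exact this

/-- A procedure next to an idle register. -/
def Proc.frame (P : Proc m l A B) (X : Type) : Proc m l (A ⊕ X) (B ⊕ X) where
  Anc := P.Anc
  Junk := P.Junk
  wires := (swapRight A X P.Anc).trans
    ((P.wires.sumCongr (Equiv.refl X)).trans (swapRight B P.Junk X))
  instrs := P.instrs.map (Instr.map (Function.Embedding.inl.trans
      (swapRight A P.Anc X).toEmbedding))

theorem Proc.cost_frame (P : Proc m l A B) (X : Type) [Fintype X] [DecidableEq X] :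
    (P.frame X).cost = P.cost :=
  congrArg (Fintype.card P.Anc + ·) (List.length_map _)

/-- The idle register is moved behind the ancillas for the execution and back afterwards. Product
inputs suffice, because mixtures are decomposed into products before a frame is used. -/
theorem Proc.run_frame (P : Proc m l A B) (F : R → Bits (Fin m) → Bits (Fin l)) (ρ : State A)
    (τ : State X) : (P.frame X).run F (tensor ρ τ) = tensor (P.run F ρ) τ := by
  have h0 : tensor (tensor ρ τ) (zeroState P.Anc) = relabel (swapRight A P.Anc X)
      (tensor (tensor ρ (zeroState P.Anc)) τ) := (relabel_swapRight _ _ _).symm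
  have h1 : ∀ ω : State (B ⊕ P.Junk), trOut (relabel (swapRight B P.Junk X) (tensor ω τ)) =
      tensor (trOut ω) τ := by
    refine ext_tensor (linear_trOut (linear_relabel _ (linear_tensor_left _ linear_id)))
      (linear_tensor_left _ (linear_trOut linear_id)) fun β γ => ?_
    rw [relabel_swapRight, trOut_tensor, trOut_tensor, (tensor_left_linear τ).map_smul]
  rw [Proc.run, Proc.frame]
  change trOut (relabel _ (execs F _ (tensor (tensor ρ τ) (zeroState P.Anc)))) = _
  rw [h0, execs_map, ← relabel_relabel, ← relabel_relabel, relabel_relabel (swapRight A P.Anc X)]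
  have h2 : (swapRight A P.Anc X).trans (swapRight A X P.Anc) = Equiv.refl _ := by
    ext w
    rcases w with (w | w) | w <;> rfl
  rw [h2, relabel_refl, relabel_sumCongr, relabel_refl, h1]
  rfl

end Procedures

end
end QEnc

namespace QEnc
noncomputable section

/-! ### Translation between procedures and circuits -/

section Compilation

variable {A B C J K X Y Z : Type} [Fintype A] [DecidableEq A] [Fintype B] [DecidableEq B]
  [Fintype C] [DecidableEq C] [Fintype J] [DecidableEq J] [Fintype K] [DecidableEq K]
  [Fintype X] [DecidableEq X] [Fintype Y] [DecidableEq Y] [Fintype Z] [DecidableEq Z]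
  {m l : ℕ} {R : Type} [Fintype R]

/-! ### Procedures and circuits -/

/-- An oracle circuit as a procedure. -/
def OCircuit.toProc (C : OCircuit m l A B) : Proc m l A B where
  Anc := B ⊕ Fin C.work
  Junk := A ⊕ Fin C.work
  wires := outFirst A B (Fin C.work)
  instrs := C.instrs

theorem OCircuit.run_toProc (C : OCircuit m l A B) (F : R → Bits (Fin m) → Bits (Fin l))
    (ρ : State A) : C.toProc.run F ρ = C.run F ρ := by
  rw [OCircuit.run, readout_eq, prepare_eq]
  rfl

theorem OCircuit.run_linear (C : OCircuit m l A B) (F : R → Bits (Fin m) → Bits (Fin l)) :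
    IsLinearMap ℂ (C.run F) := by
  have := C.toProc.run_linear F
  rwa [show C.toProc.run F = C.run F from funext fun ρ => C.run_toProc F ρ] at this

theorem OCircuit.cost_toProc (C : OCircuit m l A B) : C.toProc.cost ≤ C.size := by
  have : Fintype.card C.toProc.Anc = Fintype.card B + C.work := by
    change Fintype.card (B ⊕ Fin C.work) = _
    simp
  rw [Proc.cost, this, OCircuit.size]
  change _ + C.instrs.length ≤ _
  omega

/-- A circuit without oracle as an oracle circuit. -/
def QCircuit.toOCircuit (m l : ℕ) (C : QCircuit A B) : OCircuit m l A B where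
  work := C.work
  instrs := C.gates.map Instr.gate

theorem QCircuit.run_toOCircuit (C : QCircuit A B) (F : R → Bits (Fin m) → Bits (Fin l))
    (ρ : State A) : (C.toOCircuit m l).run F ρ = C.run ρ := by
  have := execs_gates F C.gates (prepare B C.work ρ)
  rw [OCircuit.run, QCircuit.run]
  exact congrArg readout this

theorem QCircuit.size_toOCircuit (C : QCircuit A B) : (C.toOCircuit m l).size = C.size := by
  simp [QCircuit.toOCircuit, OCircuit.size, QCircuit.size]

theorem QCircuit.run_linear (C : QCircuit A B) : IsLinearMap ℂ C.run := by
  have := (C.toOCircuit 0 0).run_linear (fun (_ : Unit) x => x)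
  rwa [show (C.toOCircuit 0 0).run _ = C.run from funext fun ρ => C.run_toOCircuit _ ρ] at this

theorem QCircuit.run_eq (C : QCircuit A B) (ρ : State A) :
    C.run ρ = trOut (relabel (outFirst A B (Fin C.work))
      (runGates C.gates (tensor ρ (zeroState (B ⊕ Fin C.work))))) := by
  rw [QCircuit.run, readout_eq, prepare_eq]
  rfl

/-- The gates of an oracle circuit without its queries. -/
def OCircuit.toQCircuit (C : OCircuit m l A B) : QCircuit A B where
  work := C.work
  gates := C.instrs.filterMap fun i => match i with
    | .gate g => some g
    | .query _ => none

theorem OCircuit.size_toQCircuit (C : OCircuit m l A B) : C.toQCircuit.size ≤ C.size := by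
  simp only [OCircuit.size, QCircuit.size, OCircuit.toQCircuit]
  exact Nat.add_le_add_left (List.length_filterMap_le _ _) _

/-- An oracle whose answers have length zero changes no wire, so its queries are identities and may
be dropped. This lets circuits without oracle be treated as a special case of oracle circuits. -/
theorem OCircuit.run_toQCircuit (C : OCircuit 0 0 A B) (ρ : State A) :
    C.toQCircuit.run ρ = C.run (fun (_ : Unit) x => x) ρ := by
  rw [OCircuit.run, QCircuit.run]
  congr 1
  change (C.instrs.filterMap _).foldl _ (prepare B C.work ρ) = _
  generalize prepare B C.work ρ = σ
  generalize C.instrs = L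
  induction L generalizing σ with
  | nil => rfl
  | cons i L ih =>
    cases i with
    | gate g => exact ih _
    | query q =>
      refine (ih σ).trans ?_
      rw [List.foldl_cons]
      congr 1
      have : typeOne q (fun x : Bits (Fin 0) => x) = 1 := by
        rw [typeOne_eq_ketMap]
        ext u v
        have : xorInto q (fun x => x) v = v := by
          funext w
          exact xorInto_other _ _ _ _ fun j => j.elim0
        rw [ketMap, Matrix.of_apply, this, Matrix.one_apply]
      simp [Instr.exec, average, this, conjBy_one]

/-- The exchange of the output wires of a procedure with fresh wires. -/
def exchange (e : A ⊕ K ≃ B ⊕ J) :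
    List (((A ⊕ K) ⊕ B) × ((A ⊕ K) ⊕ B) × ((A ⊕ K) ⊕ B)) :=
  (Finset.univ.toList.map fun b : B =>
      (Sum.inr b, Sum.inl (e.symm (Sum.inl b)), Sum.inl (e.symm (Sum.inl b)))) ++
    Finset.univ.toList.map fun b : B =>
      (Sum.inl (e.symm (Sum.inl b)), Sum.inr b, Sum.inr b)

theorem applyNot_cnot {W : Type} [Fintype W] [DecidableEq W] (t c : W) (u : Bits W)
    (h : c ≠ t) : applyNot (t, c, c) u t = xor (u t) (u c) := by
  by_cases hc : u c = true
  · rw [applyNot_target (t, c, c) ⟨Or.inr hc, Or.inr hc⟩]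
    simp [hc]
  · rw [applyNot_inactive]
    · simp [hc]
    · simp [notGate_active_iff, h, hc]

/-- The first layer of CNOTs copies the output bits to the fresh wires, the second one clears the
originals by means of the copies. As the fresh wires start at 0, the third layer of a general swap
is not needed. -/
theorem applyNots_exchange (e : A ⊕ K ≃ B ⊕ J) (u : Bits (A ⊕ K)) :
    applyNots (exchange e) (Sum.elim u fun _ => false) =
      Sum.elim (fun w => Sum.elim (fun _ => false) (fun j => u (e.symm (Sum.inr j))) (e w))
        (fun b => u (e.symm (Sum.inl b))) := by
  rw [exchange, applyNots_append]
  have h1 : applyNots (Finset.univ.toList.map fun b : B =>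
      ((Sum.inr b, Sum.inl (e.symm (Sum.inl b)), Sum.inl (e.symm (Sum.inl b))) :
        ((A ⊕ K) ⊕ B) × ((A ⊕ K) ⊕ B) × ((A ⊕ K) ⊕ B))) (Sum.elim u fun _ => false) =
      Sum.elim u (fun b => u (e.symm (Sum.inl b))) := by
    funext w
    rcases w with w | b
    · refine applyNots_of_ne _ _ _ fun g hg => ?_
      obtain ⟨b, -, rfl⟩ := List.mem_map.mp hg
      simp
    · have := applyNots_parallel (Finset.univ.toList (α := B)) (Finset.nodup_toList _)
        (fun b : B => ((Sum.inr b, Sum.inl (e.symm (Sum.inl b)), Sum.inl (e.symm (Sum.inl b))) :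
        ((A ⊕ K) ⊕ B) × ((A ⊕ K) ⊕ B) × ((A ⊕ K) ⊕ B))) (by simp) (by simp)
        (Sum.elim u fun _ => false) b (by simp)
      refine this.trans ?_
      rw [applyNot_cnot _ _ _ (by simp)]
      simp
  rw [h1]
  funext w
  rcases w with w | b
  · obtain ⟨w, rfl⟩ := e.symm.surjective w
    rcases w with b | j
    · have := applyNots_parallel (Finset.univ.toList (α := B)) (Finset.nodup_toList _)
        (fun b : B => ((Sum.inl (e.symm (Sum.inl b)), Sum.inr b, Sum.inr b) :
        ((A ⊕ K) ⊕ B) × ((A ⊕ K) ⊕ B) × ((A ⊕ K) ⊕ B))) (by simp) (by simp)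
        (Sum.elim u (fun b => u (e.symm (Sum.inl b)))) b (by simp)
      refine this.trans ?_
      rw [applyNot_cnot _ _ _ (by simp)]
      simp
    · rw [applyNots_of_ne]
      · simp
      · intro g hg
        obtain ⟨b, -, rfl⟩ := List.mem_map.mp hg
        simp
  · rw [applyNots_of_ne]
    · simp
    · intro g hg
      obtain ⟨b, -, rfl⟩ := List.mem_map.mp hg
      simp

/-- The encoding of a discarded register is irrelevant: discarding |x⟩⟨y| leaves the factor 1 if x =
y and 0 otherwise, and an injective map preserves this dichotomy. -/
theorem trOut_push_right (G : Bits J → Bits K) (hG : Function.Injective G) (σ : State (B ⊕ J)) :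
    trOut (push (fun x => Sum.elim (x ∘ Sum.inl) (G (x ∘ Sum.inr))) σ) = trOut σ := by
  refine ext_single (linear_comp trOut_linear (push_linear _)) trOut_linear (fun x y => ?_) σ
  have h1 : Matrix.single x y (1 : ℂ) = tensor (Matrix.single (x ∘ Sum.inl) (y ∘ Sum.inl) 1)
      (Matrix.single (x ∘ Sum.inr) (y ∘ Sum.inr) 1) := by
    rw [tensor_single]
    simp
  rw [push_single, ← tensor_single, h1, trOut_tensor, trOut_tensor]
  congr 1
  by_cases h : x ∘ Sum.inr = y ∘ Sum.inr
  · rw [h, Matrix.trace_single_eq_same, Matrix.trace_single_eq_same]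
  · rw [Matrix.trace_single_eq_of_ne _ _ _ h,
      Matrix.trace_single_eq_of_ne _ _ _ (hG.ne h)]

theorem trOut_exchange (e : A ⊕ K ≃ B ⊕ J) {k : ℕ} (κ : K ≃ Fin k) (σ : State (A ⊕ K)) :
    trOut (relabel (outFirst A B (Fin k)) (relabel ((Equiv.sumAssoc A K B).trans
      ((Equiv.refl A).sumCongr ((Equiv.sumComm K B).trans ((Equiv.refl B).sumCongr κ))))
        (push (applyNots (exchange e)) (tensor σ (zeroState B))))) = trOut (relabel e σ) := by
  -- The contents of the input and ancilla wires after the exchange: the junk bits in their places,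
  -- and 0 where the outputs used to be.
  let G : Bits J → Bits (A ⊕ Fin k) := fun j =>
    (fun w => Sum.elim (fun _ => false) j (e w)) ∘ ((Equiv.refl A).sumCongr κ).symm
  have hG : Function.Injective G := by
    intro j j' h
    funext x
    have := congrFun h ((Equiv.refl A).sumCongr κ (e.symm (Sum.inr x)))
    simpa only [G, Function.comp, Equiv.symm_apply_apply, Equiv.apply_symm_apply,
      Sum.elim_inr] using this
  rw [← trOut_push_right G hG, zeroState, tensor_basisState_eq_push, push_push, relabel_relabel,
    relabel_eq_push, push_push, relabel_eq_push e, push_push]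
  congr 2
  funext u
  simp only [Function.comp_def, applyNots_exchange]
  funext w
  rcases w with w | w | w <;> rfl

/-- A circuit must deliver its result on dedicated wires that start at 0, so the exchange is
appended. The term 3 |B| counts these wires and the two layers of CNOTs. -/
theorem Proc.exists_oCircuit (P : Proc m l A B) : ∃ C : OCircuit m l A B,
    C.size ≤ Fintype.card A + 3 * Fintype.card B + P.cost ∧
      ∀ (F : R → Bits (Fin m) → Bits (Fin l)) ρ, C.run F ρ = P.run F ρ := by
  let κ := Fintype.equivFin P.Anc
  let E : (A ⊕ P.Anc) ⊕ B ≃ A ⊕ B ⊕ Fin (Fintype.card P.Anc) :=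
    (Equiv.sumAssoc A P.Anc B).trans
      ((Equiv.refl A).sumCongr ((Equiv.sumComm P.Anc B).trans ((Equiv.refl B).sumCongr κ)))
  refine ⟨⟨Fintype.card P.Anc, P.instrs.map (Instr.map (Function.Embedding.inl.trans
    E.toEmbedding)) ++ (((exchange P.wires).map notGate).map Instr.gate).map
      (Instr.map E.toEmbedding)⟩, ?_, ?_⟩
  · simp only [OCircuit.size, Proc.cost, exchange, List.length_append, List.length_map,
      Finset.length_toList, Finset.card_univ]
    omega
  · intro F ρ
    have h0 : tensor ρ (zeroState (B ⊕ Fin (Fintype.card P.Anc))) =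
        relabel E (tensor (tensor ρ (zeroState P.Anc)) (zeroState B)) := by
      rw [← relabel_relabel, relabel_sumAssoc, tensor_zeroState, relabel_sumCongr, relabel_refl,
        relabel_zeroState]
    rw [OCircuit.run, readout_eq, prepare_eq]
    change trOut (relabel _ (execs F (_ ++ _) _)) = _
    rw [execs_append, h0, execs_map, execs_map_equiv, execs_gates, runGates_notGate]
    exact trOut_exchange P.wires κ _

theorem Proc.exists_qCircuit (P : Proc 0 0 A B) : ∃ C : QCircuit A B,
    C.size ≤ Fintype.card A + 3 * Fintype.card B + P.cost ∧
      ∀ ρ, C.run ρ = P.run (fun (_ : Unit) x => x) ρ := by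
  obtain ⟨C, hC, h⟩ := P.exists_oCircuit (R := Unit)
  exact ⟨C.toQCircuit, C.size_toQCircuit.trans hC, fun ρ => by rw [C.run_toQCircuit, h]⟩

end Compilation

end
end QEnc

namespace QEnc
noncomputable section

/-! ### Building blocks: measurement, copying, random coins, classical computation -/

section Transformations

variable {A B C D J K X Y Z : Type} [Fintype A] [DecidableEq A] [Fintype B] [DecidableEq B]
  [Fintype C] [DecidableEq C] [Fintype D] [DecidableEq D] [Fintype J] [DecidableEq J]
  [Fintype K] [DecidableEq K] [Fintype X] [DecidableEq X] [Fintype Y] [DecidableEq Y]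
  {m l : ℕ} {R : Type} [Fintype R] {ι : Type}
  {F : ι → R → Bits (Fin m) → Bits (Fin l)} {s s' : ℕ}

/-! ### Families of transformations that are realised by one procedure -/

/-- A single procedure of cost at most `s` maps each of the states `ins i` to `outs i` if it is run
with the oracle `F i`. -/
def Transforms (F : ι → R → Bits (Fin m) → Bits (Fin l)) (s : ℕ) (ins : ι → State A)
    (outs : ι → State B) : Prop :=
  ∃ P : Proc m l A B, P.cost ≤ s ∧ ∀ i, P.run (F i) (ins i) = outs i

namespace Transforms

theorem mono {ins : ι → State A} {outs : ι → State B} (h : Transforms F s ins outs)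
    (hs : s ≤ s') : Transforms F s' ins outs :=
  let ⟨P, h1, h2⟩ := h
  ⟨P, h1.trans hs, h2⟩

theorem congr_out {ins : ι → State A} {outs outs' : ι → State B} (h : Transforms F s ins outs)
    (ho : ∀ i, outs i = outs' i) : Transforms F s ins outs' := by
  rwa [← funext ho]

theorem congr_in {ins ins' : ι → State A} {outs : ι → State B} (h : Transforms F s ins outs)
    (ho : ∀ i, ins i = ins' i) : Transforms F s ins' outs := by
  rwa [← funext ho]

theorem trans {ins : ι → State A} {mids : ι → State B} {outs : ι → State C}
    (h : Transforms F s ins mids) (h' : Transforms F s' mids outs) :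
    Transforms F (s + s') ins outs := by
  obtain ⟨P, hP, h⟩ := h
  obtain ⟨Q, hQ, h'⟩ := h'
  exact ⟨P.comp Q, by rw [P.cost_comp]; omega, fun i => by rw [P.run_comp, h, h']⟩

theorem frame {ins : ι → State A} {outs : ι → State B} (h : Transforms F s ins outs)
    (τ : ι → State X) :
    Transforms F s (fun i => tensor (ins i) (τ i)) (fun i => tensor (outs i) (τ i)) := by
  obtain ⟨P, hP, h⟩ := h
  exact ⟨P.frame X, (P.cost_frame X).trans_le hP, fun i => by rw [P.run_frame, h]⟩

theorem smul {ins : ι → State A} {outs : ι → State B} (h : Transforms F s ins outs) (c : ι → ℂ) :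
    Transforms F s (fun i => c i • ins i) (fun i => c i • outs i) := by
  obtain ⟨P, hP, h⟩ := h
  exact ⟨P, hP, fun i => by rw [(P.run_linear _).map_smul, h]⟩

/-- Linearity: a procedure that treats every summand correctly treats the sum correctly. The
summation index joins the family index, which forces the procedure not to depend on it, while the
oracle depends only on the original index. -/
theorem sum {κ : Type} [Fintype κ] {ins : ι → κ → State A} {outs : ι → κ → State B}
    (h : Transforms (fun p : ι × κ => F p.1) s (fun p => ins p.1 p.2) (fun p => outs p.1 p.2)) :
    Transforms F s (fun i => ∑ k, ins i k) (fun i => ∑ k, outs i k) := by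
  obtain ⟨P, hP, h⟩ := h
  refine ⟨P, hP, fun i => ?_⟩
  rw [linear_sum (P.run_linear _)]
  exact Finset.sum_congr rfl fun k _ => h (i, k)

theorem average {κ : Type} [Fintype κ] {ins : ι → κ → State A} {outs : ι → κ → State B}
    (h : Transforms (fun p : ι × κ => F p.1) s (fun p => ins p.1 p.2) (fun p => outs p.1 p.2)) :
    Transforms F s (fun i => average fun k => ins i k) (fun i => average fun k => outs i k) := by
  obtain ⟨P, hP, h⟩ := h
  refine ⟨P, hP, fun i => ?_⟩
  rw [linear_average (P.run_linear _)]
  congr 1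
  exact funext fun k => h (i, k)

theorem ofOCircuit (C : OCircuit m l A B) (ins : ι → State A) :
    Transforms F C.size ins (fun i => C.run (F i) (ins i)) :=
  ⟨C.toProc, C.cost_toProc, fun _ => C.run_toProc _ _⟩

theorem ofQCircuit (C : QCircuit A B) (ins : ι → State A) :
    Transforms F C.size ins (fun i => C.run (ins i)) :=
  ((ofOCircuit (C.toOCircuit m l) ins).mono C.size_toOCircuit.le).congr_out
    fun _ => C.run_toOCircuit _ _

theorem relabel (e : A ≃ B) (ins : ι → State A) :
    Transforms F 0 ins (fun i => relabel e (ins i)) := by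
  refine ⟨⟨Empty, Empty, e.sumCongr (Equiv.refl Empty), []⟩, by simp [Proc.cost], fun i => ?_⟩
  change trOut (QEnc.relabel _ (tensor (ins i) (basisState _))) = _
  rw [relabel_sumCongr, relabel_refl, trOut_tensor_basisState]

theorem addZero (K : Type) [Fintype K] [DecidableEq K] (ins : ι → State A) :
    Transforms F (Fintype.card K) ins (fun i => tensor (ins i) (zeroState K)) := by
  refine ⟨⟨K, Empty, (Equiv.sumEmpty (A ⊕ K) Empty).symm, []⟩, by simp [Proc.cost], fun i => ?_⟩
  ext u v
  change ∑ j : Bits Empty, tensor (ins i) (zeroState K) _ _ = _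
  rw [Fintype.sum_unique]
  rfl

theorem trOut (ins : ι → State (B ⊕ J)) :
    Transforms F 0 ins (fun i => trOut (ins i)) := by
  refine ⟨⟨Empty, J, Equiv.sumEmpty (B ⊕ J) Empty, []⟩, by simp [Proc.cost], fun i => ?_⟩
  change QEnc.trOut (QEnc.relabel _ (tensor (ins i) (basisState _))) = _
  congr 1
  ext u v
  simp only [QEnc.relabel, tensor, basisState, Matrix.of_apply, Function.comp]
  rw [Subsingleton.elim (fun _ : Empty => false) (fun c => u (Equiv.sumEmpty (B ⊕ J) Empty
    (Sum.inr c))), Subsingleton.elim (fun c : Empty => v (Equiv.sumEmpty (B ⊕ J) Empty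
    (Sum.inr c))) (fun c => u (Equiv.sumEmpty (B ⊕ J) Empty (Sum.inr c)))]
  simp

theorem execs (L : List (Instr m l A)) (ins : ι → State A) :
    Transforms F L.length ins (fun i => execs (F i) L (ins i)) := by
  refine ⟨⟨Empty, Empty, Equiv.refl _, L.map (Instr.map Function.Embedding.inl)⟩,
    by simp [Proc.cost], fun i => ?_⟩
  change QEnc.trOut (QEnc.execs (F i) _ (tensor (ins i) (basisState _))) = _
  rw [execs_map_inl, trOut_tensor_basisState]

theorem runGates (L : List (Gate A)) (ins : ι → State A) :
    Transforms F L.length ins (fun i => runGates L (ins i)) :=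
  ((execs (L.map Instr.gate) ins).mono (by simp)).congr_out fun i => execs_gates _ _ _

theorem nots (L : List (A × A × A)) (ins : ι → State A) :
    Transforms F L.length ins (fun i => push (applyNots L) (ins i)) :=
  ((runGates (L.map notGate) ins).mono (by simp)).congr_out fun i => runGates_notGate _ _

theorem exists_oCircuit {ins : ι → State A} {outs : ι → State B} (h : Transforms F s ins outs) :
    ∃ C : OCircuit m l A B, C.size ≤ Fintype.card A + 3 * Fintype.card B + s ∧
      ∀ i, C.run (F i) (ins i) = outs i := by
  obtain ⟨P, hP, h⟩ := h
  obtain ⟨C, hC, h'⟩ := P.exists_oCircuit (R := R)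
  exact ⟨C, by omega, fun i => by rw [h', h]⟩

/-- Circuits without oracle correspond to the trivial oracle with empty messages and answers. -/
theorem exists_qCircuit {ins : ι → State A} {outs : ι → State B}
    (h : Transforms (fun _ (_ : Unit) (x : Bits (Fin 0)) => x) s ins outs) :
    ∃ C : QCircuit A B, C.size ≤ Fintype.card A + 3 * Fintype.card B + s ∧
      ∀ i, C.run (ins i) = outs i := by
  obtain ⟨P, hP, h⟩ := h
  obtain ⟨C, hC, h'⟩ := P.exists_qCircuit
  exact ⟨C, by omega, fun i => by rw [h', h]⟩

end Transforms

/-! ### Copying classical registers -/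

/-- The bit string on `D` each of whose bits is a constant or the copy of a bit of `c`. -/
def fill (s : D → Bool ⊕ C) (c : Bits C) : Bits D := fun d => Sum.elim id c (s d)

/-- The gate that writes a bit of `fill s c` to a fresh wire. -/
def fillGate (s : D → Bool ⊕ C) (d : D) :
    ((A ⊕ C) ⊕ D) × ((A ⊕ C) ⊕ D) × ((A ⊕ C) ⊕ D) :=
  match s d with
  | Sum.inl _ => (Sum.inr d, Sum.inr d, Sum.inr d)
  | Sum.inr c => (Sum.inr d, Sum.inl (Sum.inr c), Sum.inl (Sum.inr c))

/-- The wires that are written by `fill`. -/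
def fillWires (s : D → Bool ⊕ C) : List D :=
  (Finset.univ.filter fun d => s d ≠ Sum.inl false).toList

theorem applyNots_fill (s : D → Bool ⊕ C) (u : Bits (A ⊕ C)) :
    applyNots ((fillWires s).map (fillGate s)) (Sum.elim u fun _ => false) =
      Sum.elim u (fill s (u ∘ Sum.inr)) := by
  have htgt : ∀ d, (fillGate (A := A) s d).1 = Sum.inr d := by
    intro d
    unfold fillGate
    split <;> rfl
  funext w
  rcases w with w | d
  · refine applyNots_of_ne _ _ _ fun g hg => ?_
    obtain ⟨d, -, rfl⟩ := List.mem_map.mp hg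
    rw [htgt]
    simp
  · by_cases hd : s d = Sum.inl false
    · rw [applyNots_of_ne]
      · simp [fill, hd]
      · intro g hg
        obtain ⟨d', hd', rfl⟩ := List.mem_map.mp hg
        rw [htgt]
        intro h
        obtain rfl := Sum.inr_injective h
        simp [fillWires] at hd'
        exact hd' hd
    · have := applyNots_parallel (fillWires s) (Finset.nodup_toList _) (fillGate (A := A) s)
        (by simp [htgt]) (fun i _ j _ hij => by
          rw [htgt]
          unfold fillGate
          split <;> simp [hij]) (Sum.elim u fun _ => false) d (by simp [fillWires, hd])
      rw [htgt] at this
      rw [this]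
      rcases hs : s d with (_ | _) | c
      · exact absurd hs hd
      · have : fillGate (A := A) s d = (Sum.inr d, Sum.inr d, Sum.inr d) := by
          simp [fillGate, hs]
        rw [this, applyNot_target (Sum.inr d, Sum.inr d, Sum.inr d) ⟨Or.inl rfl, Or.inl rfl⟩]
        simp [fill, hs]
      · have : fillGate (A := A) s d =
            (Sum.inr d, Sum.inl (Sum.inr c), Sum.inl (Sum.inr c)) := by
          simp [fillGate, hs]
        rw [this, applyNot_cnot _ _ _ (by simp)]
        simp [fill, hs]

theorem measured_linear (c : Bits C) :
    IsLinearMap ℂ (fun σ : State (A ⊕ C) => measured σ c) :=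
  ⟨fun _ _ => rfl, fun _ _ => rfl⟩

theorem measured_tensor (ρ : State A) (τ : State C) (c : Bits C) :
    measured (tensor ρ τ) c = τ c c • ρ := by
  ext u v
  simp [measured, tensor, mul_comm]

theorem measured_tensor_basisState (ρ : State A) (c t : Bits C) :
    measured (tensor ρ (basisState c)) t = if c = t then ρ else 0 := by
  rw [measured_tensor]
  by_cases h : c = t
  · simp [basisState, h]
  · simp [basisState, h]

theorem linear_finset_sum {κ M N : Type} [Fintype κ] [AddCommMonoid M] [Module ℂ M]
    [AddCommMonoid N] [Module ℂ N] {f : κ → M → N} (h : ∀ i, IsLinearMap ℂ (f i)) :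
    IsLinearMap ℂ (fun x => ∑ i, f i x) where
  map_add x y := by simp [(h _).map_add, Finset.sum_add_distrib]
  map_smul c x := by simp only [(h _).map_smul, ← Finset.smul_sum]

/-- Recording a function of a register on fresh wires and discarding the register amounts to
measuring it: the discarded factor |x⟩⟨y| has trace 0 unless x = y, so only the diagonal survives.
-/
theorem trOut_copy (G : Bits C → Bits D) (σ : State (A ⊕ C)) :
    trOut (relabel (swapRight A C D) (push (fun u => Sum.elim u (G (u ∘ Sum.inr))) σ)) =
      ∑ c, tensor (measured σ c) (basisState (G c)) := by
  refine ext_tensor (linear_trOut (linear_relabel _ (push_linear _)))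
    (linear_finset_sum fun c => linear_tensor_left _ (measured_linear c)) (fun ρ τ => ?_) σ
  rw [← sub_eq_zero]
  revert τ
  have hlin : IsLinearMap ℂ (fun τ : State C =>
      trOut (relabel (swapRight A C D) (push (fun u => Sum.elim u (G (u ∘ Sum.inr)))
        (tensor ρ τ)))) :=
    linear_trOut (linear_relabel _ (linear_comp (push_linear _) (tensor_right_linear ρ)))
  have hlin' : IsLinearMap ℂ (fun τ : State C =>
      ∑ c, tensor (measured (tensor ρ τ) c) (basisState (G c))) :=
    linear_finset_sum fun c => linear_tensor_left _ (linear_comp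
      (f := fun σ => measured σ c) (measured_linear c) (tensor_right_linear ρ))
  intro τ
  rw [sub_eq_zero]
  refine ext_single hlin hlin' (fun x y => ?_) τ
  have h1 : push (fun u => Sum.elim u (G (u ∘ Sum.inr))) (tensor ρ (Matrix.single x y 1)) =
      tensor (tensor ρ (Matrix.single x y 1)) (Matrix.single (G x) (G y) 1) := by
    refine ext_single (f := fun ρ => push (fun u => Sum.elim u (G (u ∘ Sum.inr)))
      (tensor ρ (Matrix.single x y 1))) (linear_comp (push_linear _) (tensor_left_linear _))
      (linear_tensor_left _ (tensor_left_linear _)) (fun a b => ?_) ρ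
    rw [tensor_single, push_single, tensor_single]
    rfl
  rw [h1, relabel_swapRight, trOut_tensor]
  simp only [measured_tensor]
  by_cases h : x = y
  · subst h
    rw [Matrix.trace_single_eq_same, Finset.sum_eq_single x]
    · simp [basisState]
    · intro c _ hc
      rw [Matrix.single_apply_of_ne _ _ _ _ _ (by tauto), zero_smul]
      exact (tensor_left_linear _).map_zero
    · simp
  · rw [Matrix.trace_single_eq_of_ne _ _ _ h, zero_smul, Finset.sum_eq_zero]
    intro c _
    rw [Matrix.single_apply_of_ne, zero_smul]
    · exact (tensor_left_linear _).map_zero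
    · rintro ⟨rfl, rfl⟩
      exact h rfl

/-- The register `C` is measured and replaced by a register `D` filled from the outcome. The cost is
one fresh wire and at most one gate per bit of `D`; constant zeros need no gate. -/
theorem Transforms.dephase (f : D → Bool ⊕ C) (ins : ι → State (A ⊕ C)) :
    Transforms F (2 * Fintype.card D) ins
      (fun i => ∑ c, tensor (measured (ins i) c) (basisState (fill f c))) := by
  have h1 := addZero (F := F) D ins
  have h2 := h1.trans (nots ((fillWires f).map (fillGate f)) _)
  have h3 := (h2.trans (relabel (swapRight A C D) _)).trans (trOut _)
  refine (h3.mono ?_).congr_out fun i => ?_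
  · have : (fillWires f).length ≤ Fintype.card D := by
      rw [fillWires, Finset.length_toList]
      exact Finset.card_le_univ _
    simp only [List.length_map]
    omega
  · rw [← trOut_copy, zeroState, tensor_basisState_eq_push, push_push]
    congr 3
    funext u
    exact applyNots_fill f u

theorem Transforms.copy (f : D → Bool ⊕ C) (ρ : ι → State A) (c : ι → Bits C) :
    Transforms F (2 * Fintype.card D) (fun i => tensor (ρ i) (basisState (c i)))
      (fun i => tensor (ρ i) (basisState (fill f (c i)))) := by
  refine (dephase f _).congr_out fun i => ?_
  rw [Finset.sum_eq_single (c i)]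
  · rw [measured_tensor_basisState, if_pos rfl]
  · intro c' _ hc
    rw [measured_tensor_basisState, if_neg hc.symm]
    exact (tensor_left_linear _).map_zero
  · simp

/-! ### Random coins -/

/-- The Hadamard gate on a wire. -/
def hadamard (w : Y) : Gate Y := ⟨Op1.H, w, w, w⟩

/-- On a wire that carries 0 on both sides only the first column of the Hadamard matrix enters, and
its entries are both 1/√2. -/
theorem conjBy_hadamard (w : Y) (σ : State Y)
    (h : ∀ u v, (u w = true ∨ v w = true) → σ u v = 0) (u v : Bits Y) :
    conjBy (hadamard w).mat σ u v =
      (1 / 2 : ℂ) * σ (Function.update u w false) (Function.update v w false) := by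
  have hA : ∀ v, (hadamard w).Active v := fun v => ⟨Or.inl rfl, Or.inl rfl⟩
  have hm : ∀ u : Bits Y, (hadamard w).mat u (Function.update u w false) =
      1 / (Real.sqrt 2 : ℂ) := by
    intro u
    rw [Gate.mat_active _ (fun w' hw' =>
      (Function.update_of_ne (a' := w) hw' _ _).symm) (hA _)]
    simp [hadamard, Op1.mat]
  have hz : ∀ u x : Bits Y, x ≠ Function.update u w false → x w = false →
      (hadamard w).mat u x = 0 := by
    intro u x hx hxw
    apply Gate.mat_eq_zero
    intro hu
    apply hx
    funext w'
    by_cases hw : w' = w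
    · subst hw; simp [hxw]
    · rw [Function.update_of_ne hw, hu w' hw]
  simp only [conjBy, Matrix.mul_apply, Matrix.conjTranspose_apply]
  rw [Finset.sum_eq_single (Function.update v w false),
    Finset.sum_eq_single (Function.update u w false), hm, hm]
  · have : (1 / (Real.sqrt 2 : ℂ)) * star (1 / (Real.sqrt 2 : ℂ)) = 1 / 2 := by
      rw [show star (1 / (Real.sqrt 2 : ℂ)) = 1 / (Real.sqrt 2 : ℂ) by
        simp [Complex.conj_ofReal], div_mul_div_comm, ← Complex.ofReal_mul,
        Real.mul_self_sqrt (by norm_num)]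
      norm_num
    rw [← this]
    ring
  · intro x _ hx
    by_cases hxw : x w = true
    · rw [h _ _ (Or.inl hxw), mul_zero]
    · rw [hz u x hx (by simpa using hxw), zero_mul]
  · simp
  · intro x _ hx
    by_cases hxw : x w = true
    · rw [Finset.sum_eq_zero, zero_mul]
      intro y _
      rw [h _ _ (Or.inr hxw), mul_zero]
    · rw [hz v x hx (by simpa using hxw), star_zero, mul_zero]
  · simp

theorem runGates_hadamard (L : List Y) (hL : L.Nodup) (σ : State Y)
    (h : ∀ w ∈ L, ∀ u v, (u w = true ∨ v w = true) → σ u v = 0) (u v : Bits Y) :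
    runGates (L.map hadamard) σ u v = (1 / 2 : ℂ) ^ L.length *
      σ (fun w => if w ∈ L then false else u w) (fun w => if w ∈ L then false else v w) := by
  induction L generalizing σ with
  | nil => simp [runGates]
  | cons w L ih =>
    rw [List.nodup_cons] at hL
    have step : runGates ((w :: L).map hadamard) σ =
        runGates (L.map hadamard) (conjBy (hadamard w).mat σ) := rfl
    have hw := h w List.mem_cons_self
    rw [step, ih hL.2]
    · rw [conjBy_hadamard w σ hw, List.length_cons, pow_succ, mul_assoc]
      congr 3 <;>
      · funext w'
        by_cases h1 : w' = w
        · subst h1; simp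
        · simp [h1]
    · intro w' hw' u v huv
      rw [conjBy_hadamard w σ hw, h w' (List.mem_cons_of_mem _ hw'), mul_zero]
      have : w' ≠ w := by rintro rfl; exact hL.1 hw'
      simpa [this] using huv

/-- Hadamard gates on |0…0⟩ give the uniform superposition, and measuring it gives exactly uniform
bits. The cost of 4 per coin consists of a wire, a Hadamard gate and the measurement at cost 2. -/
theorem Transforms.coins (Y : Type) [Fintype Y] [DecidableEq Y] (ins : ι → State A) :
    Transforms F (4 * Fintype.card Y) ins
      (fun i => QEnc.average fun y : Bits Y => tensor (ins i) (basisState y)) := by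
  have h1 := addZero (F := F) Y ins
  have h2 := h1.trans (runGates ((Finset.univ.toList (α := Y)).map fun w =>
    (hadamard w).map (Sum.inr : Y → A ⊕ Y)) _)
  have h3 := h2.trans (dephase (Sum.inr : Y → Bool ⊕ Y) _)
  refine (h3.mono ?_).congr_out fun i => ?_
  · simp
    omega
  · have e1 : QEnc.runGates ((Finset.univ.toList (α := Y)).map fun w =>
        (hadamard w).map (Sum.inr : Y → A ⊕ Y)) (tensor (ins i) (zeroState Y)) =
        tensor (ins i) (QEnc.runGates ((Finset.univ.toList (α := Y)).map hadamard)
          (zeroState Y)) := by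
      have := runGates_map (Equiv.sumComm Y A) ((Finset.univ.toList (α := Y)).map hadamard)
        (zeroState Y) (ins i)
      rw [relabel_sumComm, relabel_sumComm, List.map_map] at this
      exact this
    rw [e1]
    -- Only the diagonal matters, because the measurement removes the other entries.
    have e2 : ∀ y : Bits Y, QEnc.runGates ((Finset.univ.toList (α := Y)).map hadamard)
        (zeroState Y) y y = ((2 : ℂ)⁻¹) ^ Fintype.card Y := by
      intro y
      rw [runGates_hadamard _ (Finset.nodup_toList _)]
      · simp [zeroState, basisState]
      · intro w _ u v huv
        rw [zeroState, basisState, Matrix.single_apply_of_ne]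
        rintro ⟨rfl, rfl⟩
        simp at huv
    simp only [measured_tensor, e2, (tensor_left_linear _).map_smul, QEnc.average]
    rw [← Finset.smul_sum, RCLike.real_smul_eq_coe_smul (K := ℂ)]
    congr 1
    · simp

/-! ### Classical computations -/

/-- The input is a basis state, so input and work wires end in a basis state and can be discarded
without uncomputation. -/
theorem Transforms.eval (C : CCircuit A B) (x : ι → Bits A) :
    Transforms F C.size (fun i => basisState (x i)) (fun i => basisState (C.eval (x i))) := by
  have h1 := addZero (F := F) (B ⊕ Fin C.work) (fun i => basisState (x i))
  have h2 := ((h1.trans (nots C.gates _)).trans (relabel (outFirst A B (Fin C.work)) _)).trans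
    (trOut _)
  refine (h2.mono ?_).congr_out fun i => ?_
  · simp [CCircuit.size]
  · rw [zeroState, tensor_basisState, push_basisState, relabel_basisState,
      ← Sum.elim_comp_inl_inr (applyNots C.gates _ ∘ _), ← tensor_basisState,
      trOut_tensor_basisState]
    rfl

end Transformations

end
end QEnc

namespace QEnc
noncomputable section

/-! ### Classically controlled gates and the universal circuit -/

section Conditional

variable {A B C D J K W X Y Z : Type} [Fintype A] [DecidableEq A] [Fintype B] [DecidableEq B]
  [Fintype C] [DecidableEq C] [Fintype D] [DecidableEq D] [Fintype J] [DecidableEq J]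
  [Fintype K] [DecidableEq K] [Fintype W] [DecidableEq W] [Fintype X] [DecidableEq X]
  [Fintype Y] [DecidableEq Y]
  {m l : ℕ} {R : Type} [Fintype R] {ι : Type}
  {F : ι → R → Bits (Fin m) → Bits (Fin l)} {s s' : ℕ}

/-! ### Gates that are controlled by a classical wire -/

/-- The gate that computes whether the wire `t` and the first control of `g` are active. -/
def ctlNot (t : C) (g : Gate W) :
    (W ⊕ (C ⊕ Unit)) × (W ⊕ (C ⊕ Unit)) × (W ⊕ (C ⊕ Unit)) :=
  (Sum.inr (Sum.inr ()), Sum.inr (Sum.inl t),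
    if g.c₁ = g.target then Sum.inr (Sum.inr ()) else Sum.inl g.c₁)

/-- The gate `g`, controlled by a scratch wire instead of its first control. -/
def ctlGate (g : Gate W) : Gate (W ⊕ (C ⊕ Unit)) :=
  ⟨g.op, Sum.inl g.target, Sum.inr (Sum.inr ()), Sum.inl g.c₂⟩

/-- The gate `g` with an additional control `t`, by means of a scratch wire. -/
def ctl (t : C) (g : Gate W) : List (Gate (W ⊕ (C ⊕ Unit))) :=
  [notGate (ctlNot t g), ctlGate g, notGate (ctlNot t g)]

theorem ketMap_inl_mul_apply (κ : Bits W → Bits (W ⊕ X)) (hκ : ∀ u, κ u ∘ Sum.inl = u)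
    (N : State W) (w : Bits (W ⊕ X)) (v : Bits W) :
    (ketMap κ * N) w v = if w = κ (w ∘ Sum.inl) then N (w ∘ Sum.inl) v else 0 := by
  rw [Matrix.mul_apply, Finset.sum_eq_single (w ∘ Sum.inl)]
  · simp [ketMap]
  · intro x _ hx
    have : w ≠ κ x := by
      rintro rfl
      exact hx (hκ x).symm
    simp [ketMap, this]
  · simp

/-- The bit strings on all wires when the scratch wire has been computed. -/
def ctlBits (t : C) (g : Gate W) (c : Bits C) (u : Bits W) : Bits (W ⊕ (C ⊕ Unit)) :=
  Sum.elim u (Sum.elim c fun _ => c t && (decide (g.c₁ = g.target) || u g.c₁))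

theorem applyNot_ctlNot (t : C) (g : Gate W) (c : Bits C) (u : Bits W) :
    applyNot (ctlNot t g) (Sum.elim u (Sum.elim c fun _ => false)) = ctlBits t g c u := by
  have hA : (notGate (ctlNot t g)).Active (Sum.elim u (Sum.elim c fun _ => false)) ↔
      (c t && (decide (g.c₁ = g.target) || u g.c₁)) = true := by
    rw [notGate_active_iff]
    by_cases h : g.c₁ = g.target <;> simp [ctlNot, h]
  funext w
  rcases w with w | w | w
  · rw [applyNot_of_ne _ _ _ (by simp [ctlNot])]
    rfl
  · rw [applyNot_of_ne _ _ _ (by simp [ctlNot])]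
    rfl
  · by_cases h : (c t && (decide (g.c₁ = g.target) || u g.c₁)) = true
    · have := applyNot_target _ (hA.mpr h)
      exact this.trans h.symm
    · rw [applyNot_inactive _ (fun h' => h (hA.mp h'))]
      simp only [Bool.not_eq_true] at h
      exact h.symm

/-- An intertwining relation: the gate commutes with adjoining the control register and the computed
scratch bit, provided it is replaced by `g` or by the identity according to `c t`. The scratch bit
depends on the data only through the first control of `g`, which is either void or different from
the target, so its value is still correct after `g` has acted. -/
theorem ctlGate_mul (t : C) (g : Gate W) (c : Bits C) :
    ((ctlGate (C := C) g).mat * ketMap (ctlBits t g c) : Matrix (Bits (W ⊕ (C ⊕ Unit))) (Bits W) ℂ) =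
      ketMap (ctlBits t g c) * (if c t = true then g.mat else 1 : Matrix (Bits W) (Bits W) ℂ) := by
  ext w v
  rw [mul_ketMap_apply, ketMap_inl_mul_apply _ (fun u => rfl)]
  have hA : (ctlGate g).Active (ctlBits t g c v) ↔ (c t = true ∧ g.Active v) := by
    simp only [Gate.Active, ctlGate, ctlBits, Sum.elim_inl, Sum.elim_inr, Sum.inl.injEq,
      Bool.and_eq_true, Bool.or_eq_true, decide_eq_true_eq, reduceCtorEq, false_or]
    tauto
  by_cases h : c t = true ∧ g.Active v
  · rw [if_pos h.1]
    have key : (∀ x, x ≠ (ctlGate (C := C) g).target → w x = ctlBits t g c v x) ↔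
        (w = ctlBits t g c (w ∘ Sum.inl) ∧ ∀ x, x ≠ g.target → (w ∘ Sum.inl) x = v x) := by
      constructor
      · intro hw
        have h1 : ∀ x, x ≠ g.target → w (Sum.inl x) = v x :=
          fun x hx => hw (Sum.inl x) (by simpa [ctlGate] using hx)
        refine ⟨?_, h1⟩
        funext x
        rcases x with x | x | x
        · rfl
        · exact hw _ (by simp [ctlGate])
        · refine (hw _ (by simp [ctlGate])).trans ?_
          simp only [ctlBits, Sum.elim_inr]
          by_cases h2 : g.c₁ = g.target
          · simp [h2]
          · simp [h2, h1 _ h2]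
      · rintro ⟨h1, h2⟩ (x | x | x) hx
        · exact h2 x (by simpa [ctlGate] using hx)
        · rw [h1]
          rfl
        · rw [h1]
          simp only [ctlBits, Sum.elim_inr]
          by_cases h3 : g.c₁ = g.target
          · simp [h3]
          · simp only [h2 _ h3]
    by_cases hw : ∀ x, x ≠ (ctlGate (C := C) g).target → w x = ctlBits t g c v x
    · rw [Gate.mat_active _ hw (hA.mpr h), if_pos (key.mp hw).1,
        Gate.mat_active _ (key.mp hw).2 h.2]
      rfl
    · rw [Gate.mat_eq_zero _ hw]
      by_cases h1 : w = ctlBits t g c (w ∘ Sum.inl)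
      · rw [if_pos h1, Gate.mat_eq_zero]
        exact fun h2 => hw (key.mpr ⟨h1, h2⟩)
      · rw [if_neg h1]
  · rw [Gate.mat_inactive _ _ (fun h' => h (hA.mp h'))]
    have h1 : (if c t = true then g.mat else 1) (w ∘ Sum.inl) v =
        (1 : State W) (w ∘ Sum.inl) v := by
      by_cases hc : c t = true
      · rw [if_pos hc, Gate.mat_inactive]
        exact fun h' => h ⟨hc, h'⟩
      · rw [if_neg hc]
    rw [h1, Matrix.one_apply, Matrix.one_apply]
    have h2 : w = ctlBits t g c v ↔ w = ctlBits t g c (w ∘ Sum.inl) ∧ w ∘ Sum.inl = v := by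
      constructor
      · rintro rfl
        exact ⟨rfl, rfl⟩
      · rintro ⟨h3, h4⟩
        rw [h3, h4]
    rw [← ite_and]
    exact if_congr h2 rfl rfl

/-- Gates have at most two controls, so a third one is merged with the first into a scratch bit:
compute, act, uncompute. The last step restores 0 because a controlled NOT is an involution. -/
theorem runGates_ctl (t : C) (g : Gate W) (σ : State W) (c : Bits C) :
    runGates (ctl t g) (tensor σ (basisState (Sum.elim c fun _ => false))) =
      tensor (if c t = true then conjBy g.mat σ else σ)
        (basisState (Sum.elim c fun _ => false)) := by
  have h1 : (applyNot (ctlNot t g)) ∘ (fun u => Sum.elim u (Sum.elim c fun _ => false)) =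
      ctlBits t g c := funext fun u => applyNot_ctlNot t g c u
  have h2 : (applyNot (ctlNot t g)) ∘ ctlBits t g c =
      fun u => Sum.elim u (Sum.elim c fun _ => false) := by
    rw [← h1]
    funext u
    exact applyNot_involutive _ _
  have h3 : (if c t = true then conjBy g.mat σ else σ) =
      conjBy (if c t = true then g.mat else 1) σ := by
    split_ifs
    · rfl
    · rw [conjBy_one]
  rw [h3, tensor_basisState_eq_push, tensor_basisState_eq_push]
  change conjBy _ (conjBy _ (conjBy _ (push _ σ))) = _
  rw [notGate_mat]
  change push _ (conjBy _ (push _ (push _ σ))) = _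
  rw [push_push, h1, push, push, push, ← conjBy_mul, ← conjBy_mul,
    Matrix.mul_assoc, ctlGate_mul, ← Matrix.mul_assoc,
    ketMap_mul_ketMap, h2, conjBy_mul]

theorem runGates_flatMap_ctl (L : List (C × Gate W)) (σ : State W) (c : Bits C) :
    runGates (L.flatMap fun p => ctl p.1 p.2)
      (tensor σ (basisState (Sum.elim c fun _ => false))) =
      tensor (runGates ((L.filter fun p => c p.1).map Prod.snd) σ)
        (basisState (Sum.elim c fun _ => false)) := by
  induction L generalizing σ with
  | nil => rfl
  | cons p L ih =>
    rw [List.flatMap_cons, runGates_append, runGates_ctl, ih]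
    by_cases h : c p.1 = true
    · rw [if_pos h, List.filter_cons_of_pos (by exact h)]
      rfl
    · rw [if_neg h, List.filter_cons_of_neg (by exact h)]

/-- One scratch wire serves all gates, since each of them returns it to 0; every gate is replaced by
three. -/
theorem Transforms.conditional (L : List (C × Gate W)) (σ : ι → State W) (c : ι → Bits C) :
    Transforms F (1 + 3 * L.length) (fun i => tensor (σ i) (basisState (c i)))
      (fun i => tensor (QEnc.runGates ((L.filter fun p => c i p.1).map Prod.snd) (σ i))
        (basisState (c i))) := by
  have h1 := (addZero (F := F) Unit (fun i => tensor (σ i) (basisState (c i)))).trans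
    (relabel (Equiv.sumAssoc W C Unit) _)
  have h2 := (h1.trans (runGates (L.flatMap fun p => ctl p.1 p.2) _)).trans
    (relabel (Equiv.sumAssoc W C Unit).symm _)
  refine ((h2.trans (trOut _)).mono ?_).congr_out fun i => ?_
  · simp [List.length_flatMap, ctl]
    omega
  · rw [relabel_sumAssoc, zeroState, tensor_basisState, runGates_flatMap_ctl,
      ← tensor_basisState, relabel_sumAssoc_symm, trOut_tensor_basisState]

/-! ### Universal circuits -/

theorem nodup_allGates (W : Type) [FinEnum W] : (allGates W).Nodup := by
  have h := FinEnum.nodup_toList (α := W)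
  unfold allGates
  refine List.nodup_flatMap.mpr ⟨fun o _ => List.nodup_flatMap.mpr ⟨fun t _ =>
    List.nodup_flatMap.mpr ⟨fun c _ => h.map fun a b hab => by simpa using hab, ?_⟩, ?_⟩, ?_⟩
  · refine h.imp fun {a b} hab => ?_
    rw [Function.onFun, List.disjoint_left]
    intro g hg hg'
    obtain ⟨_, _, rfl⟩ := List.mem_map.mp hg
    obtain ⟨_, _, h'⟩ := List.mem_map.mp hg'
    simp at h'
    exact hab h'.1.symm
  · refine h.imp fun {a b} hab => ?_
    rw [Function.onFun, List.disjoint_left]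
    intro g hg hg'
    simp only [List.mem_flatMap, List.mem_map] at hg hg'
    obtain ⟨_, _, _, _, rfl⟩ := hg
    obtain ⟨_, _, _, _, h'⟩ := hg'
    simp at h'
    exact hab h'.1.symm
  · have : [Op1.X, Op1.H, Op1.T].Nodup := by decide
    refine this.imp fun {a b} hab => ?_
    rw [Function.onFun, List.disjoint_left]
    intro g hg hg'
    simp only [List.mem_flatMap, List.mem_map] at hg hg'
    obtain ⟨_, _, _, _, _, _, rfl⟩ := hg
    obtain ⟨_, _, _, _, _, _, h'⟩ := hg'
    simp at h'
    exact hab h'.1.symm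

theorem mem_allGates {W : Type} [FinEnum W] (g : Gate W) : g ∈ allGates W := by
  obtain ⟨o, t, c, c'⟩ := g
  simp only [allGates, List.mem_flatMap, List.mem_map, FinEnum.mem_toList, true_and]
  exact ⟨o, by cases o <;> simp, t, c, c', rfl⟩

/-- The bits of a description together with the gates whose presence they indicate, in the order of
execution. -/
def descGates (A B : Type) [FinEnum A] [FinEnum B] (f : Format) :
    List (DescBit A B f × Gate (A ⊕ B ⊕ Fin f.work)) :=
  (List.finRange f.slots).flatMap fun s =>
    (allGates (A ⊕ B ⊕ Fin f.work)).map fun g => (⟨s, g⟩, g)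

theorem decode_gates {A B : Type} [FinEnum A] [FinEnum B] {f : Format}
    (d : Bits (DescBit A B f)) :
    (decode d).gates = ((descGates A B f).filter fun p => d p.1).map Prod.snd := by
  simp only [decode, descGates, List.filter_flatMap, List.map_flatMap, List.filter_map,
    List.map_map]
  congr 1
  funext s
  exact (List.map_id _).symm

/-- The gates of the circuit with description `d`. -/
def decodeGates {A B : Type} [FinEnum A] [FinEnum B] {f : Format} (d : Bits (DescBit A B f)) :
    List (Gate (A ⊕ B ⊕ Fin f.work)) := ((descGates A B f).filter fun p => d p.1).map Prod.snd

theorem decode_eq {A B : Type} [FinEnum A] [FinEnum B] {f : Format}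
    (d : Bits (DescBit A B f)) : decode d = ⟨f.work, decodeGates d⟩ :=
  congrArg (QCircuit.mk f.work) (decode_gates d)

theorem length_descGates (A B : Type) [FinEnum A] [FinEnum B] [Fintype A] [Fintype B]
    (f : Format) : (descGates A B f).length ≤ Fintype.card (DescBit A B f) := by
  have h : (allGates (A ⊕ B ⊕ Fin f.work)).length ≤
      Fintype.card (Gate (A ⊕ B ⊕ Fin f.work)) := (nodup_allGates _).length_le_card
  rw [← Fintype.card_congr (DescBit.equivProd A B f), Fintype.card_prod, Fintype.card_fin,
    descGates]
  simp only [List.length_flatMap, List.length_map, List.map_const', List.sum_replicate,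
    List.length_finRange, smul_eq_mul]
  exact Nat.mul_le_mul_left _ h

/-- A description has one bit for each gate that may occur, so a fixed list of conditional gates, no
longer than the description, executes every circuit of the given format. The description survives
for later use. -/
theorem Transforms.universal [FinEnum A] [FinEnum B] {f : Format} (ρ : ι → State A)
    (d : ι → Bits (DescBit A B f)) :
    Transforms F (Fintype.card B + f.work + (1 + 3 * Fintype.card (DescBit A B f)))
      (fun i => tensor (ρ i) (basisState (d i)))
      (fun i => tensor ((decode (d i)).run (ρ i)) (basisState (d i))) := by
  have h1 := (addZero (F := F) (B ⊕ Fin f.work) ρ).frame (fun i => basisState (d i))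
  have h2 := h1.trans (conditional (descGates A B f) _ d)
  have h3 := h2.trans (((relabel (outFirst A B (Fin f.work)) _).trans (trOut _)).frame
    (fun i => basisState (d i)))
  refine (h3.mono ?_).congr_out fun i => ?_
  · have := length_descGates A B f
    simp
    omega
  · rw [decode_eq, QCircuit.run_eq]
    rfl

end Conditional

/-! ### Encryption queries answered by a party that holds the key -/

section Emulation

variable {A B W Key Coin : Type} [Fintype A] [DecidableEq A] [Fintype B] [DecidableEq B]
  [Fintype W] [DecidableEq W] [Fintype Key] [DecidableEq Key] [Fintype Coin] [DecidableEq Coin]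
  {m l m' l' : ℕ} {R : Type} [Fintype R] {ι : Type}
  {F : ι → R → Bits (Fin m') → Bits (Fin l')} {s s' : ℕ}

/-! ### Emulation of the encryption oracle by a party that has the key -/

/-- The wires on which the encryption circuit is run. -/
def encWires (q : (Fin m ⊕ Fin l) ↪ W) (work : ℕ) :
    (Key ⊕ Fin m ⊕ Coin) ⊕ Fin l ⊕ Fin work → ((W ⊕ Key) ⊕ Coin) ⊕ (Fin l ⊕ Fin work)
  | .inl (.inl k) => .inl (.inl (.inr k))
  | .inl (.inr (.inl i)) => .inl (.inl (.inl (q (.inl i))))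
  | .inl (.inr (.inr r)) => .inl (.inr r)
  | .inr c => .inr c

theorem encWires_injective (q : (Fin m ⊕ Fin l) ↪ W) (work : ℕ) :
    Function.Injective (encWires (Key := Key) (Coin := Coin) q work) := by
  rintro ((a | a | a) | a) ((b | b | b) | b) h <;> simp [encWires] at h <;> simp [h]

/-- The gates that copy the ciphertext to the answer wires. -/
def answerGates (q : (Fin m ⊕ Fin l) ↪ W) (work : ℕ) (j : Fin l) :
    (((W ⊕ Key) ⊕ Coin) ⊕ (Fin l ⊕ Fin work)) × (((W ⊕ Key) ⊕ Coin) ⊕ (Fin l ⊕ Fin work)) ×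
      (((W ⊕ Key) ⊕ Coin) ⊕ (Fin l ⊕ Fin work)) :=
  (.inl (.inl (.inl (q (.inr j)))), .inr (.inl j), .inr (.inl j))

/-- Classical gates that compute a query: run the encryption circuit, copy its result, and run it
backwards. -/
def queryNots (q : (Fin m ⊕ Fin l) ↪ W) (E : CCircuit (Key ⊕ Fin m ⊕ Coin) (Fin l)) :
    List ((((W ⊕ Key) ⊕ Coin) ⊕ (Fin l ⊕ Fin E.work)) ×
      (((W ⊕ Key) ⊕ Coin) ⊕ (Fin l ⊕ Fin E.work)) ×
      (((W ⊕ Key) ⊕ Coin) ⊕ (Fin l ⊕ Fin E.work))) :=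
  E.gates.map (mapNot (encWires q E.work)) ++ ((List.finRange l).map (answerGates q E.work) ++
    (E.gates.reverse.map (mapNot (encWires q E.work))))

/-- Compute, copy, uncompute. The copy changes only answer wires, and the encryption circuit does
not see these because `q` keeps message and answer wires apart; hence the backward run restores
everything else, ancillas included. -/
theorem applyNots_queryNots (q : (Fin m ⊕ Fin l) ↪ W)
    (E : CCircuit (Key ⊕ Fin m ⊕ Coin) (Fin l)) (w : Bits W) (k : Bits Key) (r : Bits Coin) :
    applyNots (queryNots q E) (Sum.elim (Sum.elim (Sum.elim w k) r) fun _ => false) =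
      Sum.elim (Sum.elim (Sum.elim (xorInto q
        (fun x => E.eval (Sum.elim k (Sum.elim x r))) w) k) r) fun _ => false := by
  set u₀ : Bits (((W ⊕ Key) ⊕ Coin) ⊕ (Fin l ⊕ Fin E.work)) :=
    Sum.elim (Sum.elim (Sum.elim w k) r) fun _ => false with hu₀
  have hinj := encWires_injective (Key := Key) (Coin := Coin) q E.work
  -- The contents of the wires after encryption (`u₁`), after the copy (`u₂`) and after the backward
  -- run (`u₃`).
  set u₁ := applyNots (E.gates.map (mapNot (encWires q E.work))) u₀ with hu₁
  set u₂ := applyNots ((List.finRange l).map (answerGates q E.work)) u₁ with hu₂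
  set u₃ := applyNots (E.gates.reverse.map (mapNot (encWires q E.work))) u₂ with hu₃
  have hstart : applyNots (queryNots q E) u₀ = u₃ := by
    rw [queryNots, applyNots_append, applyNots_append]
  have h0 : u₀ ∘ encWires q E.work =
      Sum.elim (Sum.elim k (Sum.elim (fun i => w (q (Sum.inl i))) r)) fun _ => false := by
    funext x
    rcases x with (x | x | x) | x <;> rfl
  have h1 : u₁ ∘ encWires q E.work = applyNots E.gates (u₀ ∘ encWires q E.work) :=
    applyNots_mapNot hinj _ _
  have off : ∀ (L : List _) u x, (∀ y, encWires q E.work y ≠ x) →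
      applyNots (L.map (mapNot (encWires (Key := Key) (Coin := Coin) q E.work))) u x = u x := by
    intro L u x hx
    refine applyNots_of_ne _ _ _ fun g hg => ?_
    obtain ⟨g, -, rfl⟩ := List.mem_map.mp hg
    exact (hx _).symm
  have h2 : ∀ j, u₂ (.inl (.inl (.inl (q (.inr j))))) =
      xor (u₁ (.inl (.inl (.inl (q (.inr j)))))) (u₁ (.inr (.inl j))) := by
    intro j
    have := applyNots_parallel (List.finRange l) (List.nodup_finRange l)
      (answerGates (Key := Key) (Coin := Coin) q E.work) (by simp [answerGates])
      (by simp [answerGates]) u₁ j (by simp)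
    refine this.trans ?_
    exact applyNot_cnot _ _ _ (by simp)
  have h2' : ∀ x, (∀ j, x ≠ .inl (.inl (.inl (q (.inr j))))) → u₂ x = u₁ x := by
    intro x hx
    refine applyNots_of_ne _ _ _ fun g hg => ?_
    obtain ⟨j, -, rfl⟩ := List.mem_map.mp hg
    exact hx j
  have h2'' : u₂ ∘ encWires q E.work = u₁ ∘ encWires q E.work := by
    funext x
    refine h2' _ fun j => ?_
    rcases x with (x | x | x) | x <;> simp [encWires]
  have h3 : u₃ ∘ encWires q E.work = u₀ ∘ encWires q E.work := by
    rw [hu₃, applyNots_mapNot hinj, h2'', h1, applyNots_reverse]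
  have hans : ∀ j y, encWires (Key := Key) (Coin := Coin) q E.work y ≠
      .inl (.inl (.inl (q (.inr j)))) := by
    intro j y
    rcases y with (y | y | y) | y <;> simp [encWires]
  rw [hstart]
  funext x
  rcases x with ((x | x) | x) | x
  -- A data wire is a message wire, an answer wire, or not involved in the query.
  · by_cases hq : ∃ i, q i = x
    · obtain ⟨i | j, rfl⟩ := hq
      · refine (congrFun h3 (Sum.inl (Sum.inr (Sum.inl i)))).trans ?_
        simp only [Sum.elim_inl]
        rw [xorInto_other _ _ _ _ (by simp)]
        rfl
      · simp only [Sum.elim_inl]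
        rw [xorInto_answer, hu₃, off _ _ _ (hans j), h2, hu₁, off _ _ _ (hans j)]
        have : u₁ (.inr (.inl j)) = applyNots E.gates (u₀ ∘ encWires q E.work) (.inr (.inl j)) :=
          congrFun h1 (Sum.inr (Sum.inl j))
        rw [← hu₁, this, h0]
        rfl
    · have hq' : ∀ y, encWires (Key := Key) (Coin := Coin) q E.work y ≠ .inl (.inl (.inl x)) := by
        intro y hy
        rcases y with (y | y | y) | y <;> simp [encWires] at hy
        exact hq ⟨_, hy⟩
      simp only [Sum.elim_inl]
      rw [xorInto_other _ _ _ _ (fun j h => hq ⟨_, h⟩), hu₃, off _ _ _ hq', h2', hu₁, off _ _ _ hq']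
      · rfl
      · intro j h
        simp at h
        exact hq ⟨_, h.symm⟩
  · exact congrFun h3 (Sum.inl (Sum.inl x))
  · exact congrFun h3 (Sum.inl (Sum.inr (Sum.inr x)))
  · exact congrFun h3 (Sum.inr x)

/-- The oracle of an encryption circuit. -/
def encOracle (E : CCircuit (Key ⊕ Fin m ⊕ Coin) (Fin l)) (k : Bits Key) (r : Bits Coin)
    (x : Bits (Fin m)) : Bits (Fin l) := E.eval (Sum.elim k (Sum.elim x r))

/-- For each value of the coins the classical gates realise the type-(1) unitary and restore their
ancillas; discarding fresh uniform coins then yields the average over them, as in the definition of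
a query. The factor 4 pays for the coins and also dominates the two runs of the encryption circuit.
-/
theorem Transforms.query (q : (Fin m ⊕ Fin l) ↪ W) (E : CCircuit (Key ⊕ Fin m ⊕ Coin) (Fin l))
    (σ : ι → State W) (k : ι → Bits Key) :
    Transforms F (4 * E.size) (fun i => tensor (σ i) (basisState (k i)))
      (fun i => tensor ((Instr.query q).exec (encOracle E (k i)) (σ i)) (basisState (k i))) := by
  have h1 := coins (F := F) Coin (fun i => tensor (σ i) (basisState (k i)))
  have h2 := addZero (F := fun p : ι × Bits Coin => F p.1) (Fin l ⊕ Fin E.work)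
    (fun p => tensor (tensor (σ p.1) (basisState (k p.1))) (basisState p.2))
  have h3 := (((h2.trans (nots (queryNots q E) _)).trans (trOut _)).trans (trOut _)).congr_out
    (outs' := fun p => tensor (conjBy (typeOne q (encOracle E (k p.1) p.2)) (σ p.1))
      (basisState (k p.1))) (by
      intro p
      have e : push (applyNots (queryNots q E)) (tensor (tensor (tensor (σ p.1)
          (basisState (k p.1))) (basisState p.2)) (zeroState (Fin l ⊕ Fin E.work))) =
          tensor (tensor (tensor (conjBy (typeOne q (encOracle E (k p.1) p.2)) (σ p.1))
          (basisState (k p.1))) (basisState p.2)) (zeroState (Fin l ⊕ Fin E.work)) := by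
        rw [typeOne_eq_ketMap]
        change _ = tensor (tensor (tensor (push _ _) _) _) _
        simp only [zeroState, tensor_basisState_eq_push, push_push]
        congr 1
        funext w
        exact applyNots_queryNots q E w (k p.1) p.2
      rw [e, zeroState, trOut_tensor_basisState, trOut_tensor_basisState])
  refine ((h1.trans (Transforms.average (outs := fun i r =>
    tensor (conjBy (typeOne q (encOracle E (k i) r)) (σ i)) (basisState (k i))) h3)).mono ?_).congr_out fun i => ?_
  · simp [queryNots, CCircuit.size]
    omega
  · rw [Instr.exec, linear_average (tensor_left_linear _)]

theorem Transforms.emulateInstrs (E : CCircuit (Key ⊕ Fin m ⊕ Coin) (Fin l))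
    (L : List (Instr m l W)) (σ : ι → State W) (k : ι → Bits Key) :
    Transforms F (L.length * (4 * E.size + 1)) (fun i => tensor (σ i) (basisState (k i)))
      (fun i => tensor (QEnc.execs (encOracle E (k i)) L (σ i)) (basisState (k i))) := by
  induction L generalizing σ with
  | nil => exact (relabel (Equiv.refl _) _).mono (Nat.zero_le _)
  | cons a L ih =>
    have h : Transforms F (4 * E.size + 1) (fun i => tensor (σ i) (basisState (k i)))
        (fun i => tensor (a.exec (encOracle E (k i)) (σ i)) (basisState (k i))) := by
      cases a with
      | query q => exact (query q E σ k).mono (Nat.le_succ _)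
      | gate g =>
        exact ((runGates [g] σ).frame (fun i => basisState (k i))).mono (by simp)
    refine (h.trans (ih _)).mono ?_
    rw [List.length_cons, Nat.add_mul, Nat.one_mul, Nat.add_comm]

theorem Transforms.emulate (E : CCircuit (Key ⊕ Fin m ⊕ Coin) (Fin l)) (C : OCircuit m l A B)
    (ρ : ι → State A) (k : ι → Bits Key) :
    Transforms F (C.size * (4 * E.size + 1)) (fun i => tensor (ρ i) (basisState (k i)))
      (fun i => tensor (C.run (encOracle E (k i)) (ρ i)) (basisState (k i))) := by
  have h1 := (addZero (F := F) (B ⊕ Fin C.work) ρ).frame (fun i => basisState (k i))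
  have h2 := h1.trans (emulateInstrs E C.instrs _ k)
  have h3 := h2.trans (((relabel (outFirst A B (Fin C.work)) _).trans (trOut _)).frame
    (fun i => basisState (k i)))
  refine (h3.mono ?_).congr_out fun i => ?_
  · simp only [Fintype.card_sum, Fintype.card_fin, OCircuit.size, Nat.add_mul]
    have := Nat.le_mul_of_pos_right (Fintype.card B) (Nat.succ_pos (4 * E.size))
    have := Nat.le_mul_of_pos_right C.work (Nat.succ_pos (4 * E.size))
    simp only [Nat.succ_eq_add_one] at *
    nlinarith
  · rw [← C.run_toProc]
    rfl

end Emulation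

end
end QEnc

namespace QEnc
noncomputable section

/-! ### Conservation of probability -/

section Trace

variable {A B C W : Type} [Fintype A] [DecidableEq A] [Fintype B] [DecidableEq B]
  [Fintype C] [DecidableEq C] [Fintype W] [DecidableEq W]
  {m l : ℕ} {R : Type} [Fintype R]

/-! ### Preservation of the trace -/

theorem trace_conjBy {X Y : Type} [Fintype X] [DecidableEq X] [Fintype Y] {U : Matrix Y X ℂ}
    (hU : Uᴴ * U = 1) (σ : Matrix X X ℂ) : (conjBy U σ).trace = σ.trace := by
  rw [conjBy, Matrix.trace_mul_comm, ← Matrix.mul_assoc, hU, Matrix.one_mul]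

theorem ketMap_isometry {f : Bits A → Bits B} (hf : Function.Injective f) :
    (ketMap f)ᴴ * ketMap f = 1 := by
  ext u v
  rw [mul_ketMap_apply, Matrix.conjTranspose_apply, Matrix.one_apply]
  simp [ketMap, hf.eq_iff, eq_comm]

theorem Op1.mat_unitary (o : Op1) (a a' : Bool) :
    ∑ b, star (o.mat b a) * o.mat b a' = if a = a' then 1 else 0 := by
  have h2 : (Real.sqrt 2 : ℂ)⁻¹ * (Real.sqrt 2 : ℂ)⁻¹ = 1 / 2 := by
    rw [← mul_inv, ← Complex.ofReal_mul, Real.mul_self_sqrt (by norm_num)]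
    norm_num
  cases o
  · cases a <;> cases a' <;> simp [Op1.mat]
  · cases a <;> cases a' <;> simp [Op1.mat, div_eq_mul_inv, h2, Complex.conj_ofReal] <;> norm_num
  · have h4 : (starRingEnd ℂ) 4 = 4 := map_ofNat _ 4
    cases a <;> cases a' <;> simp [Op1.mat, ← Complex.exp_conj, ← Complex.exp_add, h4]

/-- Activity does not depend on the target bit, so the matrix is block diagonal over the bits off
the target, with blocks given by the unitary one-qubit matrix or the identity. -/
theorem Gate.mat_isometry (g : Gate W) : g.matᴴ * g.mat = 1 := by
  ext u v
  rw [Matrix.mul_apply]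
  simp only [Matrix.conjTranspose_apply]
  by_cases h : ∀ w, w ≠ g.target → u w = v w
  · have hact : g.Active u ↔ g.Active v := by
      unfold Gate.Active
      by_cases h1 : g.c₁ = g.target <;> by_cases h2 : g.c₂ = g.target <;> simp [h1, h2, h]
    by_cases hA : g.Active v
    · have hinj : Function.Injective (fun b : Bool => Function.update v g.target b) :=
        Function.update_injective v g.target
      have hsum : ∑ x, star (g.mat x u) * g.mat x v = ∑ b : Bool,
          star (g.mat (Function.update v g.target b) u) *
            g.mat (Function.update v g.target b) v := by
        symm
        refine Fintype.sum_of_injective _ hinj _ _ (fun x hx => ?_) fun b => rfl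
        rw [Gate.mat_eq_zero (v := v), mul_zero]
        intro hx'
        apply hx
        refine ⟨x g.target, ?_⟩
        funext w
        by_cases hw : w = g.target
        · subst hw; simp
        · simp [hw, hx' w hw]
      have e : ∀ b, ∀ w, w ≠ g.target → Function.update v g.target b w = v w :=
        fun b w hw => Function.update_of_ne hw _ _
      have hb : ∀ b, star (g.mat (Function.update v g.target b) u) *
            g.mat (Function.update v g.target b) v =
            star (g.op.mat b (u g.target)) * g.op.mat b (v g.target) := by
        intro b
        rw [Gate.mat_active _ (fun w hw => (e b w hw).trans (h w hw).symm) (hact.mpr hA),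
          Gate.mat_active _ (e b) hA, Function.update_self]
      rw [hsum]
      simp only [hb]
      rw [Op1.mat_unitary, Matrix.one_apply]
      have : u = v ↔ u g.target = v g.target := by
        refine ⟨fun h' => by rw [h'], fun h' => funext fun w => ?_⟩
        by_cases hw : w = g.target
        · rw [hw, h']
        · exact h w hw
      exact if_congr this.symm rfl rfl
    · have h1 : ∀ x, star (g.mat x u) * g.mat x v = ((1 : State W)ᴴ) u x * (1 : State W) x v := by
        intro x
        rw [Gate.mat_inactive _ _ hA, Gate.mat_inactive _ _ (fun h' => hA (hact.mp h')),
          Matrix.conjTranspose_apply]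
      simp only [h1]
      rw [← Matrix.mul_apply, Matrix.conjTranspose_one, Matrix.one_mul]
  · rw [Matrix.one_apply_ne (by rintro rfl; exact h fun _ _ => rfl)]
    refine Finset.sum_eq_zero fun x _ => ?_
    by_cases hx : ∀ w, w ≠ g.target → x w = v w
    · rw [Gate.mat_eq_zero (v := u), star_zero, zero_mul]
      intro hx'
      exact h fun w hw => (hx' w hw).symm.trans (hx w hw)
    · rw [Gate.mat_eq_zero _ hx, mul_zero]

theorem xorInto_involutive (q : (Fin m ⊕ Fin l) ↪ W) (F : Bits (Fin m) → Bits (Fin l)) :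
    Function.Involutive (xorInto q F) := by
  intro u
  have h : (fun i => xorInto q F u (q (Sum.inl i))) = fun i => u (q (Sum.inl i)) :=
    funext fun i => xorInto_other _ _ _ _ (by simp)
  funext w
  by_cases hw : ∃ j, q (Sum.inr j) = w
  · obtain ⟨j, rfl⟩ := hw
    rw [xorInto_answer, h, xorInto_answer]
    simp
  · push Not at hw
    rw [xorInto_other _ _ _ _ hw, xorInto_other _ _ _ _ hw]

theorem trace_average {κ : Type} [Fintype κ] (f : κ → State A) :
    (average f).trace = average fun k => (f k).trace := by
  simp [average, Matrix.trace_smul, Matrix.trace_sum]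

theorem average_const {κ M : Type} [Fintype κ] [Nonempty κ] [AddCommGroup M] [Module ℝ M]
    (c : M) : average (fun _ : κ => c) = c := by
  have : (Fintype.card κ : ℝ) ≠ 0 := by
    exact_mod_cast Fintype.card_ne_zero
  rw [average, Finset.sum_const, Finset.card_univ, ← Nat.cast_smul_eq_nsmul ℝ, smul_smul,
    inv_mul_cancel₀ this, one_smul]

theorem trace_execs [Nonempty R] (F : R → Bits (Fin m) → Bits (Fin l)) (L : List (Instr m l W))
    (σ : State W) : (execs F L σ).trace = σ.trace := by
  induction L generalizing σ with
  | nil => rfl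
  | cons i L ih =>
    refine (ih _).trans ?_
    cases i with
    | gate g => exact trace_conjBy g.mat_isometry σ
    | query q =>
      refine (trace_average fun r => conjBy (typeOne q (F r)) σ).trans ?_
      have : ∀ r, (conjBy (typeOne q (F r)) σ).trace = σ.trace := fun r => by
        rw [typeOne_eq_ketMap]
        exact trace_conjBy (ketMap_isometry (xorInto_involutive q (F r)).injective) σ
      simp only [this, average_const]

theorem OCircuit.trace_run [Nonempty R] (C : OCircuit m l A B)
    (F : R → Bits (Fin m) → Bits (Fin l)) (ρ : State A) : (C.run F ρ).trace = ρ.trace := by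
  rw [← C.run_toProc, Proc.run, trace_trOut, trace_relabel, trace_execs, trace_tensor,
    zeroState, trace_basisState, mul_one]

theorem QCircuit.trace_run (C : QCircuit A B) (ρ : State A) : (C.run ρ).trace = ρ.trace := by
  rw [← C.run_toOCircuit (m := 0) (l := 0) (fun (_ : Unit) x => x), OCircuit.trace_run]

/-- Decryption is a left inverse. Correctness is only available for keys in the range of Gen, whence
the formulation through the coins `g`. -/
theorem Scheme.enc_injective (E : Scheme) (n : ℕ) (g : Bits (Fin (E.genCoins n)))
    (r : Bits (Fin (E.encCoins n))) : Function.Injective (E.enc n (E.key n g) r) := by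
  intro x y h
  have h1 := E.correct n g x r fun _ => false
  have h2 := E.correct n g y r fun _ => false
  rw [← h1, ← h2]
  unfold Scheme.enc Scheme.key at h
  rw [h]

theorem Scheme.typeTwo_eq (E : Scheme) (n : ℕ) (k : Bits (Fin (E.keyLen n)))
    (r : Bits (Fin (E.encCoins n))) : E.typeTwo n k r = ketMap (E.enc n k r) := by
  ext u v
  simp [Scheme.typeTwo, ketMap]

theorem Scheme.trace_encState (E : Scheme) (n : ℕ) (g : Bits (Fin (E.genCoins n)))
    (ρ : State (Fin (E.msgLen n))) : (E.encState n (E.key n g) ρ).trace = ρ.trace := by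
  rw [Scheme.encState, trace_average]
  simp only [E.typeTwo_eq, trace_conjBy (ketMap_isometry (E.enc_injective n g _)), average_const]

theorem probBit_add (ρ : State (Fin 1)) : probBit ρ true + probBit ρ false = ρ.trace.re := by
  have : ∀ f : Bits (Fin 1) → ℂ, ∑ x, f x = f (fun _ => true) + f (fun _ => false) := by
    intro f
    rw [← (Equiv.funUnique (Fin 1) Bool).symm.sum_comp, Fintype.sum_bool]
    congr 2
  simp [Matrix.trace, this, probBit]

/-- The trace of an operator as the sum over the outcomes of a measurement. -/
theorem sum_trace_measured (σ : State (A ⊕ C)) : ∑ t, (measured σ t).trace = σ.trace := by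
  simp only [Matrix.trace, Matrix.diag, measured, Matrix.of_apply]
  rw [sum_bits_sum, Finset.sum_comm]

theorem probBit_linear_sum {κ : Type} (s : Finset κ) (f : κ → State (Fin 1)) (b : Bool) :
    probBit (∑ k ∈ s, f k) b = ∑ k ∈ s, probBit (f k) b := by
  simp [probBit, Matrix.sum_apply]

theorem probBit_average {κ : Type} [Fintype κ] (f : κ → State (Fin 1)) (b : Bool) :
    probBit (average f) b = average fun k => probBit (f k) b := by
  simp [probBit, average, Matrix.sum_apply]

end Trace

/-! ### Closure properties of polynomial bounds and negligible functions -/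

section Asymptotics

/-! ### Polynomially bounded and negligible functions -/

theorem PolyBounded.mono {f g : ℕ → ℕ} (hg : PolyBounded g) (h : ∀ n, f n ≤ g n) :
    PolyBounded f := by
  obtain ⟨p, n₀, hp⟩ := hg
  exact ⟨p, n₀, fun n hn => (h n).trans (hp n hn)⟩

theorem PolyBounded.const (c : ℕ) : PolyBounded fun _ => c :=
  ⟨Polynomial.C c, 0, fun n _ => by simp⟩

theorem PolyBounded.add {f g : ℕ → ℕ} (hf : PolyBounded f) (hg : PolyBounded g) :
    PolyBounded fun n => f n + g n := by
  obtain ⟨p, n₀, hp⟩ := hf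
  obtain ⟨q, n₁, hq⟩ := hg
  refine ⟨p + q, max n₀ n₁, fun n hn => ?_⟩
  rw [Polynomial.eval_add]
  exact Nat.add_le_add (hp n (le_of_max_le_left hn)) (hq n (le_of_max_le_right hn))

theorem PolyBounded.mul {f g : ℕ → ℕ} (hf : PolyBounded f) (hg : PolyBounded g) :
    PolyBounded fun n => f n * g n := by
  obtain ⟨p, n₀, hp⟩ := hf
  obtain ⟨q, n₁, hq⟩ := hg
  refine ⟨p * q, max n₀ n₁, fun n hn => ?_⟩
  rw [Polynomial.eval_mul]
  exact Nat.mul_le_mul (hp n (le_of_max_le_left hn)) (hq n (le_of_max_le_right hn))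

theorem Negligible.mono {ε δ : ℕ → ℝ} (h : Negligible δ) (hle : ∀ n, ε n ≤ δ n) :
    Negligible ε := by
  intro p hp
  obtain ⟨n₀, h⟩ := h p hp
  exact ⟨n₀, fun n hn => (hle n).trans (h n hn)⟩

theorem Negligible.max {ε δ : ℕ → ℝ} (h : Negligible ε) (h' : Negligible δ) :
    Negligible fun n => max (ε n) (δ n) := by
  intro p hp
  obtain ⟨n₀, h⟩ := h p hp
  obtain ⟨n₁, h'⟩ := h' p hp
  exact ⟨Max.max n₀ n₁, fun n hn => max_le (h n (le_of_max_le_left hn))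
    (h' n (le_of_max_le_right hn))⟩

theorem Negligible.two_mul {ε : ℕ → ℝ} (h : Negligible ε) : Negligible fun n => 2 * ε n := by
  intro p hp
  obtain ⟨n₀, h⟩ := h (2 * p) (fun n => by
    rw [Polynomial.eval_mul]
    simpa using hp n)
  refine ⟨n₀, fun n hn => ?_⟩
  have h1 := h n hn
  rw [Polynomial.eval_mul] at h1
  have h2 : Polynomial.eval (n : ℝ) (2 : Polynomial ℝ) = 2 := by simp
  rw [h2, one_div, mul_inv] at h1
  rw [one_div]
  linarith

end Asymptotics

end
end QEnc

namespace QEnc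
noncomputable section

/-! ### Descriptions of circuits assembled from given bits -/

section Description

variable {A A' B C W X : Type} [Fintype A] [DecidableEq A] [Fintype A'] [DecidableEq A']
  [Fintype B] [DecidableEq B] [Fintype C] [DecidableEq C] [Fintype W] [DecidableEq W]
  [Fintype X] [DecidableEq X]

/-! ### Descriptions whose bits are copies of given bits -/

/-- The gates of a list of conditional gates that are present if the conditions are evaluated on the
bit string `c`. -/
def activeGates (L : List ((Bool ⊕ C) × Gate W)) (c : Bits C) : List (Gate W) :=
  (L.filter fun p => Sum.elim id c p.1).map Prod.snd

theorem activeGates_append (L L' : List ((Bool ⊕ C) × Gate W)) (c : Bits C) :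
    activeGates (L ++ L') c = activeGates L c ++ activeGates L' c := by
  simp [activeGates]

theorem activeGates_map (f : W → X) (L : List ((Bool ⊕ C) × Gate W)) (c : Bits C) :
    activeGates (L.map fun p => (p.1, p.2.map f)) c = (activeGates L c).map (Gate.map f) := by
  simp only [activeGates, List.filter_map, List.map_map]
  rfl

/-- The description of a list of conditional gates, with one block for each of them. -/
def describe (k : ℕ) (L : List ((Bool ⊕ C) × Gate (A ⊕ B ⊕ Fin k))) :
    DescBit A B ⟨k, L.length⟩ → Bool ⊕ C :=
  fun b => if b.gate = (L.get b.slot).2 then (L.get b.slot).1 else Sum.inl false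

theorem filter_eq_and {α : Type} [DecidableEq α] {L : List α} (hL : L.Nodup) {a : α} (ha : a ∈ L)
    (b : Bool) : L.filter (fun x => if x = a then b else false) = if b then [a] else [] := by
  cases b
  · simp
  · have : (fun x => if x = a then true else false) = fun x => x == a := by
      funext x
      by_cases h : x = a <;> simp [h]
    rw [this, List.filter_beq, List.count_eq_one_of_mem hL ha]
    simp

/-- In each block only the bit of one designated gate can be set. As `allGates` contains every gate
exactly once, the block contributes this gate or nothing, and the order of the blocks is the order
of execution. -/
theorem decode_describe [FinEnum A] [FinEnum B] (k : ℕ)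
    (L : List ((Bool ⊕ C) × Gate (A ⊕ B ⊕ Fin k))) (c : Bits C) :
    decode (fill (describe k L) c) = ⟨k, activeGates L c⟩ := by
  have h1 : ∀ s : Fin L.length, (allGates (A ⊕ B ⊕ Fin k)).filter
      (fun g => fill (describe k L) c ⟨s, g⟩) =
      if Sum.elim id c (L.get s).1 then [(L.get s).2] else [] := by
    intro s
    rw [← filter_eq_and (nodup_allGates _) (mem_allGates (L.get s).2)]
    congr 1
    funext g
    simp only [fill, describe]
    split_ifs <;> simp
  have h2 : ∀ L : List ((Bool ⊕ C) × Gate (A ⊕ B ⊕ Fin k)),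
      L.flatMap (fun p => if Sum.elim id c p.1 then [p.2] else []) = activeGates L c := by
    intro L
    induction L with
    | nil => rfl
    | cons p L ih =>
      rw [List.flatMap_cons, ih]
      by_cases h : Sum.elim id c p.1 = true <;> simp [activeGates, h]
  refine congrArg (QCircuit.mk k) ?_
  rw [← h2]
  conv_rhs => rw [← List.map_get_finRange L, List.flatMap_map]
  simp only [h1]

/-- The wires of a circuit that contains a smaller one. -/
def embedWires {k k' : ℕ} (q : (A ⊕ Fin k) ⊕ X ≃ A' ⊕ Fin k') :
    (A ⊕ B ⊕ Fin k) ⊕ X ≃ A' ⊕ B ⊕ Fin k' :=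
  ((outFirst A B (Fin k)).sumCongr (Equiv.refl X)).trans ((Equiv.sumAssoc B (A ⊕ Fin k) X).trans
    (((Equiv.refl B).sumCongr q).trans (outFirst A' B (Fin k')).symm))

/-- The additional wires only enlarge the part of the register that is discarded. -/
theorem trOut_embedWires {k k' : ℕ} (q : (A ⊕ Fin k) ⊕ X ≃ A' ⊕ Fin k')
    (σ : State ((A ⊕ B ⊕ Fin k) ⊕ X)) :
    trOut (relabel (outFirst A' B (Fin k')) (relabel (embedWires q) σ)) =
      trOut (relabel (outFirst A B (Fin k)) (trOut σ)) := by
  have : relabel (outFirst A' B (Fin k')) (relabel (embedWires q) σ) =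
      relabel ((Equiv.refl B).sumCongr q) (relabel (Equiv.sumAssoc B (A ⊕ Fin k) X)
        (relabel ((outFirst A B (Fin k)).sumCongr (Equiv.refl X)) σ)) := by
    rw [embedWires, ← relabel_relabel, ← relabel_relabel, ← relabel_relabel]
    have := relabel_symm_relabel (outFirst A' B (Fin k')).symm
      (relabel ((Equiv.refl B).sumCongr q) (relabel (Equiv.sumAssoc B (A ⊕ Fin k) X)
        (relabel ((outFirst A B (Fin k)).sumCongr (Equiv.refl X)) σ)))
    exact this
  rw [this, trOut_relabel_right, trOut_relabel_sumAssoc, trOut_relabel_left]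

theorem runGates_map_equiv (e : W ≃ X) (L : List (Gate W)) (σ : State W) :
    runGates (L.map (Gate.map e)) (relabel e σ) = relabel e (runGates L σ) := by
  have := execs_map_equiv (m := 0) (l := 0) (fun (_ : Unit) x => x) e (L.map Instr.gate) σ
  rw [execs_gates, List.map_map] at this
  rw [← this, ← execs_gates (fun (_ : Unit) (x : Bits (Fin 0)) => x), List.map_map]
  rfl

theorem relabel_basisState_comp (e : W ≃ X) (x : Bits X) :
    relabel e (basisState (x ∘ e)) = basisState x := by
  rw [relabel_basisState]
  congr 1
  funext w
  simp

/-- The channel of a circuit that runs the gates `L` on the wires `(A ⊕ B ⊕ Fin k) ⊕ X`. -/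
theorem run_embedWires {k k' : ℕ} (q : (A ⊕ Fin k) ⊕ X ≃ A' ⊕ Fin k')
    (C : List (Gate (A' ⊕ B ⊕ Fin k'))) (L : List (Gate ((A ⊕ B ⊕ Fin k) ⊕ X)))
    (hC : C = L.map (Gate.map (embedWires q))) (x : Bits A') :
    (QCircuit.mk k' C).run (basisState x) =
      trOut (relabel (outFirst A B (Fin k)) (trOut (runGates L (basisState
        ((Sum.elim x fun _ => false) ∘ embedWires q))))) := by
  rw [QCircuit.run_eq, ← trOut_embedWires q, ← runGates_map_equiv (embedWires q),
    relabel_basisState_comp, hC, zeroState, tensor_basisState]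

theorem runGates_flatMap_ctl' (L : List (Gate W)) (t : C) (σ : State W) (c : Bits C) :
    runGates (L.flatMap (ctl t)) (tensor σ (basisState (Sum.elim c fun _ => false))) =
      tensor (if c t = true then runGates L σ else σ)
        (basisState (Sum.elim c fun _ => false)) := by
  have := runGates_flatMap_ctl (L.map fun g => (t, g)) σ c
  rw [List.flatMap_map] at this
  rw [this, List.filter_map, List.map_map]
  change tensor (runGates ((L.filter fun _ => c t).map id) σ) _ = _
  by_cases h : c t = true
  · rw [if_pos h, h, List.filter_true, List.map_id]
  · rw [if_neg h, Bool.eq_false_of_not_eq_true h, List.filter_false]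
    rfl

theorem runGates_not (t : C) (σ : State W) (c : Bits C) :
    runGates [notGate ((Sum.inr (Sum.inl t), Sum.inr (Sum.inl t), Sum.inr (Sum.inl t)) :
      (W ⊕ (C ⊕ X)) × (W ⊕ (C ⊕ X)) × (W ⊕ (C ⊕ X)))]
      (tensor σ (basisState (Sum.elim c fun _ => false))) =
      tensor σ (basisState (Sum.elim (Function.update c t (!c t)) fun _ => false)) := by
  rw [← List.map_singleton, runGates_notGate, tensor_basisState_eq_push,
    tensor_basisState_eq_push, push_push]
  congr 1
  funext u w
  have hA : ∀ v : Bits (W ⊕ (C ⊕ X)), (notGate ((Sum.inr (Sum.inl t), Sum.inr (Sum.inl t),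
      Sum.inr (Sum.inl t)) : (W ⊕ (C ⊕ X)) × (W ⊕ (C ⊕ X)) × (W ⊕ (C ⊕ X)))).Active v :=
    fun v => ⟨Or.inl rfl, Or.inl rfl⟩
  change applyNot _ _ w = _
  rcases w with w | w | w
  · rw [applyNot_of_ne _ _ _ (by simp)]
    rfl
  · by_cases h : w = t
    · subst h
      rw [applyNot_target _ (hA _)]
      exact (Function.update_self w (!c w) c).symm
    · rw [applyNot_of_ne _ _ _ (by simpa using h)]
      exact (Function.update_of_ne h (!c t) c).symm
  · rw [applyNot_of_ne _ _ _ (by simp)]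
    rfl

end Description

section Averages

theorem average_comm {κ κ' M : Type} [Fintype κ] [Fintype κ'] [AddCommGroup M] [Module ℝ M]
    (f : κ → κ' → M) :
    average (fun x => average fun y => f x y) = average fun y => average fun x => f x y := by
  simp only [average, ← Finset.smul_sum]
  rw [smul_comm, Finset.sum_comm]

theorem average_sum {κ κ' M : Type} [Fintype κ] [Fintype κ'] [AddCommGroup M] [Module ℝ M]
    (f : κ → κ' → M) : average (fun x => ∑ y, f x y) = ∑ y, average fun x => f x y := by
  simp only [average, ← Finset.smul_sum]
  rw [Finset.sum_comm]

theorem average_bits_one {M : Type} [AddCommGroup M] [Module ℝ M] (f : Bool → M) :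
    average (fun y : Bits (Fin 1) => f (y 0)) = average f := by
  rw [average, average]
  congr 1

theorem average_bool (f : Bool → ℝ) : average f = (f true + f false) / 2 := by
  simp [average]
  ring

end Averages

end
end QEnc

namespace QEnc
noncomputable section

/-! ### The template whose seed selects one of two described states -/

section Selection

/-! ### A template that selects one of two described states -/

variable (m : ℕ) (fmt : Format)

/-- The conditional gates that run the first or the second described circuit according to a
control bit. -/
def selectList : List ((Bool ⊕ (StateDescBit m fmt ⊕ StateDescBit m fmt)) ×
    Gate ((Fin 0 ⊕ Fin m ⊕ Fin fmt.work) ⊕ (Fin 1 ⊕ Unit))) :=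
  let flip : Gate ((Fin 0 ⊕ Fin m ⊕ Fin fmt.work) ⊕ (Fin 1 ⊕ Unit)) :=
    notGate (Sum.inr (Sum.inl 0), Sum.inr (Sum.inl 0), Sum.inr (Sum.inl 0))
  [(Sum.inl true, flip)] ++
    (((descGates (Fin 0) (Fin m) fmt).flatMap fun p =>
      (ctl 0 p.2).map fun g => (Sum.inr (Sum.inl p.1), g)) ++
    ([(Sum.inl true, flip)] ++
    ((descGates (Fin 0) (Fin m) fmt).flatMap fun p =>
      (ctl 0 p.2).map fun g => (Sum.inr (Sum.inr p.1), g))))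

/-- The wires of the selecting circuit. -/
def selectWires (w : ℕ) : (Fin 0 ⊕ Fin w) ⊕ (Fin 1 ⊕ Unit) ≃ Fin 1 ⊕ Fin (w + 1) :=
  ((Equiv.sumAssoc (Fin 0 ⊕ Fin w) (Fin 1) Unit).symm.trans
    (((Equiv.sumComm (Fin 0 ⊕ Fin w) (Fin 1)).sumCongr (Equiv.refl Unit)).trans
      (Equiv.sumAssoc (Fin 1) (Fin 0 ⊕ Fin w) Unit))).trans
    ((Equiv.refl (Fin 1)).sumCongr (Fintype.equivFinOfCardEq (by simp)))

/-- The conditional gates of `selectList` on the wires of a circuit with one input. -/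
def selectDesc : List ((Bool ⊕ (StateDescBit m fmt ⊕ StateDescBit m fmt)) ×
    Gate (Fin 1 ⊕ Fin m ⊕ Fin (fmt.work + 1))) :=
  (selectList m fmt).map fun p => (p.1, p.2.map (embedWires (selectWires fmt.work)))

/-- The lengths of a template with a one-bit seed, no advice and a one-bit target `|0⟩`. -/
abbrev bitShape (f : Format) : TemplateShape := ⟨1, 0, 1, f, ⟨0, 0⟩, ⟨0, 0⟩⟩

/-- The format of the selecting circuit. -/
def selectFormat : Format := ⟨fmt.work + 1, (selectDesc m fmt).length⟩

/-- The bits of the selecting template in terms of the two descriptions. -/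
def selectTemplate : TemplateBit m (bitShape (selectFormat m fmt)) →
    Bool ⊕ (StateDescBit m fmt ⊕ StateDescBit m fmt) :=
  Sum.elim (describe (fmt.work + 1) (selectDesc m fmt)) fun _ => Sum.inl false

variable {m fmt}

theorem activeGates_flatMap_ctl {C W V K : Type} [Fintype C] [DecidableEq C] [Fintype W]
    [DecidableEq W] [Fintype K] [DecidableEq K] (L : List (V × Gate W)) (κ : V → K) (t : C) (c : Bits K) :
    activeGates (L.flatMap fun p => (ctl t p.2).map fun g => (Sum.inr (κ p.1), g)) c =
      ((L.filter fun p => c (κ p.1)).map Prod.snd).flatMap (ctl t) := by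
  induction L with
  | nil => rfl
  | cons p L ih =>
    rw [List.flatMap_cons, activeGates_append, ih]
    by_cases h : c (κ p.1) = true <;> simp [activeGates, h, ctl]

/-- Two kinds of control are at work: a gate is present in the template if its bit in the
description is set, and it acts during the run if the control wire carries 1. The first circuit runs
between two flips of this wire, the second one after them, so exactly one of them acts. -/
theorem runGates_selectList (t : Bits (StateDescBit m fmt ⊕ StateDescBit m fmt))
    (σ : State (Fin 0 ⊕ Fin m ⊕ Fin fmt.work)) (y : Bits (Fin 1)) :
    runGates (activeGates (selectList m fmt) t)
      (tensor σ (basisState (Sum.elim y fun _ => false))) =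
      tensor (runGates (decodeGates fun i => t (if y 0 then Sum.inr i else Sum.inl i)) σ)
        (basisState (Sum.elim y fun _ => false)) := by
  have h1 : ∀ g : Gate ((Fin 0 ⊕ Fin m ⊕ Fin fmt.work) ⊕ (Fin 1 ⊕ Unit)),
      activeGates [(Sum.inl true, g)] t = [g] := fun g => rfl
  rw [selectList, activeGates_append, activeGates_append, activeGates_append, h1,
    activeGates_flatMap_ctl, activeGates_flatMap_ctl,
    ← decodeGates.eq_1 (fun i => t (Sum.inl i)), ← decodeGates.eq_1 (fun i => t (Sum.inr i)),
    runGates_append, runGates_append, runGates_append,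
    runGates_not, runGates_flatMap_ctl', runGates_not, runGates_flatMap_ctl']
  have h2 : Function.update (Function.update y 0 (!y 0)) 0
      (!Function.update y 0 (!y 0) 0) = y := by
    rw [Function.update_self, Bool.not_not, Function.update_idem, Function.update_eq_self]
  rw [h2, Function.update_self]
  cases h : y 0
  · rw [if_neg (show ¬ (false = true) by decide), if_pos (show (!false) = true from rfl)]
    rfl
  · rw [if_pos (show true = true from rfl), if_neg (show ¬ ((!true) = true) by decide)]
    rfl

theorem plaintext_select (t : Bits (StateDescBit m fmt ⊕ StateDescBit m fmt))
    (y : Bits (Fin 1)) :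
    plaintext (s := bitShape (selectFormat m fmt)) (fill (selectTemplate m fmt) t) y =
      describedState fun i => t (if y 0 then Sum.inr i else Sum.inl i) := by
  have h1 := run_embedWires (B := Fin m) (selectWires fmt.work) _ _
    (activeGates_map (embedWires (selectWires fmt.work)) (selectList m fmt) t) y
  have h2 : plaintext (s := bitShape (selectFormat m fmt)) (fill (selectTemplate m fmt) t) y =
      (decode (fill (describe (fmt.work + 1) (selectDesc m fmt)) t)).run (basisState y) := rfl
  rw [h2, decode_describe]
  refine h1.trans ?_
  have h3 : (Sum.elim y fun _ => false) ∘ embedWires (B := Fin m) (selectWires fmt.work) =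
      Sum.elim (fun _ => false) (Sum.elim y fun _ => false) := by
    funext w
    rcases w with (w | w | w) | w | w
    · exact w.elim0
    · rfl
    · rfl
    · rfl
    · rfl
  rw [h3, ← tensor_basisState, runGates_selectList, trOut_tensor_basisState, describedState,
    decode_eq, QCircuit.run_eq, zeroState, tensor_basisState]
  congr 4
  funext w
  rcases w with w | w
  · rfl
  · rfl

/-- Two flips, and three gates for each potential gate of either description. -/
theorem length_selectDesc :
    (selectDesc m fmt).length ≤ 2 + 6 * Fintype.card (StateDescBit m fmt) := by
  have : _ ≤ Fintype.card (StateDescBit m fmt) := length_descGates (Fin 0) (Fin m) fmt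
  simp [selectDesc, selectList, ctl, List.length_flatMap]
  omega

/-- Keeps only what the reduction needs: the format bounds and the fact that the template arises
from the two descriptions by copying bits. The additional work wire is the scratch wire of the
controlled gates. -/
theorem exists_selectTemplate (m : ℕ) (fmt : Format) :
    ∃ (f : Format) (sel : TemplateBit m (bitShape f) →
      Bool ⊕ (StateDescBit m fmt ⊕ StateDescBit m fmt)),
      f.work = fmt.work + 1 ∧ f.slots ≤ 2 + 6 * Fintype.card (StateDescBit m fmt) ∧
      ∀ t (y : Bits (Fin 1)), plaintext (s := bitShape f) (fill sel t) y =
        describedState fun i => t (if y 0 then Sum.inr i else Sum.inl i) :=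
  ⟨selectFormat m fmt, selectTemplate m fmt, rfl, length_selectDesc, plaintext_select⟩

end Selection

section States

variable {A B C : Type} [Fintype A] [DecidableEq A] [Fintype B] [DecidableEq B]
  [Fintype C] [DecidableEq C]

theorem QCircuit.run_of_no_gates (k : ℕ) (ρ : State A) :
    (QCircuit.mk k [] : QCircuit A B).run ρ = ρ.trace • zeroState B := by
  have h : relabel (outFirst A B (Fin k)) (tensor ρ (zeroState (B ⊕ Fin k))) =
      tensor (zeroState B) (tensor ρ (zeroState (Fin k))) := by
    rw [← tensor_zeroState, outFirst, ← relabel_relabel, ← relabel_relabel,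
      relabel_sumAssoc_symm, relabel_sumCongr, relabel_sumComm, relabel_refl, relabel_sumAssoc]
  rw [QCircuit.run_eq]
  change trOut (relabel (outFirst A B (Fin k)) (tensor ρ (zeroState (B ⊕ Fin k)))) = _
  rw [h, trOut_tensor, trace_tensor, zeroState, trace_basisState, mul_one]

/-- Operators on an empty register are scalars; so an advice state without qubits carries no
information. -/
theorem eq_of_trace_eq {ρ σ : State (Fin 0)} (h : ρ.trace = σ.trace) : ρ = σ := by
  ext u v
  obtain rfl : v = u := Subsingleton.elim _ _
  rw [Matrix.trace, Matrix.trace, Fintype.sum_subsingleton _ v, Fintype.sum_subsingleton _ v] at h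
  exact h

variable {m : ℕ} {s : TemplateShape}

theorem trace_plaintext (T : Bits (TemplateBit m s)) (y : Bits (Fin s.seed)) :
    (plaintext T y).trace = 1 := by
  rw [plaintext, QCircuit.trace_run, trace_basisState]

theorem trace_adviceState (T : Bits (TemplateBit m s)) (y : Bits (Fin s.seed)) :
    (adviceState T y).trace = 1 := by
  rw [adviceState, QCircuit.trace_run, trace_plaintext]

theorem sum_advTemplateProb (E : Scheme) (n : ℕ) (a : SEMAdversary (E.msgLen n) (E.ctLen n)) :
    ∑ T, advTemplateProb E n a T = 1 := by
  simp only [advTemplateProb, advMemory, ← average_sum, ← Complex.re_sum, sum_trace_measured,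
    OCircuit.trace_run, trace_basisState, average_const, Complex.one_re]

theorem accept_linear_average {κ : Type} [Fintype κ] (D : Distinguisher m s)
    (T : Bits (TemplateBit m s)) (y : Bits (Fin s.seed)) (f : κ → State (Fin s.target)) :
    accept D T y (average f) = average fun k => accept D T y (f k) := by
  simp only [accept]
  rw [← probBit_average, linear_average (f := fun ρ => D.run (tensor (basisState T)
    (tensor (basisState y) ρ)))]
  exact linear_comp D.run_linear (linear_tensor_right _ (linear_tensor_right _ linear_id))

end States

/-! ### The equality-testing distinguisher -/

section Equality

/-! ### A distinguisher that compares the seed with the answer of the player -/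

/-- The answer is measured, the seed bit is added to it, and the result is negated, so that 1 is
output exactly in case of equality. -/
theorem exists_compare (TB : Type) [Fintype TB] [DecidableEq TB] :
    ∃ D : QCircuit (TB ⊕ (Fin 1 ⊕ Fin 1)) (Fin 1), D.size ≤ Fintype.card TB + 20 ∧
      ∀ T (y : Bits (Fin 1)) ρ, probBit (D.run (tensor (basisState T)
        (tensor (basisState y) ρ))) true = probBit ρ (y 0) := by
  -- All inputs form a single family, so that one circuit is obtained for all of them.
  let ι := Bits TB × Bits (Fin 1) × State (Fin 1)
  have h1 := (Transforms.relabel (F := fun (_ : ι) (_ : Unit) (x : Bits (Fin 0)) => x)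
    (Equiv.sumAssoc TB (Fin 1) (Fin 1)).symm
    (fun i : ι => tensor (basisState i.1) (tensor (basisState i.2.1) i.2.2))).trans
    (Transforms.dephase (Sum.inr : Fin 1 → Bool ⊕ Fin 1) _)
  have h2 : Transforms (fun (_ : ι × Bits (Fin 1)) (_ : Unit) (x : Bits (Fin 0)) => x) 2
      (fun p => tensor (p.1.2.2 p.2 p.2 • basisState (Sum.elim p.1.1 p.1.2.1)) (basisState p.2))
      (fun p => p.1.2.2 p.2 p.2 • (basisState fun _ => p.2 0 == p.1.2.1 0 : State (Fin 1))) := by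
    have h := (((Transforms.nots (F := fun (_ : ι × Bits (Fin 1)) (_ : Unit)
      (x : Bits (Fin 0)) => x) (A := (TB ⊕ Fin 1) ⊕ Fin 1)
      [(.inr 0, .inl (.inr 0), .inl (.inr 0)), (.inr 0, .inr 0, .inr 0)]
      (fun p => basisState (Sum.elim (Sum.elim p.1.1 p.1.2.1) p.2))).trans
      (Transforms.relabel (Equiv.sumComm _ _) _)).trans (Transforms.trOut _)).smul
      (fun p => p.1.2.2 p.2 p.2)
    refine (h.congr_in fun p => ?_).congr_out fun p => ?_
    · rw [(tensor_left_linear _).map_smul, tensor_basisState]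
    · congr 1
      rw [push_basisState, ← Sum.elim_comp_inl_inr (applyNots _ _), ← tensor_basisState,
        relabel_sumComm, trOut_tensor_basisState]
      congr 1
      funext j
      obtain rfl : j = 0 := Subsingleton.elim _ _
      change applyNot _ (applyNot _ _) (Sum.inr 0) = _
      refine (applyNot_target ((Sum.inr 0, Sum.inr 0, Sum.inr 0) :
        ((TB ⊕ Fin 1) ⊕ Fin 1) × ((TB ⊕ Fin 1) ⊕ Fin 1) × ((TB ⊕ Fin 1) ⊕ Fin 1))
        ⟨Or.inl rfl, Or.inl rfl⟩).trans ?_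
      rw [applyNot_cnot _ _ _ (by simp)]
      change (!(xor (p.2 0) (p.1.2.1 0))) = _
      cases p.2 0 <;> cases p.1.2.1 0 <;> rfl
  have h3 := h1.trans (Transforms.sum (ins := fun (i : ι) c => tensor (measured (relabel
    (Equiv.sumAssoc TB (Fin 1) (Fin 1)).symm (tensor (basisState i.1)
      (tensor (basisState i.2.1) i.2.2))) c) (basisState (fill (Sum.inr : Fin 1 → Bool ⊕ Fin 1) c)))
    (outs := fun i c => i.2.2 c c • (basisState fun _ => c 0 == i.2.1 0 : State (Fin 1)))
    (h2.congr_in fun p => by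
      rw [relabel_sumAssoc_symm, measured_tensor, tensor_basisState]
      rfl))
  obtain ⟨D, hD, hrun⟩ := h3.exists_qCircuit
  refine ⟨D, hD.trans ?_, fun T y ρ => ?_⟩
  · have : Fintype.card (TB ⊕ (Fin 1 ⊕ Fin 1)) = Fintype.card TB + 2 := by simp
    rw [this]
    simp
  · rw [show D.run _ = _ from hrun (T, y, ρ), probBit_linear_sum, probBit,
      Finset.sum_eq_single (fun _ => y 0)]
    · simp [probBit, basisState]
    · intro c _ hc
      have : (c 0 == y 0) = false := by
        simp only [beq_eq_false_iff_ne, ne_eq]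
        intro h
        apply hc
        funext j
        obtain rfl : j = 0 := Subsingleton.elim _ _
        exact h
      rw [this]
      simp [probBit, basisState, Matrix.single_apply, funext_iff]
    · simp

end Equality

end
end QEnc

namespace QEnc
noncomputable section

/-! ### Reduction of qIND-qCPA to qSEM-qCPA -/

section Reduction

/-! ### Semantic security implies indistinguishability -/

variable {A D κ M : Type} [Fintype A] [DecidableEq A] [Fintype D] [DecidableEq D] [Fintype κ]
  [AddCommGroup M] [Module ℂ M]

/-- Summing over the outcomes of a classical register merely regroups the branches `t` by the value
that they store. No injectivity of `c` is needed: branches with the same value are merged by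
linearity. -/
theorem sum_measured_sum_tensor {f : Bits D → State A → M} (hf : ∀ T, IsLinearMap ℂ (f T))
    (ρ : κ → State A) (c : κ → Bits D) :
    ∑ T, f T (measured (∑ t, tensor (ρ t) (basisState (c t))) T) = ∑ t, f (c t) (ρ t) := by
  have h : ∀ T, f T (measured (∑ t, tensor (ρ t) (basisState (c t))) T) =
      ∑ t, if c t = T then f T (ρ t) else 0 := by
    intro T
    rw [linear_sum (measured_linear T), linear_sum (hf T)]
    refine Finset.sum_congr rfl fun t _ => ?_
    rw [measured_tensor_basisState]
    split_ifs
    · rfl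
    · exact (hf T).map_zero
  simp only [h]
  rw [Finset.sum_comm]
  simp

theorem targetState_bitShape {m : ℕ} {fmt : Format}
    (T : Bits (TemplateBit m (bitShape fmt))) (y : Bits (Fin 1)) :
    targetState (s := bitShape fmt) T y = zeroState (Fin 1) := by
  refine (QCircuit.run_of_no_gates 0 (plaintext (s := bitShape fmt) T y)).trans ?_
  refine (congrArg (· • _) (trace_plaintext T y)).trans (one_smul _ _)

theorem probBit_zeroState (b : Bool) : probBit (zeroState (Fin 1)) b = if b then 0 else 1 := by
  cases b <;> simp [probBit, zeroState, basisState, Matrix.single_apply, funext_iff]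

variable (E : Scheme) (n : ℕ)

variable {m : ℕ} {fmt : Format} {D : Distinguisher m (bitShape fmt)}

/-- The target |0⟩ passes the equality test exactly for the seed 0, so it is accepted with
probability 1/2 whatever the distribution of the templates. -/
theorem advantage_of_compare (hD : ∀ T (y : Bits (Fin 1)) ρ, accept D T y ρ = probBit ρ (y 0))
    {prob : Bits (TemplateBit m (bitShape fmt)) → ℝ} (hprob : ∑ T, prob T = 1)
    (out : Bits (TemplateBit m (bitShape fmt)) → Bits (Fin 1) → State (Fin 1)) :
    advantage D prob out =
      |(average fun y : Bits (Fin 1) => ∑ T, probBit (out T y) (y 0)) - 1 / 2| := by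
  have h : ∀ y : Bits (Fin 1), ∑ T, prob T * accept D T y (targetState T y) =
      if y 0 then 0 else 1 := by
    intro y
    have h : ∀ T, accept D T y (targetState T y) = if y 0 then 0 else 1 := fun T => by
      rw [hD, ← probBit_zeroState]
      exact congrArg (probBit · _) (targetState_bitShape T y)
    simp only [h, ← Finset.sum_mul, hprob, one_mul]
  have h2 : (average fun y : Bits (Fin 1) => ∑ T, prob T * accept D T y (targetState T y)) =
      1 / 2 := by
    simp only [h]
    rw [average_bits_one fun b => if b then (0 : ℝ) else 1, average_bool]
    norm_num
  have h3 : ∀ y : Bits (Fin 1), ∑ T, accept D T y (out T y) = ∑ T, probBit (out T y) (y 0) :=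
    fun y => Finset.sum_congr rfl fun T _ => hD _ _ _
  change |average (fun y : Bits (Fin 1) => ∑ T, accept D T y (out T y)) -
    average (fun y : Bits (Fin 1) => ∑ T, prob T * accept D T y (targetState T y))| = _
  rw [h2]
  simp only [h3]

/-- With an empty advice register the output of the simulator does not depend on the seed, and its
probabilities to equal 0 and to equal 1 add up to the weight of the template. -/
theorem average_simOutput (S : Simulator m (bitShape fmt)) :
    (average fun y : Bits (Fin 1) => ∑ T, probBit (simOutput S T y) (y 0)) =
      (∑ T, simTemplateProb S T) / 2 := by
  have h : ∀ (y : Bits (Fin 1)) T, simOutput S T y =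
      S.respond.run (tensor (simMemory S T) (zeroState (Fin 0))) := by
    intro y T
    have : adviceState T y = zeroState (Fin 0) :=
      eq_of_trace_eq ((trace_adviceState T y).trans (trace_basisState _).symm)
    exact congrArg (fun ρ => S.respond.run (tensor (simMemory S T) ρ)) this
  simp only [h]
  rw [average_bits_one fun b => ∑ T, probBit (S.respond.run (tensor (simMemory S T)
    (zeroState (Fin 0)))) b, average_bool, ← Finset.sum_add_distrib]
  congr 1
  refine Finset.sum_congr rfl fun T _ => ?_
  rw [probBit_add, QCircuit.trace_run, trace_tensor, zeroState, trace_basisState, mul_one]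
  rfl

variable (E : Scheme) (n : ℕ)

theorem sum_advOutput (A : SEMAdversary (E.msgLen n) (E.ctLen n)) (y : Bits (Fin A.shape.seed)) :
    ∑ T, advOutput E n A T y = average fun g => ∑ T, A.respond.run (E.enc n (E.key n g))
      (tensor (measured (A.choose.run (E.enc n (E.key n g)) (basisState fun _ => false)) T)
        (tensor (E.encState n (E.key n g) (plaintext T y)) (adviceState T y))) :=
  (average_sum _).symm

/-- The constructed player turns the two descriptions into the selecting template and answers with
the guess of `a`. Its advantage against the equality test is the distance of the success probability
of `a` from 1/2, while a simulator has advantage 0; of the simulator only the total weight of its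
templates matters. -/
theorem exists_semAdversary (a : INDAdversary (E.msgLen n) (E.ctLen n)) :
    ∃ (f : Format) (A : SEMAdversary (E.msgLen n) (E.ctLen n)) (D : Distinguisher (E.msgLen n) A.shape),
      f.work = a.fmt.work + 1 ∧
      f.slots ≤ 2 + 6 * Fintype.card (StateDescBit (E.msgLen n) a.fmt) ∧
      A.size ≤ (bitShape f).size + 5 * a.size +
        5 * Fintype.card (TemplateBit (E.msgLen n) (bitShape f)) + 3 ∧
      D.size ≤ Fintype.card (TemplateBit (E.msgLen n) (bitShape f)) + 20 ∧
      ∀ S : Simulator (E.msgLen n) A.shape,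
        (∀ T, simTemplateProb S T = advTemplateProb E n A T) →
        indSuccess E n a - 1 / 2 ≤ |advantage D (advTemplateProb E n A) (advOutput E n A) -
          advantage D (simTemplateProb S) (simOutput S)| := by
  obtain ⟨f, sel, hf₁, hf₂, hsel⟩ := exists_selectTemplate (E.msgLen n) a.fmt
  obtain ⟨choose, hchoose, hc⟩ := ((Transforms.ofOCircuit (F := fun k => E.enc n k) a.choose
    (fun _ => basisState fun _ => false)).trans
    (Transforms.dephase sel _)).exists_oCircuit
  obtain ⟨respond, hrespond, hr⟩ := (((Transforms.relabel (F := fun i :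
    Bits (Fin (E.keyLen n)) × State (Fin a.mem) × State (Fin (E.ctLen n)) × State (Fin 0) =>
      E.enc n i.1) (Equiv.sumAssoc _ _ _).symm
    (fun i => tensor i.2.1 (tensor i.2.2.1 i.2.2.2))).trans
    ((((Transforms.ofOCircuit a.guess (fun i : Bits (Fin (E.keyLen n)) × State (Fin a.mem) ×
      State (Fin (E.ctLen n)) × State (Fin 0) => tensor i.2.1 i.2.2.1)).frame
      (fun i => i.2.2.2))).congr_in fun i => (relabel_sumAssoc_symm _ _ _).symm)).trans
    (Transforms.trOut _)).exists_oCircuit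
  obtain ⟨D, hD, hcmp⟩ :=
    exists_compare (TemplateBit (E.msgLen n) (bitShape f))
  -- The seed plays the part of the challenge bit: the answer equals the seed as often as `a` wins.
  have hadv : (average fun y : Bits (Fin 1) => ∑ T, probBit (advOutput E n
      ⟨bitShape f, a.mem, choose, respond⟩ T y) (y 0)) =
      indSuccess E n a := by
    have h1 : ∀ (y : Bits (Fin 1)) g, ∑ T, respond.run (E.enc n (E.key n g))
        (tensor (measured (choose.run (E.enc n (E.key n g)) (basisState fun _ => false)) T)
          (tensor (E.encState n (E.key n g) (plaintext T y)) (adviceState T y))) =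
        ∑ t, a.guess.run (E.enc n (E.key n g)) (tensor
          (measured (a.choose.run (E.enc n (E.key n g)) (basisState fun _ => false)) t)
          (E.encState n (E.key n g)
            (describedState fun i => t (if y 0 then Sum.inr i else Sum.inl i)))) := by
      intro y g
      rw [hc]
      refine (sum_measured_sum_tensor (D := TemplateBit (E.msgLen n) (bitShape f))
        (f := fun T (ρ : State (Fin a.mem)) => respond.run (E.enc n (E.key n g))
          (tensor ρ (tensor (E.encState n (E.key n g) (plaintext (s := bitShape f) T y))
            (adviceState (s := bitShape f) T y))))
        (fun T => linear_comp (OCircuit.run_linear _ _) (linear_tensor_left _ linear_id))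
        _ _).trans (Finset.sum_congr rfl fun t _ => ?_)
      have h := hr (E.key n g, measured (a.choose.run (E.enc n (E.key n g))
        (basisState fun _ => false)) t, E.encState n (E.key n g)
          (plaintext (s := bitShape f)
            (fill sel t) y),
        adviceState (s := bitShape f)
          (fill sel t) y)
      refine h.trans ?_
      rw [trOut_tensor]
      simp only
      rw [trace_adviceState, one_smul, hsel]
    have h2 : ∀ (y : Bits (Fin 1)), ∑ T, probBit (advOutput E n
        ⟨bitShape f, a.mem, choose, respond⟩ T y) (y 0) =
        average fun g => ∑ t, probBit (a.guess.run (E.enc n (E.key n g)) (tensor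
          (measured (a.choose.run (E.enc n (E.key n g)) (basisState fun _ => false)) t)
          (E.encState n (E.key n g)
            (describedState fun i => t (if y 0 then Sum.inr i else Sum.inl i))))) (y 0) := by
      intro y
      refine (probBit_linear_sum _ _ _).symm.trans ?_
      refine (congrArg (probBit · (y 0)) ((sum_advOutput E n
        ⟨bitShape f, a.mem, choose, respond⟩ y).trans
        (congrArg average (funext fun g => h1 y g)))).trans ?_
      rw [probBit_average]
      simp only [probBit_linear_sum]
    simp only [h2]
    rw [average_comm, indSuccess]
    refine congrArg average (funext fun g => ?_)
    exact average_bits_one fun b => ∑ t, probBit (a.guess.run (E.enc n (E.key n g)) (tensor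
      (measured (a.choose.run (E.enc n (E.key n g)) (basisState fun _ => false)) t)
      (E.encState n (E.key n g)
        (describedState fun i => t (if b then Sum.inr i else Sum.inl i))))) b
  refine ⟨f, ⟨bitShape f, a.mem, choose, respond⟩, D, hf₁, hf₂, ?_, hD, fun S hS => ?_⟩
  · have h1 : a.size = a.fmt.size + (Fintype.card (Fin 0) + Fintype.card (Fin a.mem ⊕
        (StateDescBit (E.msgLen n) a.fmt ⊕ StateDescBit (E.msgLen n) a.fmt)) + a.choose.work +
        a.choose.instrs.length) + (Fintype.card (Fin a.mem ⊕ Fin (E.ctLen n)) +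
        Fintype.card (Fin 1) + a.guess.work + a.guess.instrs.length) := rfl
    simp only [SEMAdversary.size]
    simp only [OCircuit.size, Fintype.card_sum, Fintype.card_fin] at h1 hchoose hrespond ⊢
    omega
  · have hsum := sum_advTemplateProb E n
      ⟨bitShape f, a.mem, choose, respond⟩
    -- The only use of the agreement of the template distributions: it makes the simulator accepted
    -- with probability exactly 1/2.
    have hsum' : ∑ T, simTemplateProb S T = 1 := by simp only [hS, hsum]
    have e1 := advantage_of_compare hcmp hsum (advOutput E n
      ⟨bitShape f, a.mem, choose, respond⟩)
    have e2 := advantage_of_compare hcmp hsum' (simOutput S)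
    rw [hadv] at e1
    rw [average_simOutput, hsum', sub_self, abs_zero] at e2
    refine le_trans ?_ (le_of_eq (congrArg abs (congrArg₂ _ e1.symm e2.symm)))
    rw [sub_zero, abs_abs]
    exact le_abs_self _

end Reduction

end
end QEnc

namespace QEnc
noncomputable section

/-! ### Polynomial size of descriptions, and the first implication -/

section Sizes

/-! ### Sizes of descriptions -/

theorem card_gate (W : Type) [Fintype W] :
    Fintype.card (Gate W) =
      3 * (Fintype.card W * (Fintype.card W * Fintype.card W)) := by
  rw [← Fintype.card_congr (Gate.equivProd W)]
  simp only [Fintype.card_prod]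
  rfl

theorem card_descBit (A B : Type) [Fintype A] [Fintype B] (f : Format) :
    Fintype.card (DescBit A B f) = f.slots * Fintype.card (Gate (A ⊕ B ⊕ Fin f.work)) := by
  rw [← Fintype.card_congr (DescBit.equivProd A B f)]
  simp only [Fintype.card_prod, Fintype.card_fin]

theorem card_descBit_le {A B : Type} [Fintype A] [Fintype B] {f : Format} {s K : ℕ}
    (hs : f.slots ≤ s) (hK : Fintype.card A + Fintype.card B + f.work ≤ K) :
    Fintype.card (DescBit A B f) ≤ s * (3 * (K * (K * K))) := by
  rw [card_descBit, card_gate]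
  have : Fintype.card (A ⊕ B ⊕ Fin f.work) ≤ K := by
    simp only [Fintype.card_sum, Fintype.card_fin]
    omega
  gcongr

/-- On K wires there are 3 K³ gates, so a description has polynomially many bits although it
reserves one for every gate in every block. -/
theorem card_descBit_bounded {A B : ℕ → Type} [∀ n, Fintype (A n)] [∀ n, Fintype (B n)]
    {f : ℕ → Format} (hf : PolyBounded fun n => (f n).size)
    (hA : PolyBounded fun n => Fintype.card (A n)) (hB : PolyBounded fun n => Fintype.card (B n)) :
    PolyBounded fun n => Fintype.card (DescBit (A n) (B n) (f n)) := by
  have hK := (hA.add hB).add hf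
  refine (hf.mul ((PolyBounded.const 3).mul (hK.mul (hK.mul hK)))).mono fun n => ?_
  exact card_descBit_le (Nat.le_add_left _ _)
    (Nat.add_le_add_left (Nat.le_add_right _ _) _)

theorem card_templateBit_bounded {m : ℕ → ℕ} {s : ℕ → TemplateShape}
    (hs : PolyBounded fun n => (s n).size) (hm : PolyBounded m) :
    PolyBounded fun n => Fintype.card (TemplateBit (m n) (s n)) := by
  simp only [Fintype.card_sum]
  have hs' : ∀ p : TemplateShape → ℕ, (∀ t : TemplateShape, p t ≤ t.size) →
      PolyBounded fun n => p (s n) := fun p hp => hs.mono fun n => hp (s n)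
  have hc : ∀ k : ℕ → ℕ, PolyBounded k → PolyBounded fun n => Fintype.card (Fin (k n)) :=
    fun k hk => hk.mono fun n => (Fintype.card_fin _).le
  refine PolyBounded.add ?_ (PolyBounded.add ?_ ?_) <;> refine card_descBit_bounded ?_ ?_ ?_
  · exact hs' (fun t => t.fmtG.size) fun t => by simp only [TemplateShape.size]; omega
  · exact hc _ (hs' (fun t => t.seed) fun t => by simp only [TemplateShape.size]; omega)
  · exact hc _ hm
  · exact hs' (fun t => t.fmtH.size) fun t => by simp only [TemplateShape.size]; omega
  · exact hc _ hm
  · exact hc _ (hs' (fun t => t.advice) fun t => by simp only [TemplateShape.size]; omega)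
  · exact hs' (fun t => t.fmtF.size) fun t => by simp only [TemplateShape.size]; omega
  · exact hc _ hm
  · exact hc _ (hs' (fun t => t.target) fun t => by simp only [TemplateShape.size]; omega)

theorem Scheme.msgLen_bounded (E : Scheme) : PolyBounded E.msgLen :=
  E.enc_poly.mono fun n => by simp only [CCircuit.size, Fintype.card_sum, Fintype.card_fin]; omega

end Sizes

theorem QSEMqCPA.qINDqCPA {E : Scheme} (h : QSEMqCPA E) : QINDqCPA E := by
  intro a ha
  -- Circuits are chosen separately for each security parameter, as the non-uniform model permits.
  choose f A D hwork hslots hA hD hadv using fun n => exists_semAdversary E n (a n)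
  have hdesc : PolyBounded fun n => Fintype.card (StateDescBit (E.msgLen n) (a n).fmt) :=
    ha.mono fun n => by
      simp only [INDAdversary.size, OCircuit.size, Fintype.card_sum]
      omega
  have hf : PolyBounded fun n => (f n).size :=
    (ha.add ((PolyBounded.const 3).add ((PolyBounded.const 6).mul hdesc))).mono fun n => by
      have := hwork n
      have := hslots n
      simp only [Format.size, INDAdversary.size] at *
      omega
  have hshape : PolyBounded fun n => (bitShape (f n)).size :=
    (hf.add (PolyBounded.const 2)).mono fun n => by
      simp only [TemplateShape.size, Format.size]
      omega
  have hT := card_templateBit_bounded hshape E.msgLen_bounded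
  obtain ⟨S, -, hS, hS'⟩ := h A ((((hshape.add ((PolyBounded.const 5).mul ha)).add
    ((PolyBounded.const 5).mul hT)).add (PolyBounded.const 3)).mono hA)
  exact (hS' D ((hT.add (PolyBounded.const 20)).mono hD)).mono fun n => hadv n (S n) (hS n)

end
end QEnc

namespace QEnc
noncomputable section

/-! ### Bookkeeping of tensor factors; encryption of zero -/

section Structure

/-! ### Rearranging tensor factors -/

variable {A B C D X : Type} [Fintype A] [DecidableEq A] [Fintype B] [DecidableEq B]
  [Fintype C] [DecidableEq C] [Fintype D] [DecidableEq D] [Fintype X] [DecidableEq X]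
  {m l : ℕ} {R : Type} [Fintype R] {ι : Type}
  {F : ι → R → Bits (Fin m) → Bits (Fin l)} {s s' : ℕ}

namespace Transforms

theorem comm (ρ : ι → State A) (σ : ι → State B) :
    Transforms F 0 (fun i => tensor (ρ i) (σ i)) (fun i => tensor (σ i) (ρ i)) :=
  (relabel (Equiv.sumComm A B) _).congr_out fun _ => relabel_sumComm _ _

theorem assoc (ρ : ι → State A) (σ : ι → State B) (τ : ι → State C) :
    Transforms F 0 (fun i => tensor (tensor (ρ i) (σ i)) (τ i))
      (fun i => tensor (ρ i) (tensor (σ i) (τ i))) :=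
  (relabel (Equiv.sumAssoc A B C) _).congr_out fun _ => relabel_sumAssoc _ _ _

theorem assocSymm (ρ : ι → State A) (σ : ι → State B) (τ : ι → State C) :
    Transforms F 0 (fun i => tensor (ρ i) (tensor (σ i) (τ i)))
      (fun i => tensor (tensor (ρ i) (σ i)) (τ i)) :=
  (relabel (Equiv.sumAssoc A B C).symm _).congr_out fun _ => relabel_sumAssoc_symm _ _ _

theorem swap (ρ : ι → State A) (σ : ι → State B) (τ : ι → State C) :
    Transforms F 0 (fun i => tensor (tensor (ρ i) (σ i)) (τ i))
      (fun i => tensor (tensor (ρ i) (τ i)) (σ i)) :=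
  (relabel (swapRight A B C) _).congr_out fun _ => relabel_swapRight _ _ _

theorem left {ins : ι → State A} {outs : ι → State B} (h : Transforms F s ins outs)
    (τ : ι → State X) :
    Transforms F s (fun i => tensor (τ i) (ins i)) (fun i => tensor (τ i) (outs i)) :=
  (((comm _ _).trans (h.frame τ)).trans (comm _ _)).mono (by omega)

theorem unrelabel (e : A ≃ B) (ρ : ι → State A) :
    Transforms F 0 (fun i => QEnc.relabel e (ρ i)) ρ :=
  (relabel e.symm _).congr_out fun _ => relabel_symm_relabel _ _

end Transforms

theorem measured_relabel_swapRight {K : Type} [Fintype K] [DecidableEq K] (e : A ⊕ K ≃ B)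
    (σ : State (A ⊕ D)) (τ : State K) (t : Bits D) :
    measured (relabel ((swapRight A D K).trans (e.sumCongr (Equiv.refl D))) (tensor σ τ)) t =
      relabel e (tensor (measured σ t) τ) := by
  ext u v
  simp only [measured, relabel, tensor, Matrix.of_apply, Function.comp]
  congr 2 <;> (funext w; rcases w with w | w <;> rfl)

theorem Transforms.encryptZero {Key Coin : Type} [Fintype Key] [DecidableEq Key] [Fintype Coin]
    [DecidableEq Coin] {m' l' : ℕ} (C : CCircuit (Key ⊕ Fin m' ⊕ Coin) (Fin l')) (ρ : ι → State A)
    (τ : ι → State B) (k : ι → Bits Key) :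
    Transforms F (2 * (2 * Fintype.card Key + m') + 4 * Fintype.card Coin + C.size)
      (fun i => tensor (tensor (ρ i) (τ i)) (basisState (k i)))
      (fun i => tensor (tensor (ρ i) (tensor (QEnc.average fun r => basisState
        (encOracle C (k i) r fun _ => false)) (τ i))) (basisState (k i))) := by
  -- The key is doubled, since `eval` discards its input: one copy is kept, the other is fed to the
  -- circuit together with the zero message.
  have h1 := (copy (F := F) (Sum.elim Sum.inr (Sum.elim Sum.inr fun _ => Sum.inl false) :
    Key ⊕ (Key ⊕ Fin m') → Bool ⊕ Key) (fun i => tensor (ρ i) (τ i)) k).trans (coins Coin _)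
  have e1 := ((eval (F := fun p : ι × Bits Coin => F p.1) C
      fun p => Sum.elim (k p.1) (Sum.elim (fun _ => false) p.2)).left
    fun p => basisState (k p.1)).left fun p => tensor (ρ p.1) (τ p.1)
  have e2 := (((e1.trans ((comm _ _).left _)).trans (assocSymm _ _ _)).trans
    ((assoc _ _ _).frame _)).trans (((comm _ _).left _).frame _)
  have e3 := (assoc (F := fun p : ι × Bits Coin => F p.1) (fun p => tensor (ρ p.1) (τ p.1))
    (fun p => basisState (fill (Sum.elim Sum.inr (Sum.elim Sum.inr fun _ => Sum.inl false) :
      Key ⊕ (Key ⊕ Fin m') → Bool ⊕ Key) (k p.1)))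
    (fun p => basisState p.2)).trans ((relabel ((Equiv.sumAssoc _ _ _).trans
      ((Equiv.refl _).sumCongr (Equiv.sumAssoc _ _ _))) _).left _)
  have e4 := e3.trans (e2.congr_in fun p => by
    congr 1
    rw [tensor_basisState, tensor_basisState, relabel_basisState]
    congr 1
    funext w
    rcases w with w | w | w | w <;> rfl)
  refine ((h1.trans (average (ins := fun i r => tensor (tensor (tensor (ρ i) (τ i))
    (basisState (fill (Sum.elim Sum.inr (Sum.elim Sum.inr fun _ => Sum.inl false) :
      Key ⊕ (Key ⊕ Fin m') → Bool ⊕ Key) (k i)))) (basisState r))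
    (outs := fun i r => tensor (tensor (ρ i) (tensor (basisState
      (encOracle C (k i) r fun _ => false)) (τ i))) (basisState (k i))) e4)).mono
    ?_).congr_out fun i => ?_
  · simp only [Fintype.card_sum, Fintype.card_fin]
    omega
  · rw [← linear_average (f := fun σ => tensor (tensor (ρ i) (tensor σ (τ i))) (basisState (k i)))
      (linear_tensor_left _ (linear_tensor_right _ (linear_tensor_left _ linear_id)))]

end Structure

/-! ### Construction of the simulator -/

section Simulation

/-! ### The simulator that encrypts a fixed plaintext -/

variable (E : Scheme) (n : ℕ) (A : SEMAdversary (E.msgLen n) (E.ctLen n))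

/-- The answer of the adversary for fixed key coins, template and seed if the plaintext state is
`ω`, weighted with the probability of the template. -/
def hybridOutput (ω : State (Fin (E.msgLen n))) (g : Bits (Fin (E.genCoins n)))
    (T : Bits (TemplateBit (E.msgLen n) A.shape)) (y : Bits (Fin A.shape.seed)) :
    State (Fin A.shape.target) :=
  A.respond.run (E.enc n (E.key n g))
    (tensor (advMemory E n A (E.key n g) T)
      (tensor (E.encState n (E.key n g) ω) (adviceState T y)))

/-- The type-(2) encryption of a basis state is a random classical ciphertext. The simulator can
therefore produce it with the classical circuit, without implementing |x⟩ ↦ |Enc_k(x)⟩ on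
superpositions, which would require erasing x. -/
theorem Scheme.encState_zeroState (k : Bits (Fin (E.keyLen n))) :
    E.encState n k (zeroState _) =
      average fun r => basisState (E.enc n k r fun _ => false) := by
  rw [Scheme.encState]
  simp only [E.typeTwo_eq]
  exact congrArg average (funext fun r => push_basisState _ _)

/-- Random coins are turned into a key, and the first phase is emulated with it. The key is stored
next to the memory of the adversary, because the second phase must use the same one. -/
theorem exists_simulator_choose {TB : Type} [Fintype TB] [DecidableEq TB] {mem : ℕ}
    (C : OCircuit (E.msgLen n) (E.ctLen n) (Fin 0) (Fin mem ⊕ TB)) :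
    ∃ C' : QCircuit (Fin 0) (Fin (mem + E.keyLen n) ⊕ TB),
      C'.size ≤ 3 * (mem + E.keyLen n + Fintype.card TB) +
        (4 * E.genCoins n + (E.Gen n).size + C.size * (4 * (E.Enc n).size + 1)) ∧
      ∀ T, measured (C'.run (basisState fun _ => false)) T = average fun g =>
        relabel finSumFinEquiv (tensor (measured (C.run (E.enc n (E.key n g))
          (basisState fun _ => false)) T) (basisState (E.key n g))) := by
  have h1 := Transforms.coins (F := fun (_ : Unit) (_ : Unit) (x : Bits (Fin 0)) => x)
    (Fin (E.genCoins n)) fun _ => (basisState fun _ => false : State (Fin 0))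
  have h2 := ((Transforms.eval (F := fun (_ : Unit × Bits (Fin (E.genCoins n))) (_ : Unit)
      (x : Bits (Fin 0)) => x) (E.Gen n) (fun p => p.2)).left
    (fun _ => (basisState fun _ => false : State (Fin 0)))).trans
    (Transforms.emulate (E.Enc n) C _ _)
  have h3 := h2.trans (Transforms.relabel ((swapRight _ _ _).trans
    (finSumFinEquiv.sumCongr (Equiv.refl _))) _)
  obtain ⟨C', hC, h⟩ := (h1.trans (Transforms.average (ins := fun _ g =>
    tensor (basisState fun _ => false : State (Fin 0)) (basisState g)) (outs := fun _ g =>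
      relabel ((swapRight _ _ _).trans (finSumFinEquiv.sumCongr (Equiv.refl _)))
        (tensor (C.run (encOracle (E.Enc n) (E.key n g)) (basisState fun _ => false))
          (basisState (E.key n g)))) h3)).exists_qCircuit
  refine ⟨C', hC.trans ?_, fun T => ?_⟩
  · simp only [Fintype.card_sum, Fintype.card_fin]
    omega
  · rw [h (), linear_average (measured_linear T)]
    simp only [measured_relabel_swapRight]
    rfl

/-- The key is taken from the memory, used to encrypt |0…0⟩ and then to emulate the second phase.
The identity covers arbitrary operators `μ`, so the branches with fixed key and template can be
averaged afterwards. -/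
theorem exists_simulator_respond :
    ∃ C : QCircuit (Fin (A.mem + E.keyLen n) ⊕ Fin A.shape.advice) (Fin A.shape.target),
      C.size ≤ A.mem + E.keyLen n + A.shape.advice + 3 * A.shape.target +
        (2 * (2 * E.keyLen n + E.msgLen n) + 4 * E.encCoins n + (E.Enc n).size +
          A.respond.size * (4 * (E.Enc n).size + 1)) ∧
      ∀ (μ : State (Fin A.mem)) k τ, C.run (tensor (relabel finSumFinEquiv
        (tensor μ (basisState k))) τ) = A.respond.run (E.enc n k)
          (tensor μ (tensor (E.encState n k (zeroState _)) τ)) := by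
  have h1 := (((Transforms.unrelabel (F := fun (_ : State (Fin A.mem) ×
    Bits (Fin (E.keyLen n)) × State (Fin A.shape.advice)) (_ : Unit) (x : Bits (Fin 0)) => x)
    finSumFinEquiv (fun i => tensor i.1 (basisState i.2.1))).frame (fun i => i.2.2)).trans
    (Transforms.swap _ _ _)).trans (Transforms.encryptZero (E.Enc n) _ _ _)
  have h2 := Transforms.emulate (F := fun (_ : State (Fin A.mem) ×
    Bits (Fin (E.keyLen n)) × State (Fin A.shape.advice)) (_ : Unit) (x : Bits (Fin 0)) => x)
    (E.Enc n) A.respond (fun i => tensor i.1 (tensor (average fun r => basisState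
      (encOracle (E.Enc n) i.2.1 r fun _ => false)) i.2.2)) (fun i => i.2.1)
  have h3 := h1.trans ((h2.trans (Transforms.trOut _)).congr_out fun i =>
    trOut_tensor_basisState _ _)
  obtain ⟨C, hC, h⟩ := h3.exists_qCircuit
  refine ⟨C, hC.trans ?_, fun μ k τ => ?_⟩
  · simp only [Fintype.card_sum, Fintype.card_fin]
    omega
  · rw [E.encState_zeroState]
    exact h (μ, k, τ)

/-- Coins, key generation and queries are all reproduced without error, which is why the template
distributions agree exactly and not only up to a negligible amount. -/
theorem exists_simulator : ∃ S : Simulator (E.msgLen n) A.shape,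
    S.size ≤ 40 * (A.size + (E.Gen n).size + (E.Enc n).size) +
      A.size * (4 * (E.Enc n).size + 1) ∧
    (∀ T, simTemplateProb S T = advTemplateProb E n A T) ∧
    ∀ T y, simOutput S T y = average fun g => hybridOutput E n A (zeroState _) g T y := by
  obtain ⟨C, hC, h⟩ := exists_simulator_choose E n A.choose
  obtain ⟨C', hC', h'⟩ := exists_simulator_respond E n A
  refine ⟨⟨A.mem + E.keyLen n, C, C'⟩, ?_, fun T => ?_, fun T y => ?_⟩
  · have e1 : A.choose.size = 0 + (A.mem + Fintype.card (TemplateBit (E.msgLen n) A.shape)) +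
        A.choose.work + A.choose.instrs.length := by
      simp only [OCircuit.size, Fintype.card_sum, Fintype.card_fin]
    have e2 : A.size * (4 * (E.Enc n).size + 1) = A.shape.size * (4 * (E.Enc n).size + 1) +
        A.choose.size * (4 * (E.Enc n).size + 1) + A.respond.size * (4 * (E.Enc n).size + 1) := by
      rw [SEMAdversary.size, Nat.add_mul, Nat.add_mul]
    have e3 : A.shape.advice + A.shape.target ≤ A.shape.size := by
      simp only [TemplateShape.size]
      omega
    have e4 : E.genCoins n ≤ (E.Gen n).size := by
      simp only [CCircuit.size, Fintype.card_sum, Fintype.card_fin]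
      omega
    have e5 : E.keyLen n + E.msgLen n + E.encCoins n ≤ (E.Enc n).size := by
      simp only [CCircuit.size, Fintype.card_sum, Fintype.card_fin]
      omega
    have e6 : A.size = A.shape.size + A.choose.size + A.respond.size := rfl
    simp only [Simulator.size]
    omega
  · rw [simTemplateProb, simMemory, h, trace_average, advTemplateProb]
    simp only [trace_relabel, trace_tensor, trace_basisState, mul_one]
    rw [average, Complex.smul_re, Complex.re_sum]
    rfl
  · rw [simOutput, simMemory, h]
    simp only
    rw [linear_average (f := fun ρ => C'.run (tensor ρ (adviceState T y)))
      (linear_comp (QCircuit.run_linear _) (linear_tensor_left _ linear_id))]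
    simp only [h']
    rfl

end Simulation

end
end QEnc

namespace QEnc
noncomputable section

/-! ### Descriptions of plaintexts with the seed built in -/

section SeededDescription

/-! ### Descriptions of the plaintexts of a template -/

/-- The zero string describes a circuit without gates in every format. Hence |0…0⟩ can be submitted
in the format of the other plaintext, as the qIND game requires. -/
theorem describedState_zero {m : ℕ} {f : Format} :
    describedState (fun _ : StateDescBit m f => false) = zeroState (Fin m) := by
  have h : decode (fun _ : StateDescBit m f => false) = ⟨f.work, []⟩ := by
    rw [decode_eq, decodeGates]
    simp
  rw [describedState, h, QCircuit.run_of_no_gates, trace_basisState, one_smul]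

variable {W : Type} [Fintype W] [DecidableEq W]

/-- Gates that write the bits of a seed to fresh wires. -/
def loadGates {k : ℕ} (f : Fin k → W) : List (Fin k × Gate W) :=
  (List.finRange k).map fun i => (i, notGate (f i, f i, f i))

theorem runGates_loadGates {k : ℕ} {f : Fin k → W} (hf : Function.Injective f) (y : Bits (Fin k))
    (u : Bits W) (hu : ∀ i, u (f i) = false) :
    runGates (((loadGates f).filter fun p => y p.1).map Prod.snd) (basisState u) =
      basisState fun w => u w || decide (∃ i, f i = w ∧ y i = true) := by
  have h1 : ((loadGates f).filter fun p => y p.1).map Prod.snd =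
      ((((List.finRange k).filter fun i => y i).map fun i => (f i, f i, f i)).map notGate) := by
    simp only [loadGates, List.filter_map, List.map_map]
    rfl
  rw [h1, runGates_notGate, push_basisState]
  congr 1
  funext w
  by_cases hw : ∃ i, f i = w ∧ y i = true
  · obtain ⟨i, rfl, hi⟩ := hw
    have := applyNots_parallel ((List.finRange k).filter fun i => y i)
      ((List.nodup_finRange k).filter _) (fun i => (f i, f i, f i))
      (fun i _ j _ h => hf h) (fun i _ j _ h => ⟨fun e => h (hf e), fun e => h (hf e)⟩) u i
      (by simp [hi])
    refine this.trans ?_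
    rw [applyNot_target (f i, f i, f i) ⟨Or.inl rfl, Or.inl rfl⟩]
    simp only [hu]
    simpa using ⟨i, rfl, hi⟩
  · rw [applyNots_of_ne]
    · simp [hw]
    · intro g hg
      obtain ⟨i, hi, rfl⟩ := List.mem_map.mp hg
      rintro rfl
      exact hw ⟨i, rfl, by simpa using hi⟩

variable (m : ℕ) (s : TemplateShape)

/-- The conditional gates that prepare the plaintext for a given template and seed. -/
def seededList : List ((Bool ⊕ (TemplateBit m s ⊕ Fin s.seed)) ×
    Gate ((Fin s.seed ⊕ Fin m ⊕ Fin s.fmtG.work) ⊕ Empty)) :=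
  ((loadGates (fun i => Sum.inl (Sum.inl i))).map fun p => (Sum.inr (Sum.inr p.1), p.2)) ++
    ((descGates (Fin s.seed) (Fin m) s.fmtG).map fun p =>
      (Sum.inr (Sum.inl (Sum.inl p.1)), p.2.map Sum.inl))

/-- The wires of the circuit that prepares the plaintext. -/
def seededWires (a w : ℕ) : (Fin a ⊕ Fin w) ⊕ Empty ≃ Fin 0 ⊕ Fin (a + w) :=
  (Equiv.sumEmpty _ _).trans (finSumFinEquiv.trans (Equiv.emptySum _ _).symm)

variable {m s}

theorem activeGates_map_fst {C V : Type} (L : List (V × Gate W)) (κ : V → C) (c : Bits C) :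
    activeGates (L.map fun p => (Sum.inr (κ p.1), p.2)) c =
      (L.filter fun p => c (κ p.1)).map Prod.snd := by
  simp only [activeGates, List.filter_map, List.map_map]
  rfl

/-- The seed is built into the circuit: a NOT on the i-th former input wire is present if and only
if y_i = 1, and the gates of the template circuit follow. Input wires become work wires, which
explains the work size, and every bit of the description is a constant or a bit of the template or
the seed. -/
theorem exists_plaintextDesc (m : ℕ) (s : TemplateShape) :
    ∃ (f : Format) (sel : StateDescBit m f → Bool ⊕ (TemplateBit m s ⊕ Fin s.seed)),
      f.work = s.seed + s.fmtG.work ∧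
      f.slots ≤ s.seed + Fintype.card (TemplateBit m s) ∧
      ∀ T y, describedState (fill sel (Sum.elim T y)) = plaintext T y := by
  refine ⟨⟨s.seed + s.fmtG.work, _⟩, describe (s.seed + s.fmtG.work) ((seededList m s).map
    fun p => (p.1, p.2.map (embedWires (seededWires s.seed s.fmtG.work)))), rfl, ?_,
    fun T y => ?_⟩
  · have := length_descGates (Fin s.seed) (Fin m) s.fmtG
    simp only [List.length_map, seededList, loadGates, List.length_append, List.length_finRange,
      Fintype.card_sum]
    omega
  · have h1 := run_embedWires (B := Fin m) (seededWires s.seed s.fmtG.work) _ _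
      (activeGates_map (embedWires (seededWires s.seed s.fmtG.work)) (seededList m s)
        (Sum.elim T y)) (fun _ => false)
    rw [describedState, decode_describe]
    refine h1.trans ?_
    have h2 : activeGates (seededList m s) (Sum.elim T y) =
        ((loadGates (fun i => Sum.inl (Sum.inl i))).filter fun p => y p.1).map Prod.snd ++
        (decodeGates fun i => T (Sum.inl i)).map (Gate.map Sum.inl) := by
      rw [seededList, activeGates_append, activeGates_map_fst]
      congr 1
      simp only [activeGates, List.filter_map, List.map_map, decodeGates]
      rfl
    have h3 : (Sum.elim (fun _ => false) fun _ => false) ∘ embedWires (A := Fin s.seed)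
        (B := Fin m) (seededWires s.seed s.fmtG.work) = fun _ => false := by
      funext w
      exact congrFun (Sum.elim_const_const _) _
    have h4 : (fun w => false || decide (∃ i, (Sum.inl (Sum.inl i) :
        (Fin s.seed ⊕ Fin m ⊕ Fin s.fmtG.work) ⊕ Empty) = w ∧ y i = true)) =
        Sum.elim (Sum.elim y fun _ => false) fun _ => false := by
      funext w
      rcases w with (w | w) | w
      · simp
      · simp
      · exact w.elim
    rw [h2, h3, runGates_append, runGates_loadGates (fun i j h => by simpa using h) _ _
      (fun _ => rfl), h4, ← tensor_basisState]
    have h5 := runGates_map (Equiv.refl ((Fin s.seed ⊕ Fin m ⊕ Fin s.fmtG.work) ⊕ Empty))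
      (decodeGates fun i => T (Sum.inl i)) (basisState (Sum.elim y fun _ => false))
      (basisState fun _ => false)
    rw [relabel_refl, relabel_refl] at h5
    rw [show (Sum.inl : Fin s.seed ⊕ Fin m ⊕ Fin s.fmtG.work → _ ⊕ Empty) =
      ⇑(Equiv.refl _) ∘ Sum.inl from rfl, h5, trOut_tensor_basisState, plaintext, decode_eq,
      QCircuit.run_eq, zeroState, tensor_basisState]

end SeededDescription

end
end QEnc

namespace QEnc
noncomputable section

/-! ### The two phases of the qIND adversary -/

section Hybrid

/-! ### The adversary against indistinguishability -/

variable {A B C D X Y TB SD : Type} [Fintype A] [DecidableEq A] [Fintype B] [DecidableEq B]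
  [Fintype C] [DecidableEq C] [Fintype D] [DecidableEq D] [Fintype X] [DecidableEq X]
  [Fintype Y] [DecidableEq Y] [Fintype TB] [DecidableEq TB] [Fintype SD] [DecidableEq SD]
  {m l : ℕ} {R : Type} [Fintype R] {ι : Type}
  {F : ι → R → Bits (Fin m) → Bits (Fin l)} {s s' : ℕ}

/-- The adversary measures the template and samples the seed in place of the challenger. Template
and seed are then used twice: they are kept in the memory, and they determine the submitted
descriptions. -/
theorem exists_hybrid_choose {mem mem' : ℕ} (C : OCircuit m l (Fin 0) (Fin mem ⊕ TB))
    (sel : SD → Bool ⊕ (TB ⊕ Y)) (e : Fin mem ⊕ (TB ⊕ Y) ≃ Fin mem')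
    (F : ι → R → Bits (Fin m) → Bits (Fin l)) :
    ∃ C' : OCircuit m l (Fin 0) (Fin mem' ⊕ SD),
      C'.size ≤ 3 * (mem' + Fintype.card SD) + (C.size + 2 * Fintype.card TB +
        4 * Fintype.card Y + 2 * (Fintype.card TB + Fintype.card Y + Fintype.card SD)) ∧
      ∀ i, C'.run (F i) (basisState fun _ => false) = ∑ T : Bits TB, average fun y : Bits Y =>
        tensor (relabel e (tensor (measured (C.run (F i) (basisState fun _ => false)) T)
          (basisState (Sum.elim T y)))) (basisState (fill sel (Sum.elim T y))) := by
  have h1 := (Transforms.ofOCircuit (F := F) C fun _ => basisState fun _ => false).trans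
    (Transforms.dephase (Sum.inr : TB → Bool ⊕ TB) _)
  have h2 := Transforms.coins (F := fun p : ι × Bits TB => F p.1) Y fun p =>
    tensor (measured (C.run (F p.1) (basisState fun _ => false)) p.2)
      (basisState (fill (Sum.inr : TB → Bool ⊕ TB) p.2))
  have h3 := ((Transforms.copy (F := fun p : (ι × Bits TB) × Bits Y => F p.1.1)
    (Sum.elim Sum.inr sel : (TB ⊕ Y) ⊕ SD → Bool ⊕ (TB ⊕ Y))
    (fun p => measured (C.run (F p.1.1) (basisState fun _ => false)) p.1.2)
    (fun p => Sum.elim p.1.2 p.2)).congr_out (outs' := fun p => tensor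
      (measured (C.run (F p.1.1) (basisState fun _ => false)) p.1.2)
      (tensor (basisState (Sum.elim p.1.2 p.2))
        (basisState (fill sel (Sum.elim p.1.2 p.2))))) (fun p => by
      rw [tensor_basisState]
      congr 2
      funext w
      rcases w with w | w <;> rfl)).trans (Transforms.assocSymm _ _ _)
  have h4 := (h3.trans ((Transforms.relabel e _).frame _)).congr_in
    (ins' := fun p => relabel (Equiv.sumAssoc _ _ _) (tensor (tensor
      (measured (C.run (F p.1.1) (basisState fun _ => false)) p.1.2)
      (basisState (fill (Sum.inr : TB → Bool ⊕ TB) p.1.2))) (basisState p.2)))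
    (fun p => by
      rw [relabel_sumAssoc, tensor_basisState]
      rfl)
  have h5 := (Transforms.relabel _ _).trans h4
  obtain ⟨C', hC, h⟩ := (h1.trans (Transforms.sum
    (ins := fun i T => tensor (measured (C.run (F i) (basisState fun _ => false)) T)
      (basisState (fill (Sum.inr : TB → Bool ⊕ TB) T)))
    (outs := fun i T => QEnc.average fun y : Bits Y =>
        tensor (relabel e (tensor (measured (C.run (F i) (basisState fun _ => false)) T)
          (basisState (Sum.elim T y)))) (basisState (fill sel (Sum.elim T y)))) (h2.trans (Transforms.average
    (ins := fun (p : ι × Bits TB) (y : Bits Y) => tensor (tensor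
      (measured (C.run (F p.1) (basisState fun _ => false)) p.2)
      (basisState (fill (Sum.inr : TB → Bool ⊕ TB) p.2))) (basisState y))
    (outs := fun (p : ι × Bits TB) (y : Bits Y) => tensor (relabel e (tensor
      (measured (C.run (F p.1) (basisState fun _ => false)) p.2)
      (basisState (Sum.elim p.2 y)))) (basisState (fill sel (Sum.elim p.2 y))))
    h5)))).exists_oCircuit
  refine ⟨C', hC.trans ?_, h⟩
  simp only [Fintype.card_sum, Fintype.card_fin]
  omega

set_option synthInstance.maxSize 4096 in
-- A party that knows template and seed can prepare a plaintext of its own and apply the advice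
-- circuit to it, by two runs of the universal circuit. This is legitimate because the game computes
-- the advice from a separate copy of the plaintext.
theorem Transforms.advice {mm : ℕ} {s : TemplateShape} (ρ : ι → State A)
    (T : ι → Bits (TemplateBit mm s)) (y : ι → Bits (Fin s.seed)) :
    Transforms F (10 * Fintype.card (TemplateBit mm s) + 4 * s.seed + mm + s.size + 2)
      (fun i => tensor (ρ i) (basisState (Sum.elim (T i) (y i))))
      (fun i => tensor (ρ i) (tensor (basisState (Sum.elim (T i) (y i)))
        (adviceState (T i) (y i)))) := by
  have h1 := (copy (F := F) (Sum.elim Sum.inr (Sum.elim (Sum.elim (fun i => Sum.inr (Sum.inr i))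
    (fun i => Sum.inr (Sum.inl (Sum.inl i)))) (fun i => Sum.inr (Sum.inl (Sum.inr (Sum.inl i))))) :
      (TemplateBit mm s ⊕ Fin s.seed) ⊕ ((Fin s.seed ⊕ DescBit (Fin s.seed) (Fin mm) s.fmtG) ⊕
        DescBit (Fin mm) (Fin s.advice) s.fmtH) → Bool ⊕ (TemplateBit mm s ⊕ Fin s.seed)) ρ
    (fun i => Sum.elim (T i) (y i))).congr_out (outs' := fun i => tensor (ρ i)
      (tensor (basisState (Sum.elim (T i) (y i))) (tensor (tensor (basisState (y i))
        (basisState fun j => T i (Sum.inl j))) (basisState fun j => T i (Sum.inr (Sum.inl j))))))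
    (fun i => by
      rw [tensor_basisState, tensor_basisState, tensor_basisState]
      congr 2
      funext w
      rcases w with w | (w | w) | w <;> rfl)
  have h2 := ((universal (F := F) (fun i => basisState (y i)) fun i j => T i (Sum.inl j)).trans
    (trOut _)).congr_out (outs' := fun i => plaintext (T i) (y i))
    (fun i => trOut_tensor_basisState _ _)
  have h3 := ((universal (F := F) (fun i => plaintext (T i) (y i))
    fun i j => T i (Sum.inr (Sum.inl j))).trans
    (trOut _)).congr_out (outs' := fun i => adviceState (T i) (y i))
    (fun i => trOut_tensor_basisState _ _)
  refine (h1.trans ((((h2.frame _).trans h3).left _).left _)).mono ?_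
  simp only [Fintype.card_sum, Fintype.card_fin, TemplateShape.size, Format.size]
  omega

set_option synthInstance.maxSize 4096 in
-- The second phase computes the advice, lets the adversary respond and runs the distinguisher on
-- the stored template and seed. The challenge `χ` is arbitrary, so the same circuit covers both
-- values of the challenge bit.
theorem exists_hybrid_guess {mem mem' mm : ℕ} {s : TemplateShape}
    (C : OCircuit m l (Fin mem ⊕ (Fin l ⊕ Fin s.advice)) (Fin s.target)) (D : Distinguisher mm s)
    (e : Fin mem ⊕ (TemplateBit mm s ⊕ Fin s.seed) ≃ Fin mem')
    {K : Type} (F : K → R → Bits (Fin m) → Bits (Fin l)) :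
    ∃ C' : OCircuit m l (Fin mem' ⊕ Fin l) (Fin 1),
      C'.size ≤ mem' + l + 3 + (10 * Fintype.card (TemplateBit mm s) + 4 * s.seed + mm + s.size +
        2 + C.size + D.size) ∧
      ∀ k μ T (y : Bits (Fin s.seed)) (χ : State (Fin l)),
        C'.run (F k) (tensor (relabel e (tensor μ (basisState (Sum.elim T y)))) χ) =
          D.run (tensor (basisState T) (tensor (basisState y)
            (C.run (F k) (tensor μ (tensor χ (adviceState T y)))))) := by
  have h1 := (((Transforms.unrelabel (F := fun i : K × State (Fin mem) × Bits (TemplateBit mm s) ×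
    Bits (Fin s.seed) × State (Fin l) => F i.1) e
    (fun i => tensor i.2.1 (basisState (Sum.elim i.2.2.1 i.2.2.2.1)))).frame
    (fun i => i.2.2.2.2)).trans (Transforms.swap _ _ _)).trans (Transforms.advice _ _ _)
  have h2 := (((h1.trans ((Transforms.comm _ _).left _)).trans (Transforms.assocSymm _ _ _)).trans
    ((Transforms.assoc _ _ _).frame _)).trans ((Transforms.ofOCircuit C _).frame _)
  have h3 := ((h2.trans (Transforms.comm _ _)).trans
    (Transforms.relabel (Equiv.sumAssoc _ _ _) _)).trans (Transforms.ofQCircuit D _)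
  obtain ⟨C', hC, h⟩ := h3.exists_oCircuit
  refine ⟨C', hC.trans ?_, fun k μ T y χ => (h (k, μ, T, y, χ)).trans ?_⟩
  · simp only [Fintype.card_sum, Fintype.card_fin]
    omega
  · simp only
    rw [← tensor_basisState, relabel_sumAssoc]

end Hybrid

end
end QEnc

namespace QEnc
noncomputable section

/-! ### Reduction of qSEM-qCPA to qIND-qCPA -/

section HybridArgument

/-! ### Indistinguishability implies semantic security -/

theorem average_half_sub {κ : Type} [Fintype κ] [Nonempty κ] (a b : κ → ℝ) :
    (average fun k => (a k - b k + 1) / 2) = 1 / 2 + (average a - average b) / 2 := by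
  have h : (Fintype.card κ : ℝ) ≠ 0 := by exact_mod_cast Fintype.card_ne_zero
  simp only [average, smul_eq_mul, ← Finset.sum_div, Finset.sum_add_distrib,
    Finset.sum_sub_distrib, Finset.sum_const, Finset.card_univ, nsmul_eq_mul, mul_one]
  field_simp
  ring

theorem sum_measured_sum_average {A D κ κ' M : Type} [Fintype A] [DecidableEq A] [Fintype D]
    [DecidableEq D] [Fintype κ] [Fintype κ'] [AddCommGroup M] [Module ℂ M]
    {f : Bits D → State A → M} (hf : ∀ T, IsLinearMap ℂ (f T))
    (ρ : κ → κ' → State A) (c : κ → κ' → Bits D) :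
    ∑ t, f t (measured (∑ x, average fun y => tensor (ρ x y) (basisState (c x y))) t) =
      ∑ x, average fun y => f (c x y) (ρ x y) := by
  have hlin := linear_finset_sum fun t : Bits D => linear_comp (hf t) (measured_linear t)
  rw [linear_sum hlin]
  refine Finset.sum_congr rfl fun x _ => ?_
  rw [linear_average hlin]
  refine congrArg average (funext fun y => ?_)
  have := sum_measured_sum_tensor hf (fun _ : Unit => ρ x y) fun _ => c x y
  simp only [Finset.univ_unique, Finset.sum_singleton] at this
  exact this

variable (E : Scheme) (n : ℕ) (A : SEMAdversary (E.msgLen n) (E.ctLen n))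

/-- The probability that the distinguisher accepts the answer of the adversary if the plaintext for
the template `T` and the seed `y` is replaced by `ω T y`. -/
def hybridAccept (D : Distinguisher (E.msgLen n) A.shape)
    (ω : Bits (TemplateBit (E.msgLen n) A.shape) → Bits (Fin A.shape.seed) →
      State (Fin (E.msgLen n))) : ℝ :=
  average fun y => ∑ T, accept D T y (average fun g => hybridOutput E n A (ω T y) g T y)

/-- The answer of the distinguisher for fixed key coins. -/
def hybridAnswer (D : Distinguisher (E.msgLen n) A.shape)
    (ω : Bits (TemplateBit (E.msgLen n) A.shape) → Bits (Fin A.shape.seed) →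
      State (Fin (E.msgLen n))) (g : Bits (Fin (E.genCoins n))) : State (Fin 1) :=
  ∑ T, average fun y => D.run (tensor (basisState T) (tensor (basisState y)
    (hybridOutput E n A (ω T y) g T y)))

variable {E n A}

theorem hybridAccept_eq (D : Distinguisher (E.msgLen n) A.shape)
    (ω : Bits (TemplateBit (E.msgLen n) A.shape) → Bits (Fin A.shape.seed) →
      State (Fin (E.msgLen n))) :
    hybridAccept E n A D ω = average fun g => probBit (hybridAnswer E n A D ω g) true := by
  have h : ∀ g, probBit (hybridAnswer E n A D ω g) true =
      average fun y => ∑ T, accept D T y (hybridOutput E n A (ω T y) g T y) := by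
    intro g
    rw [hybridAnswer, probBit_linear_sum, average_sum]
    exact Finset.sum_congr rfl fun T _ => probBit_average _ _
  simp only [h, hybridAccept, accept_linear_average]
  rw [average_comm]
  exact congrArg average (funext fun y => (average_sum _).symm)

/-- Normalisation allows the probability of the answer 0 to be written as 1 minus that of the answer
1. -/
theorem trace_hybridAnswer (D : Distinguisher (E.msgLen n) A.shape)
    {ω : Bits (TemplateBit (E.msgLen n) A.shape) → Bits (Fin A.shape.seed) →
      State (Fin (E.msgLen n))} (hω : ∀ T y, (ω T y).trace = 1) (g : Bits (Fin (E.genCoins n))) :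
    (hybridAnswer E n A D ω g).trace = 1 := by
  have h : ∀ T y, (hybridOutput E n A (ω T y) g T y).trace =
      (advMemory E n A (E.key n g) T).trace := by
    intro T y
    rw [hybridOutput, OCircuit.trace_run, trace_tensor, trace_tensor, E.trace_encState, hω,
      trace_adviceState, mul_one, mul_one]
  simp only [hybridAnswer, Matrix.trace_sum, trace_average, QCircuit.trace_run, trace_tensor,
    trace_basisState, one_mul, h, average_const]
  simp only [advMemory]
  rw [sum_trace_measured, OCircuit.trace_run, trace_basisState]

theorem trace_describedState {m : ℕ} {f : Format} (d : Bits (StateDescBit m f)) :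
    (describedState d).trace = 1 := by
  rw [describedState, QCircuit.trace_run, trace_basisState]

/-- The bit of the distinguisher serves as the guess; the success probability is the mean of the
probability of answering 1 when b = 1 and of answering 0 when b = 0. The plaintext offered for the
challenge bit `b` is described by `sel b`. -/
theorem exists_indAdversary (D : Distinguisher (E.msgLen n) A.shape) (f : Format)
    (sel : Bool → StateDescBit (E.msgLen n) f →
      Bool ⊕ (TemplateBit (E.msgLen n) A.shape ⊕ Fin A.shape.seed)) :
    ∃ a : INDAdversary (E.msgLen n) (E.ctLen n),
      a.size ≤ f.size + 40 * A.size + 40 * Fintype.card (TemplateBit (E.msgLen n) A.shape) +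
        10 * Fintype.card (StateDescBit (E.msgLen n) f) + E.msgLen n + E.ctLen n + D.size + 5 ∧
      indSuccess E n a = 1 / 2 +
        (hybridAccept E n A D (fun T y => describedState (fill (sel true) (Sum.elim T y))) -
          hybridAccept E n A D (fun T y => describedState (fill (sel false) (Sum.elim T y)))) /
            2 := by
  obtain ⟨C, hC, hc⟩ := exists_hybrid_choose A.choose (Sum.elim (sel false) (sel true))
    (Fintype.equivFin _) (fun k => E.enc n k)
  obtain ⟨G, hG, hg⟩ := exists_hybrid_guess A.respond D (Fintype.equivFin _) (fun k => E.enc n k)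
  refine ⟨⟨f, _, C, G⟩, ?_, ?_⟩
  · have e1 : A.size = A.shape.size + (0 + (A.mem +
        Fintype.card (TemplateBit (E.msgLen n) A.shape)) + A.choose.work +
          A.choose.instrs.length) + A.respond.size := by
      simp only [SEMAdversary.size, OCircuit.size, Fintype.card_sum, Fintype.card_fin]
    have e2 : A.size = A.shape.size + A.choose.size + A.respond.size := rfl
    have e3 : A.shape.seed ≤ A.shape.size := by
      simp only [TemplateShape.size]
      omega
    simp only [INDAdversary.size]
    simp only [Fintype.card_sum, Fintype.card_fin] at hC hG e1 ⊢
    omega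
  · have h : ∀ (b : Bool) g, ∑ t, G.run (E.enc n (E.key n g)) (tensor
        (measured (C.run (E.enc n (E.key n g)) (basisState fun _ => false)) t)
        (E.encState n (E.key n g)
          (describedState fun i => t (if b then Sum.inr i else Sum.inl i)))) =
        hybridAnswer E n A D (fun T y => describedState (fill (sel b) (Sum.elim T y))) g := by
      intro b g
      rw [hc]
      refine (sum_measured_sum_average (f := fun t ρ => G.run (E.enc n (E.key n g)) (tensor ρ
        (E.encState n (E.key n g)
          (describedState fun i => t (if b then Sum.inr i else Sum.inl i)))))
        (fun t => linear_comp (OCircuit.run_linear _ _) (linear_tensor_left _ linear_id))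
        _ _).trans (Finset.sum_congr rfl fun T _ => congrArg average (funext fun y => ?_))
      refine (hg _ _ _ _ _).trans ?_
      -- The half of the register that belongs to the challenge bit `b` was filled from `sel b`.
      cases b <;> rfl
    have h2 : ∀ g, (average fun b : Bool => probBit (hybridAnswer E n A D (fun T y =>
        describedState (fill (sel b) (Sum.elim T y))) g) b) =
        (probBit (hybridAnswer E n A D (fun T y =>
          describedState (fill (sel true) (Sum.elim T y))) g) true -
        probBit (hybridAnswer E n A D (fun T y =>
          describedState (fill (sel false) (Sum.elim T y))) g) true + 1) / 2 := by
      intro g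
      have := probBit_add (hybridAnswer E n A D (fun T y =>
          describedState (fill (sel false) (Sum.elim T y))) g)
      rw [trace_hybridAnswer D (fun T y => trace_describedState _), Complex.one_re] at this
      rw [average_bool]
      linarith
    simp only [indSuccess, ← probBit_linear_sum, h, h2]
    rw [average_half_sub, hybridAccept_eq, hybridAccept_eq]

/-- Security bounds only the excess of the success probability over 1/2, not its absolute deviation.
Exchanging the two descriptions changes the sign of the gap, so the maximum over the two adversaries
recovers its absolute value. -/
theorem exists_hybrid_adversaries (D : Distinguisher (E.msgLen n) A.shape) :
    ∃ (f : Format) (a a' : INDAdversary (E.msgLen n) (E.ctLen n)),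
      f.size ≤ 2 * A.shape.size + Fintype.card (TemplateBit (E.msgLen n) A.shape) ∧
      (∀ a₁ ∈ [a, a'], a₁.size ≤ f.size + 40 * A.size +
        40 * Fintype.card (TemplateBit (E.msgLen n) A.shape) +
        10 * Fintype.card (StateDescBit (E.msgLen n) f) + E.msgLen n + E.ctLen n + D.size + 5) ∧
      |hybridAccept E n A D plaintext - hybridAccept E n A D fun _ _ => zeroState _| =
        2 * max (indSuccess E n a - 1 / 2) (indSuccess E n a' - 1 / 2) := by
  obtain ⟨f, sel, hf₁, hf₂, hsel⟩ := exists_plaintextDesc (E.msgLen n) A.shape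
  have h0 : ∀ T y, describedState (fill (fun _ : StateDescBit (E.msgLen n) f =>
      (Sum.inl false : Bool ⊕ (TemplateBit (E.msgLen n) A.shape ⊕ Fin A.shape.seed)))
      (Sum.elim T y)) = zeroState _ := fun T y => describedState_zero
  obtain ⟨a, ha, h⟩ := exists_indAdversary D f fun b => if b then sel else fun _ => Sum.inl false
  obtain ⟨a', ha', h'⟩ := exists_indAdversary D f fun b => if b then fun _ => Sum.inl false else sel
  refine ⟨f, a, a', ?_, ?_, ?_⟩
  · simp only [Format.size, TemplateShape.size] at *
    omega
  · simp only [List.mem_cons, List.not_mem_nil, or_false, forall_eq_or_imp, forall_eq]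
    exact ⟨ha, ha'⟩
  · simp only [if_true, Bool.false_eq_true, if_false, hsel, h0] at h h'
    have e : hybridAccept E n A D plaintext = hybridAccept E n A D fun T y => plaintext T y := rfl
    rw [h, h', e, abs_eq_max_neg, mul_max_of_nonneg _ _ (by norm_num : (0 : ℝ) ≤ 2)]
    congr 1 <;> ring

end HybridArgument

theorem QINDqCPA.qSEMqCPA {E : Scheme} (h : QINDqCPA E) : QSEMqCPA E := by
  intro A hA
  choose S hsize hprob hout using fun n => exists_simulator E n (A n)
  refine ⟨S, ?_, hprob, fun D hD => ?_⟩
  · exact (((PolyBounded.const 40).mul ((hA.add E.gen_poly).add E.enc_poly)).add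
      (hA.mul (((PolyBounded.const 4).mul E.enc_poly).add (PolyBounded.const 1)))).mono hsize
  · choose f a a' hf ha hadv using fun n => exists_hybrid_adversaries (D n)
    have hshape : PolyBounded fun n => (A n).shape.size :=
      hA.mono fun n => by
        simp only [SEMAdversary.size]
        omega
    have hT := card_templateBit_bounded hshape E.msgLen_bounded
    have hfmt := (((PolyBounded.const 2).mul hshape).add hT).mono hf
    have hdesc : PolyBounded fun n => Fintype.card (StateDescBit (E.msgLen n) (f n)) := by
      refine card_descBit_bounded hfmt ?_ ?_ <;> simp only [Fintype.card_fin]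
      · exact PolyBounded.const 0
      · exact E.msgLen_bounded
    have hct : PolyBounded E.ctLen := E.enc_poly.mono fun n => by
      simp only [CCircuit.size, Fintype.card_sum, Fintype.card_fin]
      omega
    have hbound := ((((((hfmt.add ((PolyBounded.const 40).mul hA)).add
      ((PolyBounded.const 40).mul hT)).add ((PolyBounded.const 10).mul hdesc)).add
      E.msgLen_bounded).add hct).add hD).add (PolyBounded.const 5)
    have h1 := h a (hbound.mono fun n => ha n _ (by simp))
    have h2 := h a' (hbound.mono fun n => ha n _ (by simp))
    refine (h1.max h2).two_mul.mono fun n => ?_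
    rw [← hadv n]
    have e1 : simTemplateProb (S n) = advTemplateProb E n (A n) := funext (hprob n)
    have e2 : simOutput (S n) = fun T y =>
        average fun g => hybridOutput E n (A n) (zeroState _) g T y :=
      funext fun T => funext fun y => hout n T y
    rw [e1, e2, advantage, advantage]
    -- By the reverse triangle inequality the outer absolute values may be dropped. The target terms
    -- are then identical and cancel, and what is left is by definition the gap between the two
    -- hybrids.
    refine (abs_abs_sub_abs_le _ _).trans (le_of_eq ?_)
    rw [sub_sub_sub_cancel_right]
    rfl

end
end QEnc

theorem mainTheorem1 (E : QEnc.Scheme) : QEnc.QINDqCPA E ↔ QEnc.QSEMqCPA E :=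
  ⟨QEnc.QINDqCPA.qSEMqCPA, QEnc.QSEMqCPA.qINDqCPA⟩
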